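/- **Conventions.** Let $\mathbf F$ be a field of characteristic $0$. In a strict 2-category, $fg$ is the composite "first $f$, then $g$" of 1-morphisms, $\alpha\cdot\beta$ is vertical composition (first $\alpha$, then $\beta$) and $\alpha\circ\beta$ is horizontal composition of 2-morphisms; a 1-morphism in a horizontal composite stands for its identity 2-morphism. $\mathrm{Hom}(A,B)$ is the category of 1-morphisms $A\to B$ and 2-morphisms between them, $\mathrm{2Hom}(f,g)$ the set of 2-morphisms $f\Rightarrow g$. **The 2-category.** Let $C$ be a finitely semi-simple, non-degenerate, $\mathrm{Vect}$-linear, semi-strict spherical 2-category over $\mathbf F$. This means the following. (a) *Semi-strict monoidal structure.* $C$ is a strict 2-category with strict 2-functors $A\otimes-$, $-\otimes A$ for every object $A$, strictly associative and with strict unit $I$, and with 2-isomorphisms (tensorators) $\otimes_{f,g}\colon (f\otimes B)(C\otimes g)\Rightarrow(A\otimes g)(f\otimes D)$ for $f\colon A\to C$, $g\colon B\to D$, natural in 2-morphisms and compatible with identities, composition and tensor products. (b) *Duals.* There are duals $\alpha^*\colon g\Rightarrow f$ of 2-morphisms $\alpha\colon f\Rightarrow g$; duals $f^*\colon B\to A$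 of 1-morphisms $f\colon A\to B$ with $i_f\colon 1_A\Rightarrow ff^*$ and $e_f\colon f^*f\Rightarrow 1_B$; duals $A^*$ of objects with $i_A\colon I\to A\otimes A^*$, $e_A\colon A^*\otimes A\to I$ and $T_A\colon (i_A\otimes A)(A\otimes e_A)\Rightarrow 1_A$. Put $\alpha^\dagger=(g^*\circ i_f)\cdot(g^*\circ\alpha\circ f^*)\cdot(e_g\circ f^*)$ and ${}^\dagger\alpha=(i_{f^*}\circ g^*)\cdot(f^*\circ\alpha\circ g^*)\cdot(f^*\circ e_{g^*})$; call $\alpha$ unitary if $\alpha^{-1}=\alpha^*$. The laws are: $X^{**}=X$ and $1_X^*=1_X$; $(\alpha\cdot\beta)^*=\beta^*\cdot\alpha^*$, $(\alpha\circ\beta)^*=\alpha^*\circ\beta^*$, $(fg)^*=g^*f^*$, $(A\otimes X)^*=A\otimes X^*$ and $(X\otimes A)^*=X^*\otimes A$ for $X$ a 1- or 2-morphism, $(A\otimes B)^*=B^*\otimes A^*$; $\otimes_{f,g}$ and $T_A$ are unitary; $i_{X^*}=e_X^*$ and $e_{X^*}=i_X^*$; $i_{A\otimes B}=i_A(A\otimes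 i_B\otimes A^*)$, $e_{A\otimes B}=(B^*\otimes e_A\otimes B)e_B$, $T_{A\otimes B}=[(i_A\otimes A\otimes B)\circ(A\otimes\otimes_{i_B,e_A}\otimes B)\circ(A\otimes B\otimes e_B)]\cdot[(T_A\otimes B)\circ(A\otimes T_B)]$, $T_I=1_{1_I}$; $i_{A\otimes f}=A\otimes i_f$, $i_{f\otimes A}=i_f\otimes A$ and likewise for $e$; $i_{fg}=i_f\cdot(f\circ i_g\circ f^*)$, $e_{fg}=(g^*\circ e_f\circ g)\cdot e_g$; $(i_f\circ f)\cdot(f\circ e_f)=1_f$, $(f^*\circ i_f)\cdot(e_f\circ f^*)=1_{f^*}$; $\alpha^{\dagger*}=\alpha^{*\dagger}$; and $[i_A\circ(A\otimes T_{A^*}^\dagger)]\cdot[\otimes_{i_A,i_A}\circ(A\otimes e_A\otimes A^*)]\cdot[i_A\circ(T_A\otimes A^*)]=1_{i_A}$. (c) *Pivotal structure.* For $f\colon A\to B$ put ${}^\#f=(i_{A^*}\otimes B^*)(A^*\otimes f\otimes B^*)(A^*\otimes e_{B^*})$ and $f^\#=(B^*\otimes i_A)(B^*\otimes f\otimes A^*)(e_B\otimes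 A^*)$, both $B^*\to A^*$, and similarly for 2-morphisms. There are unitary $\phi_f\colon {}^\#f\Rightarrow f^\#$, natural in $f$, with $\phi_f^\dagger=\phi_{f^*}$, compatible with the canonical 2-isomorphisms ${}^\#(fg)\cong{}^\#g\,{}^\#f$ and $(fg)^\#\cong g^\#f^\#$ built from tensorators and triangulators, and ${}^\#(\alpha^\dagger)={}^\dagger(\alpha^\#)$, $({}^\#\alpha)^\dagger=({}^\dagger\alpha)^\#$ for all $\alpha$. (d) *Consistency and sphericity.* For $f\colon A\to A$ put $\mathrm{Tr}_L(f)=i_{A^*}(A^*\otimes f)e_A$ and $\mathrm{Tr}_R(f)=i_A(f\otimes A^*)e_{A^*}$, and likewise on 2-morphisms. For $f\colon A\to B$ let $\cap^R_f=i_{i_A(f\otimes A^*)}\colon 1_I\Rightarrow\mathrm{Tr}_R(ff^*)$, $\cap^L_f=i_{i_{A^*}(A^*\otimes f)}\colon 1_I\Rightarrow\mathrm{Tr}_L(ff^*)$, $\cup^R_f=(\cap^R_f)^*$, $\cup^L_f=(\cap^L_f)^*$. The canonical 2-isomorphisms $\theta^R_{f,g}\colon\mathrm{Tr}_R(fg)\Rightarrow\mathrm{Tr}_R(gf)$,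 built from $T$, $\otimes$ and $\phi$, and their mirror images $\theta^L_{f,g}$, satisfy $\cap_f\cdot\theta_{f,f^*}=\cap_{f^*}$ and $\theta_{f,f^*}\cdot\cup_{f^*}=\cup_f$ (for $R$ and for $L$). There are unitary $\sigma_f\colon\mathrm{Tr}_L(f)\Rightarrow\mathrm{Tr}_R(f)$, natural in $f$, with $\cap^L_{1_A}\cdot\sigma_{1_A}=\cap^R_{1_A}$ and $\sigma_{1_A}\cdot\cup^R_{1_A}=\cup^L_{1_A}$. (e) *Linearity.* Every $\mathrm{Hom}(A,B)$ is an $\mathbf F$-linear category equivalent to $\mathrm{Vect}^n$ for some $n$, composition and tensor product are bilinear, $\mathrm{End}(I)\simeq\mathrm{Vect}$ and $\mathrm{2End}(1_I)=\mathbf F$. (f) *Non-degeneracy.* For $\alpha\colon f\Rightarrow g$ and $\beta\colon g\Rightarrow f$ put $\langle\alpha,\beta\rangle=\cap^R_f\cdot\mathrm{Tr}_R((\alpha\cdot\beta)\circ 1_{f^*})\cdot\cup^R_f\in\mathrm{2End}(1_I)=\mathbf F$. This symmetric bilinear pairing $\mathrm{2Hom}(f,g)\times\mathrm{2Hom}(g,f)\to\mathbf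 F$ is non-degenerate for all parallel $f,g$. The quantum dimensions are $\dim_q(f)=\langle 1_f,1_f\rangle$ and $\dim_q(A)=\dim_q(1_A)$. (g) *Semi-simplicity.* A finite set $\mathcal E$ of non-zero, pairwise non-equivalent objects is fixed such that composition gives equivalences $\bigoplus_{X\in\mathcal E}\mathrm{Hom}(A,X)\otimes\mathrm{Hom}(X,B)\simeq\mathrm{Hom}(A,B)$ for all $A,B$, and for all $A,B$ a finite basis $\mathcal F_{A,B}$ of simple objects of the 2-vector space $\mathrm{Hom}(A,B)$ is fixed. **Labels and state spaces.** Label the edges $(ij)$ of the 4-simplex $(01234)$ by $e_{ij}\in\mathcal E$ and the triangles $(ijk)$ by $f_{ijk}\in\mathcal F_{e_{ik},\,e_{jk}\otimes e_{ij}}$. For $i<j<k<l$ put $$f_{(ijk)l}=f_{ikl}(e_{kl}\otimes f_{ijk}),\qquad f_{i(jkl)}=f_{ijl}(f_{jkl}\otimes e_{ij}),\qquad 2H(ijkl)=\mathrm{2Hom}(f_{(ijk)l},f_{i(jkl)}),$$ and $2H(01234)=\mathrm{2Hom}(f_{((012)3)4},f_{0(1(234))})$, where $f_{((012)3)4}=f_{(023)4}(e_{34}\otimes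 e_{23}\otimes f_{012})$ and $f_{0(1(234))}=f_{0(124)}(f_{234}\otimes e_{12}\otimes e_{01})$. Consider the composition maps with values in $2H(01234)$ $$\beta\otimes\delta\mapsto\beta\delta=(\beta\circ(e_{34}\otimes e_{23}\otimes f_{012}))\cdot(f_{024}\circ\otimes_{f_{234},f_{012}})\cdot(\delta\circ(f_{234}\otimes e_{12}\otimes e_{01})),$$ $$\alpha\otimes\gamma\otimes\epsilon\mapsto\epsilon\gamma\alpha=(f_{034}\circ(e_{34}\otimes\epsilon))\cdot(\gamma\circ(e_{34}\otimes f_{123}\otimes e_{01}))\cdot(f_{014}\circ(\alpha\otimes e_{01}))$$ on $2H(0234)\otimes 2H(0124)$ and $2H(1234)\otimes 2H(0134)\otimes 2H(0123)$ respectively. For 2-morphisms in the opposite directions, i.e. in the spaces $\mathrm{2Hom}(f_{i(jkl)},f_{(ijk)l})$, let $\delta'\beta'$ and $\alpha'\gamma'\epsilon'$ be the composites in the reversed order, with $\otimes_{f_{234},f_{012}}^{-1}$ in place of $\otimes_{f_{234},f_{012}}$. The partition functions are the linear maps $$Z(+(01234))\colon 2H(0234)\otimes 2H(0124)\to 2H(1234)\otimes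 2H(0134)\otimes 2H(0123),$$ $$Z(-(01234))\colon 2H(1234)\otimes 2H(0134)\otimes 2H(0123)\to 2H(0234)\otimes 2H(0124)$$ determined, with the pairings of the tensor factors multiplied, by $$\langle Z(+(01234))(\beta\otimes\delta),\ \alpha'\otimes\gamma'\otimes\epsilon'\rangle=\langle\beta\delta,\ \alpha'\gamma'\epsilon'\rangle,\qquad \langle \beta'\otimes\delta',\ Z(-(01234))(\alpha\otimes\gamma\otimes\epsilon)\rangle=\langle\delta'\beta',\ \epsilon\gamma\alpha\rangle .$$ **Lemma (crossing).** Fix all labels except $e_{13},f_{013},f_{123},f_{134},f_{024}$. Then the two composition maps $$\bigoplus_{f_{024}}2H(0234)\otimes 2H(0124)\longrightarrow 2H(01234)\longleftarrow\bigoplus_{e_{13},f_{013},f_{123},f_{134}}2H(1234)\otimes 2H(0134)\otimes 2H(0123)$$ are isomorphisms of vector spaces, where the sums run over $e_{13}\in\mathcal E$ and over the respective bases $\mathcal F$. The linear map $\Phi_{01234}$ from the left-hand sum to the right-hand sum whose components are $$\dim_q(e_{13})^{-1}\dim_q(f_{013})\dim_q(f_{123})\dim_q(f_{134})\;Z(+(01234))$$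 makes the triangle commute: the right-hand map composed after $\Phi_{01234}$ is the left-hand map. Moreover $\Phi_{01234}$ is invertible, and $\Phi_{01234}^{-1}$ is the map whose components are $\dim_q(f_{024})\,Z(-(01234))$. -/

import Mathlib

open CategoryTheory CategoryTheory.Limits TensorProduct

universe u v w x

/-! ## Strict 2-categories

A strict 2-category is presented by its sets of objects, `1`-morphisms and `2`-morphisms with source
and target maps and partially defined compositions.  In this form the strict laws are literal
equations.  Composition is written in diagrammatic order: `comp f g` is first `f`, then `g`.  The
compositions are only meaningful on composable pairs: every law carries the composability hypotheses
it needs, and nothing is required of the values on other pairs. -/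

/-- A strict 2-category. -/
structure StrictTwoCategory where
  /-- objects -/
  Obj : Type u
  /-- `1`-morphisms -/
  Mor₁ : Type v
  /-- `2`-morphisms -/
  Mor₂ : Type w
  /-- source object of a `1`-morphism -/
  dom : Mor₁ → Obj
  /-- target object of a `1`-morphism -/
  cod : Mor₁ → Obj
  /-- source `1`-morphism of a `2`-morphism -/
  src : Mor₂ → Mor₁
  /-- target `1`-morphism of a `2`-morphism -/
  tgt : Mor₂ → Mor₁
  dom_tgt : ∀ α, dom (tgt α) = dom (src α)
  cod_tgt : ∀ α, cod (tgt α) = cod (src α)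
  /-- identity `1`-morphism -/
  id₁ : Obj → Mor₁
  /-- composition of `1`-morphisms -/
  comp : Mor₁ → Mor₁ → Mor₁
  /-- identity `2`-morphism -/
  id₂ : Mor₁ → Mor₂
  /-- vertical composition of `2`-morphisms -/
  vcomp : Mor₂ → Mor₂ → Mor₂
  /-- horizontal composition of `2`-morphisms -/
  hcomp : Mor₂ → Mor₂ → Mor₂
  dom_id₁ : ∀ A, dom (id₁ A) = A
  cod_id₁ : ∀ A, cod (id₁ A) = A
  dom_comp : ∀ f g, cod f = dom g → dom (comp f g) = dom f
  cod_comp : ∀ f g, cod f = dom g → cod (comp f g) = cod g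
  id₁_comp : ∀ f, comp (id₁ (dom f)) f = f
  comp_id₁ : ∀ f, comp f (id₁ (cod f)) = f
  comp_assoc : ∀ f g h, cod f = dom g → cod g = dom h → comp (comp f g) h = comp f (comp g h)
  src_id₂ : ∀ f, src (id₂ f) = f
  tgt_id₂ : ∀ f, tgt (id₂ f) = f
  src_vcomp : ∀ α β, tgt α = src β → src (vcomp α β) = src α
  tgt_vcomp : ∀ α β, tgt α = src β → tgt (vcomp α β) = tgt β
  id₂_vcomp : ∀ α, vcomp (id₂ (src α)) α = α
  vcomp_id₂ : ∀ α, vcomp α (id₂ (tgt α)) = α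
  vcomp_assoc : ∀ α β γ, tgt α = src β → tgt β = src γ →
    vcomp (vcomp α β) γ = vcomp α (vcomp β γ)
  src_hcomp : ∀ α β, cod (src α) = dom (src β) → src (hcomp α β) = comp (src α) (src β)
  tgt_hcomp : ∀ α β, cod (src α) = dom (src β) → tgt (hcomp α β) = comp (tgt α) (tgt β)
  id_hcomp : ∀ α, hcomp (id₂ (id₁ (dom (src α)))) α = α
  hcomp_id : ∀ α, hcomp α (id₂ (id₁ (cod (src α)))) = α
  hcomp_assoc : ∀ α β γ, cod (src α) = dom (src β) → cod (src β) = dom (src γ) →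
    hcomp (hcomp α β) γ = hcomp α (hcomp β γ)
  id₂_comp : ∀ f g, cod f = dom g → id₂ (comp f g) = hcomp (id₂ f) (id₂ g)
  interchange : ∀ α α' β β', tgt α = src α' → tgt β = src β' → cod (src α) = dom (src β) →
    hcomp (vcomp α α') (vcomp β β') = vcomp (hcomp α β) (hcomp α' β')

infixl:80 " ∗₁ " => StrictTwoCategory.comp _
infixl:60 " ⊡ᵥ " => StrictTwoCategory.vcomp _
infixl:70 " ⊡ₕ " => StrictTwoCategory.hcomp _

namespace StrictTwoCategory

/-- The `1`-morphisms from `A` to `B`, i.e. the objects of the category `Hom(A, B)`. -/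
@[ext]
structure Hom (C : StrictTwoCategory.{u, v, w}) (A B : C.Obj) : Type v where
  /-- the underlying `1`-morphism -/
  val : C.Mor₁
  dom_eq : C.dom val = A
  cod_eq : C.cod val = B

/-- The set `2Hom(f, g)` of `2`-morphisms from `f` to `g`. -/
@[ext]
structure Hom₂ (C : StrictTwoCategory.{u, v, w}) {A B : C.Obj} (f g : C.Hom A B) : Type w where
  /-- the underlying `2`-morphism -/
  val : C.Mor₂
  src_eq : C.src val = f.val
  tgt_eq : C.tgt val = g.val

/-- `Hom(A, B)` as a category: its morphisms are the `2`-morphisms, composed vertically. -/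
instance homCategory (C : StrictTwoCategory.{u, v, w}) (A B : C.Obj) :
    Category.{w, v} (C.Hom A B) where
  Hom f g := C.Hom₂ f g
  id f := ⟨C.id₂ f.1, C.src_id₂ _, C.tgt_id₂ _⟩
  comp α β := ⟨α.1 ⊡ᵥ β.1,
    (C.src_vcomp _ _ (α.3.trans β.2.symm)).trans α.2,
    (C.tgt_vcomp _ _ (α.3.trans β.2.symm)).trans β.3⟩
  id_comp α := Hom₂.ext (by
    have h := C.id₂_vcomp α.1
    rwa [α.2] at h)
  comp_id α := Hom₂.ext (by
    have h := C.vcomp_id₂ α.1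
    rwa [α.3] at h)
  assoc α β γ := Hom₂.ext
    (C.vcomp_assoc _ _ _ (α.3.trans β.2.symm) (β.3.trans γ.2.symm))

variable {C : StrictTwoCategory.{u, v, w}}

/-- The identity `1`-morphism as an object of `Hom(A, A)`. -/
def idHom (A : C.Obj) : C.Hom A A := ⟨C.id₁ A, C.dom_id₁ A, C.cod_id₁ A⟩

/-- Composition of `1`-morphisms on the categories `Hom`. -/
def Hom.comp {A B D : C.Obj} (f : C.Hom A B) (g : C.Hom B D) : C.Hom A D :=
  ⟨f.1 ∗₁ g.1, (C.dom_comp _ _ (f.3.trans g.2.symm)).trans f.2,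
    (C.cod_comp _ _ (f.3.trans g.2.symm)).trans g.3⟩

theorem cod_src_eq_dom_src {A B D : C.Obj} {f f' : C.Hom A B} {g g' : C.Hom B D}
    (α : f ⟶ f') (β : g ⟶ g') : C.cod (C.src α.1) = C.dom (C.src β.1) := by
  rw [α.2, β.2, f.3, g.2]

/-- Horizontal composition of `2`-morphisms on the categories `Hom`. -/
def Hom.hcomp {A B D : C.Obj} {f f' : C.Hom A B} {g g' : C.Hom B D}
    (α : f ⟶ f') (β : g ⟶ g') : f.comp g ⟶ f'.comp g' :=
  ⟨α.1 ⊡ₕ β.1, by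
    rw [C.src_hcomp _ _ (cod_src_eq_dom_src α β), α.2, β.2]; rfl, by
    rw [C.tgt_hcomp _ _ (cod_src_eq_dom_src α β), α.3, β.3]; rfl⟩

/-- Equivalence of objects. -/
def Equivalent (A B : C.Obj) : Prop :=
  ∃ (f : C.Hom A B) (g : C.Hom B A),
    Nonempty (f.comp g ≅ idHom A) ∧ Nonempty (g.comp f ≅ idHom B)

/-- A non-zero object: `End(A)` is not the zero category. -/
def NonzeroObj (A : C.Obj) : Prop := ∃ f : C.Hom A A, ¬ IsZero f

end StrictTwoCategory

/-! ## Semi-strict monoidal structures -/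

/-- A semi-strict monoidal structure on a strict 2-category: for every object `A`, strict 2-functors
`A ⊗ -` and `- ⊗ A`, strictly unital and associative, and for all `1`-morphisms `f : A → C` and
`g : B → D` a `2`-isomorphism, the tensorator, `(f ⊗ B)(C ⊗ g) ⇒ (A ⊗ g)(f ⊗ D)`. -/
class SemistrictMonoidal (C : StrictTwoCategory.{u, v, w}) where
  /-- the identity object -/
  I : C.Obj
  /-- tensor product of objects -/
  tensorObj : C.Obj → C.Obj → C.Obj
  /-- `A ⊗ f` -/
  tl₁ : C.Obj → C.Mor₁ → C.Mor₁
  /-- `f ⊗ A` -/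
  tr₁ : C.Mor₁ → C.Obj → C.Mor₁
  /-- `A ⊗ α` -/
  tl₂ : C.Obj → C.Mor₂ → C.Mor₂
  /-- `α ⊗ A` -/
  tr₂ : C.Mor₂ → C.Obj → C.Mor₂
  -- `A ⊗ -` is a strict 2-functor
  dom_tl₁ : ∀ A f, C.dom (tl₁ A f) = tensorObj A (C.dom f)
  cod_tl₁ : ∀ A f, C.cod (tl₁ A f) = tensorObj A (C.cod f)
  src_tl₂ : ∀ A α, C.src (tl₂ A α) = tl₁ A (C.src α)
  tgt_tl₂ : ∀ A α, C.tgt (tl₂ A α) = tl₁ A (C.tgt α)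
  tl₁_id₁ : ∀ A B, tl₁ A (C.id₁ B) = C.id₁ (tensorObj A B)
  tl₁_comp : ∀ A f g, C.cod f = C.dom g → tl₁ A (f ∗₁ g) = tl₁ A f ∗₁ tl₁ A g
  tl₂_id₂ : ∀ A f, tl₂ A (C.id₂ f) = C.id₂ (tl₁ A f)
  tl₂_vcomp : ∀ A α β, C.tgt α = C.src β → tl₂ A (α ⊡ᵥ β) = tl₂ A α ⊡ᵥ tl₂ A β
  tl₂_hcomp : ∀ A α β, C.cod (C.src α) = C.dom (C.src β) →
    tl₂ A (α ⊡ₕ β) = tl₂ A α ⊡ₕ tl₂ A β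
  -- `- ⊗ A` is a strict 2-functor
  dom_tr₁ : ∀ f A, C.dom (tr₁ f A) = tensorObj (C.dom f) A
  cod_tr₁ : ∀ f A, C.cod (tr₁ f A) = tensorObj (C.cod f) A
  src_tr₂ : ∀ α A, C.src (tr₂ α A) = tr₁ (C.src α) A
  tgt_tr₂ : ∀ α A, C.tgt (tr₂ α A) = tr₁ (C.tgt α) A
  tr₁_id₁ : ∀ B A, tr₁ (C.id₁ B) A = C.id₁ (tensorObj B A)
  tr₁_comp : ∀ f g A, C.cod f = C.dom g → tr₁ (f ∗₁ g) A = tr₁ f A ∗₁ tr₁ g A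
  tr₂_id₂ : ∀ f A, tr₂ (C.id₂ f) A = C.id₂ (tr₁ f A)
  tr₂_vcomp : ∀ α β A, C.tgt α = C.src β → tr₂ (α ⊡ᵥ β) A = tr₂ α A ⊡ᵥ tr₂ β A
  tr₂_hcomp : ∀ α β A, C.cod (C.src α) = C.dom (C.src β) →
    tr₂ (α ⊡ₕ β) A = tr₂ α A ⊡ₕ tr₂ β A
  -- `I` is a strict unit
  unit_tensor : ∀ A, tensorObj I A = A
  tensor_unit : ∀ A, tensorObj A I = A
  tl₁_unit : ∀ f, tl₁ I f = f
  tr₁_unit : ∀ f, tr₁ f I = f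
  tl₂_unit : ∀ α, tl₂ I α = α
  tr₂_unit : ∀ α, tr₂ α I = α
  -- strict associativity
  tensor_assoc : ∀ A B D, tensorObj (tensorObj A B) D = tensorObj A (tensorObj B D)
  tl₁_tl₁ : ∀ A B f, tl₁ A (tl₁ B f) = tl₁ (tensorObj A B) f
  tr₁_tl₁ : ∀ A f B, tr₁ (tl₁ A f) B = tl₁ A (tr₁ f B)
  tr₁_tr₁ : ∀ f A B, tr₁ (tr₁ f A) B = tr₁ f (tensorObj A B)
  tl₂_tl₂ : ∀ A B α, tl₂ A (tl₂ B α) = tl₂ (tensorObj A B) α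
  tr₂_tl₂ : ∀ A α B, tr₂ (tl₂ A α) B = tl₂ A (tr₂ α B)
  tr₂_tr₂ : ∀ α A B, tr₂ (tr₂ α A) B = tr₂ α (tensorObj A B)
  /-- the tensorator -/
  tensorator : C.Mor₁ → C.Mor₁ → C.Mor₂
  /-- the inverse of the tensorator -/
  tensoratorInv : C.Mor₁ → C.Mor₁ → C.Mor₂
  src_tensorator : ∀ f g,
    C.src (tensorator f g) = tr₁ f (C.dom g) ∗₁ tl₁ (C.cod f) g
  tgt_tensorator : ∀ f g,
    C.tgt (tensorator f g) = tl₁ (C.dom f) g ∗₁ tr₁ f (C.cod g)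
  src_tensoratorInv : ∀ f g,
    C.src (tensoratorInv f g) = tl₁ (C.dom f) g ∗₁ tr₁ f (C.cod g)
  tgt_tensoratorInv : ∀ f g,
    C.tgt (tensoratorInv f g) = tr₁ f (C.dom g) ∗₁ tl₁ (C.cod f) g
  tensorator_inv : ∀ f g,
    tensorator f g ⊡ᵥ tensoratorInv f g = C.id₂ (tr₁ f (C.dom g) ∗₁ tl₁ (C.cod f) g)
  inv_tensorator : ∀ f g,
    tensoratorInv f g ⊡ᵥ tensorator f g = C.id₂ (tl₁ (C.dom f) g ∗₁ tr₁ f (C.cod g))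
  -- compatibility of the tensorator with the tensor product
  tensorator_tl : ∀ A f g, tensorator (tl₁ A f) g = tl₂ A (tensorator f g)
  tensorator_mid : ∀ f A g, tensorator (tr₁ f A) g = tensorator f (tl₁ A g)
  tensorator_tr : ∀ f g A, tensorator f (tr₁ g A) = tr₂ (tensorator f g) A
  -- compatibility with identities
  tensorator_id_left : ∀ A g, tensorator (C.id₁ A) g = C.id₂ (tl₁ A g)
  tensorator_id_right : ∀ f A, tensorator f (C.id₁ A) = C.id₂ (tr₁ f A)
  -- naturality in both variables
  tensorator_natural : ∀ α β,
    (tr₂ α (C.dom (C.src β)) ⊡ₕ tl₂ (C.cod (C.src α)) β) ⊡ᵥ tensorator (C.tgt α) (C.tgt β) =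
      tensorator (C.src α) (C.src β) ⊡ᵥ
        (tl₂ (C.dom (C.src α)) β ⊡ₕ tr₂ α (C.cod (C.src β)))
  -- compatibility with composition in both variables
  tensorator_comp_left : ∀ f f' g, C.cod f = C.dom f' →
    tensorator (f ∗₁ f') g =
      (C.id₂ (tr₁ f (C.dom g)) ⊡ₕ tensorator f' g) ⊡ᵥ
        (tensorator f g ⊡ₕ C.id₂ (tr₁ f' (C.cod g)))
  tensorator_comp_right : ∀ f g g', C.cod g = C.dom g' →
    tensorator f (g ∗₁ g') =
      (tensorator f g ⊡ₕ C.id₂ (tl₁ (C.cod f) g')) ⊡ᵥ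
        (C.id₂ (tl₁ (C.dom f) g) ⊡ₕ tensorator f g')

infixr:90 " ⊗ₒ " => SemistrictMonoidal.tensorObj
infixr:90 " ◁₁ " => SemistrictMonoidal.tl₁
infixl:92 " ▷₁ " => SemistrictMonoidal.tr₁
infixr:90 " ◁₂ " => SemistrictMonoidal.tl₂
infixl:92 " ▷₂ " => SemistrictMonoidal.tr₂

open SemistrictMonoidal

namespace StrictTwoCategory

variable {C : StrictTwoCategory.{u, v, w}} [SemistrictMonoidal C]

/-- `A ⊗ f` on the categories `Hom`. -/
def Hom.tensorLeft {X Y : C.Obj} (A : C.Obj) (f : C.Hom X Y) : C.Hom (A ⊗ₒ X) (A ⊗ₒ Y) :=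
  ⟨A ◁₁ f.1, by rw [dom_tl₁, f.2], by rw [cod_tl₁, f.3]⟩

/-- `f ⊗ A` on the categories `Hom`. -/
def Hom.tensorRight {X Y : C.Obj} (f : C.Hom X Y) (A : C.Obj) : C.Hom (X ⊗ₒ A) (Y ⊗ₒ A) :=
  ⟨f.1 ▷₁ A, by rw [dom_tr₁, f.2], by rw [cod_tr₁, f.3]⟩

/-- `A ⊗ α` on the categories `Hom`. -/
def Hom.tensorLeft₂ {X Y : C.Obj} (A : C.Obj) {f g : C.Hom X Y} (α : f ⟶ g) :
    f.tensorLeft A ⟶ g.tensorLeft A :=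
  ⟨A ◁₂ α.1, by rw [src_tl₂, α.2]; rfl, by rw [tgt_tl₂, α.3]; rfl⟩

/-- `α ⊗ A` on the categories `Hom`. -/
def Hom.tensorRight₂ {X Y : C.Obj} {f g : C.Hom X Y} (α : f ⟶ g) (A : C.Obj) :
    f.tensorRight A ⟶ g.tensorRight A :=
  ⟨α.1 ▷₂ A, by rw [src_tr₂, α.2]; rfl, by rw [tgt_tr₂, α.3]; rfl⟩

end StrictTwoCategory

/-! ## Duals -/

/-- The operations of a duality, with their sources and targets. -/
class DualData (C : StrictTwoCategory.{u, v, w}) [SemistrictMonoidal C] where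
  /-- dual of an object -/
  dual₀ : C.Obj → C.Obj
  /-- dual of a `1`-morphism -/
  dual₁ : C.Mor₁ → C.Mor₁
  /-- dual of a `2`-morphism -/
  dual₂ : C.Mor₂ → C.Mor₂
  /-- the unit `i_A : I → A ⊗ A*` of an object -/
  unit₀ : C.Obj → C.Mor₁
  /-- the counit `e_A : A* ⊗ A → I` of an object -/
  counit₀ : C.Obj → C.Mor₁
  /-- the unit `i_f : 1_A ⇒ f f*` of a `1`-morphism -/
  unit₁ : C.Mor₁ → C.Mor₂
  /-- the counit `e_f : f* f ⇒ 1_B` of a `1`-morphism -/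
  counit₁ : C.Mor₁ → C.Mor₂
  /-- the triangulator `T_A : (i_A ⊗ A)(A ⊗ e_A) ⇒ 1_A` -/
  triangulator : C.Obj → C.Mor₂
  src_dual₂ : ∀ α, C.src (dual₂ α) = C.tgt α
  tgt_dual₂ : ∀ α, C.tgt (dual₂ α) = C.src α
  dom_dual₁ : ∀ f, C.dom (dual₁ f) = C.cod f
  cod_dual₁ : ∀ f, C.cod (dual₁ f) = C.dom f
  src_unit₁ : ∀ f, C.src (unit₁ f) = C.id₁ (C.dom f)
  tgt_unit₁ : ∀ f, C.tgt (unit₁ f) = f ∗₁ dual₁ f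
  src_counit₁ : ∀ f, C.src (counit₁ f) = dual₁ f ∗₁ f
  tgt_counit₁ : ∀ f, C.tgt (counit₁ f) = C.id₁ (C.cod f)
  dom_unit₀ : ∀ A, C.dom (unit₀ A) = I
  cod_unit₀ : ∀ A, C.cod (unit₀ A) = A ⊗ₒ dual₀ A
  dom_counit₀ : ∀ A, C.dom (counit₀ A) = dual₀ A ⊗ₒ A
  cod_counit₀ : ∀ A, C.cod (counit₀ A) = I
  src_triangulator : ∀ A, C.src (triangulator A) = unit₀ A ▷₁ A ∗₁ A ◁₁ counit₀ A
  tgt_triangulator : ∀ A, C.tgt (triangulator A) = C.id₁ A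

open DualData

section DualDefs

variable {C : StrictTwoCategory.{u, v, w}} [SemistrictMonoidal C] [DualData C]

/-- A `2`-morphism is unitary if its dual is its inverse. -/
def Unitary₂ (α : C.Mor₂) : Prop :=
  α ⊡ᵥ dual₂ α = C.id₂ (C.src α) ∧ dual₂ α ⊡ᵥ α = C.id₂ (C.tgt α)

/-- The adjoint `α† : g* ⇒ f*` of `α : f ⇒ g`. -/
def adjoint₂ (α : C.Mor₂) : C.Mor₂ :=
  (C.id₂ (dual₁ (C.tgt α)) ⊡ₕ unit₁ (C.src α)) ⊡ᵥ
    (C.id₂ (dual₁ (C.tgt α)) ⊡ₕ α ⊡ₕ C.id₂ (dual₁ (C.src α))) ⊡ᵥ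
    (counit₁ (C.tgt α) ⊡ₕ C.id₂ (dual₁ (C.src α)))

/-- The other adjoint `†α : g* ⇒ f*` of `α : f ⇒ g`. -/
def leftAdjoint₂ (α : C.Mor₂) : C.Mor₂ :=
  (unit₁ (dual₁ (C.src α)) ⊡ₕ C.id₂ (dual₁ (C.tgt α))) ⊡ᵥ
    (C.id₂ (dual₁ (C.src α)) ⊡ₕ α ⊡ₕ C.id₂ (dual₁ (C.tgt α))) ⊡ᵥ
    (C.id₂ (dual₁ (C.src α)) ⊡ₕ counit₁ (dual₁ (C.tgt α)))

end DualDefs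

/-- The laws of a semi-strict monoidal 2-category with duals. -/
class HasDuals (C : StrictTwoCategory.{u, v, w}) [SemistrictMonoidal C] [DualData C] : Prop where
  dual₀_dual₀ : ∀ A : C.Obj, dual₀ (dual₀ A) = A
  dual₁_dual₁ : ∀ f : C.Mor₁, dual₁ (dual₁ f) = f
  dual₂_dual₂ : ∀ α : C.Mor₂, dual₂ (dual₂ α) = α
  dual₁_id₁ : ∀ A, dual₁ (C.id₁ A) = C.id₁ A
  dual₂_id₂ : ∀ f, dual₂ (C.id₂ f) = C.id₂ f
  dual₂_vcomp : ∀ α β : C.Mor₂, C.tgt α = C.src β → dual₂ (α ⊡ᵥ β) = dual₂ β ⊡ᵥ dual₂ α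
  dual₂_hcomp : ∀ α β : C.Mor₂, C.cod (C.src α) = C.dom (C.src β) →
    dual₂ (α ⊡ₕ β) = dual₂ α ⊡ₕ dual₂ β
  dual₁_comp : ∀ f g : C.Mor₁, C.cod f = C.dom g → dual₁ (f ∗₁ g) = dual₁ g ∗₁ dual₁ f
  dual₂_tl₂ : ∀ (A : C.Obj) (α : C.Mor₂), dual₂ (A ◁₂ α) = A ◁₂ dual₂ α
  dual₁_tl₁ : ∀ (A : C.Obj) (f : C.Mor₁), dual₁ (A ◁₁ f) = A ◁₁ dual₁ f
  dual₂_tr₂ : ∀ (α : C.Mor₂) (A : C.Obj), dual₂ (α ▷₂ A) = dual₂ α ▷₂ A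
  dual₁_tr₁ : ∀ (f : C.Mor₁) (A : C.Obj), dual₁ (f ▷₁ A) = dual₁ f ▷₁ A
  dual₀_tensor : ∀ A B : C.Obj, dual₀ (A ⊗ₒ B) = dual₀ B ⊗ₒ dual₀ A
  unitary_tensorator : ∀ f g : C.Mor₁, Unitary₂ (tensorator f g)
  unit₀_dual : ∀ A : C.Obj, unit₀ (dual₀ A) = dual₁ (counit₀ A)
  counit₀_dual : ∀ A : C.Obj, counit₀ (dual₀ A) = dual₁ (unit₀ A)
  unit₁_dual : ∀ f : C.Mor₁, unit₁ (dual₁ f) = dual₂ (counit₁ f)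
  counit₁_dual : ∀ f : C.Mor₁, counit₁ (dual₁ f) = dual₂ (unit₁ f)
  unitary_triangulator : ∀ A : C.Obj, Unitary₂ (triangulator A)
  unit₀_tensor : ∀ A B : C.Obj,
    unit₀ (A ⊗ₒ B) = unit₀ A ∗₁ (A ◁₁ (unit₀ B ▷₁ dual₀ A))
  counit₀_tensor : ∀ A B : C.Obj,
    counit₀ (A ⊗ₒ B) = (dual₀ B ◁₁ (counit₀ A ▷₁ B)) ∗₁ counit₀ B
  triangulator_tensor : ∀ A B : C.Obj,
    triangulator (A ⊗ₒ B) =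
      (C.id₂ (unit₀ A ▷₁ (A ⊗ₒ B)) ⊡ₕ
        A ◁₂ (tensorator (unit₀ B) (counit₀ A) ▷₂ B) ⊡ₕ
        C.id₂ ((A ⊗ₒ B) ◁₁ counit₀ B)) ⊡ᵥ
      (triangulator A ▷₂ B ⊡ₕ A ◁₂ triangulator B)
  triangulator_unit : triangulator (I : C.Obj) = C.id₂ (C.id₁ I)
  unit₁_tl₁ : ∀ (A : C.Obj) (f : C.Mor₁), unit₁ (A ◁₁ f) = A ◁₂ unit₁ f
  unit₁_tr₁ : ∀ (f : C.Mor₁) (A : C.Obj), unit₁ (f ▷₁ A) = unit₁ f ▷₂ A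
  counit₁_tl₁ : ∀ (A : C.Obj) (f : C.Mor₁), counit₁ (A ◁₁ f) = A ◁₂ counit₁ f
  counit₁_tr₁ : ∀ (f : C.Mor₁) (A : C.Obj), counit₁ (f ▷₁ A) = counit₁ f ▷₂ A
  unit₁_comp : ∀ f g : C.Mor₁, C.cod f = C.dom g →
    unit₁ (f ∗₁ g) = unit₁ f ⊡ᵥ (C.id₂ f ⊡ₕ unit₁ g ⊡ₕ C.id₂ (dual₁ f))
  counit₁_comp : ∀ f g : C.Mor₁, C.cod f = C.dom g →
    counit₁ (f ∗₁ g) = (C.id₂ (dual₁ g) ⊡ₕ counit₁ f ⊡ₕ C.id₂ g) ⊡ᵥ counit₁ g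
  zigzag : ∀ f : C.Mor₁, (unit₁ f ⊡ₕ C.id₂ f) ⊡ᵥ (C.id₂ f ⊡ₕ counit₁ f) = C.id₂ f
  zigzag_dual : ∀ f : C.Mor₁,
    (C.id₂ (dual₁ f) ⊡ₕ unit₁ f) ⊡ᵥ (counit₁ f ⊡ₕ C.id₂ (dual₁ f)) = C.id₂ (dual₁ f)
  dual₂_adjoint₂ : ∀ α : C.Mor₂, dual₂ (adjoint₂ α) = adjoint₂ (dual₂ α)
  swallowtail : ∀ A : C.Obj,
    (C.id₂ (unit₀ A) ⊡ₕ A ◁₂ adjoint₂ (triangulator (dual₀ A))) ⊡ᵥ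
      (tensorator (unit₀ A) (unit₀ A) ⊡ₕ C.id₂ (A ◁₁ (counit₀ A ▷₁ dual₀ A))) ⊡ᵥ
      (C.id₂ (unit₀ A) ⊡ₕ triangulator A ▷₂ dual₀ A) = C.id₂ (unit₀ A)

/-! ## Pivotal and spherical structures -/

section PivotalDefs

variable {C : StrictTwoCategory.{u, v, w}} [SemistrictMonoidal C] [DualData C]

/-- `#f : B* → A*` for `f : A → B`. -/
def lsharp₁ (f : C.Mor₁) : C.Mor₁ :=
  unit₀ (dual₀ (C.dom f)) ▷₁ dual₀ (C.cod f) ∗₁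
    dual₀ (C.dom f) ◁₁ (f ▷₁ dual₀ (C.cod f)) ∗₁
    dual₀ (C.dom f) ◁₁ counit₀ (dual₀ (C.cod f))

/-- `f# : B* → A*` for `f : A → B`. -/
def rsharp₁ (f : C.Mor₁) : C.Mor₁ :=
  dual₀ (C.cod f) ◁₁ unit₀ (C.dom f) ∗₁
    dual₀ (C.cod f) ◁₁ (f ▷₁ dual₀ (C.dom f)) ∗₁
    counit₀ (C.cod f) ▷₁ dual₀ (C.dom f)

/-- `#α : #f ⇒ #g` for `α : f ⇒ g`, where `f, g : A → B`. -/
def lsharp₂ (α : C.Mor₂) : C.Mor₂ :=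
  C.id₂ (unit₀ (dual₀ (C.dom (C.src α))) ▷₁ dual₀ (C.cod (C.src α))) ⊡ₕ
    dual₀ (C.dom (C.src α)) ◁₂ (α ▷₂ dual₀ (C.cod (C.src α))) ⊡ₕ
    C.id₂ (dual₀ (C.dom (C.src α)) ◁₁ counit₀ (dual₀ (C.cod (C.src α))))

/-- `α# : f# ⇒ g#` for `α : f ⇒ g`, where `f, g : A → B`. -/
def rsharp₂ (α : C.Mor₂) : C.Mor₂ :=
  C.id₂ (dual₀ (C.cod (C.src α)) ◁₁ unit₀ (C.dom (C.src α))) ⊡ₕ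
    dual₀ (C.cod (C.src α)) ◁₂ (α ▷₂ dual₀ (C.dom (C.src α))) ⊡ₕ
    C.id₂ (counit₀ (C.cod (C.src α)) ▷₁ dual₀ (C.dom (C.src α)))

/-- The `2`-isomorphism `#(f g) ⇒ #g #f` for `f : X → Y`, `g : Y → Z`. -/
def lsharpComp (f g : C.Mor₁) : C.Mor₂ :=
  let X' := dual₀ (C.dom f)
  let Y := C.cod f
  let Y' := dual₀ Y
  let Z := C.cod g
  let Z' := dual₀ Z
  (C.id₂ (unit₀ X' ▷₁ Z' ∗₁ X' ◁₁ (f ▷₁ Z')) ⊡ₕ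
      X' ◁₂ (adjoint₂ (triangulator Y) ▷₂ Z') ⊡ₕ
      C.id₂ (X' ◁₁ (g ▷₁ Z') ∗₁ X' ◁₁ counit₀ Z')) ⊡ᵥ
    (C.id₂ (unit₀ X' ▷₁ Z' ∗₁ X' ◁₁ (f ▷₁ Z') ∗₁ (X' ⊗ₒ Y) ◁₁ (unit₀ Y' ▷₁ Z')) ⊡ₕ
      X' ◁₂ (tensorator (counit₀ Y') g ▷₂ Z') ⊡ₕ
      C.id₂ (X' ◁₁ counit₀ Z')) ⊡ᵥ
    (tensorator (unit₀ X' ∗₁ X' ◁₁ f) (unit₀ Y' ▷₁ Z' ∗₁ Y' ◁₁ (g ▷₁ Z')) ⊡ₕ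
      C.id₂ (X' ◁₁ (counit₀ Y' ▷₁ (Z ⊗ₒ Z')) ∗₁ X' ◁₁ counit₀ Z')) ⊡ᵥ
    (C.id₂ (unit₀ Y' ▷₁ Z' ∗₁ Y' ◁₁ (g ▷₁ Z')) ⊡ₕ
      tensorator (unit₀ X' ▷₁ Y' ∗₁ X' ◁₁ (f ▷₁ Y') ∗₁ X' ◁₁ counit₀ Y') (counit₀ Z'))

/-- The `2`-isomorphism `(f g)# ⇒ g# f#` for `f : X → Y`, `g : Y → Z`. -/
def rsharpComp (f g : C.Mor₁) : C.Mor₂ :=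
  let X := C.dom f
  let X' := dual₀ X
  let Y := C.cod f
  let Y' := dual₀ Y
  let Z := C.cod g
  let Z' := dual₀ Z
  (C.id₂ (Z' ◁₁ unit₀ X ∗₁ Z' ◁₁ (f ▷₁ X')) ⊡ₕ
      Z' ◁₂ (dual₂ (triangulator Y) ▷₂ X') ⊡ₕ
      C.id₂ (Z' ◁₁ (g ▷₁ X') ∗₁ counit₀ Z ▷₁ X')) ⊡ᵥ
    (C.id₂ (Z' ◁₁ unit₀ X ∗₁ Z' ◁₁ (f ▷₁ X') ∗₁ Z' ◁₁ (unit₀ Y ▷₁ (Y ⊗ₒ X'))) ⊡ₕ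
      Z' ◁₂ (tensoratorInv g (counit₀ Y) ▷₂ X') ⊡ₕ
      C.id₂ (counit₀ Z ▷₁ X')) ⊡ᵥ
    (tensoratorInv (Z' ◁₁ unit₀ Y ∗₁ Z' ◁₁ (g ▷₁ Y')) (unit₀ X ∗₁ f ▷₁ X') ⊡ₕ
      C.id₂ ((Z' ⊗ₒ Z) ◁₁ (counit₀ Y ▷₁ X') ∗₁ counit₀ Z ▷₁ X')) ⊡ᵥ
    (C.id₂ (Z' ◁₁ unit₀ Y ∗₁ Z' ◁₁ (g ▷₁ Y')) ⊡ₕ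
      tensoratorInv (counit₀ Z) (Y' ◁₁ unit₀ X ∗₁ Y' ◁₁ (f ▷₁ X') ∗₁ counit₀ Y ▷₁ X'))

/-- The left trace `Tr_L(f) : I → I` of `f : A → A`. -/
def trL₁ (f : C.Mor₁) : C.Mor₁ :=
  unit₀ (dual₀ (C.dom f)) ∗₁ dual₀ (C.dom f) ◁₁ f ∗₁ counit₀ (C.dom f)

/-- The right trace `Tr_R(f) : I → I` of `f : A → A`. -/
def trR₁ (f : C.Mor₁) : C.Mor₁ :=
  unit₀ (C.dom f) ∗₁ f ▷₁ dual₀ (C.dom f) ∗₁ counit₀ (dual₀ (C.dom f))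

/-- The left trace of a `2`-morphism between `1`-morphisms `A → A`. -/
def trL₂ (α : C.Mor₂) : C.Mor₂ :=
  C.id₂ (unit₀ (dual₀ (C.dom (C.src α)))) ⊡ₕ dual₀ (C.dom (C.src α)) ◁₂ α ⊡ₕ
    C.id₂ (counit₀ (C.dom (C.src α)))

/-- The right trace of a `2`-morphism between `1`-morphisms `A → A`. -/
def trR₂ (α : C.Mor₂) : C.Mor₂ :=
  C.id₂ (unit₀ (C.dom (C.src α))) ⊡ₕ α ▷₂ dual₀ (C.dom (C.src α)) ⊡ₕ
    C.id₂ (counit₀ (dual₀ (C.dom (C.src α))))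

/-- The cap `1_I ⇒ Tr_R(f f*)`. -/
def capR (f : C.Mor₁) : C.Mor₂ := unit₁ (unit₀ (C.dom f) ∗₁ f ▷₁ dual₀ (C.dom f))

/-- The cup `Tr_R(f f*) ⇒ 1_I`. -/
def cupR (f : C.Mor₁) : C.Mor₂ := dual₂ (capR f)

/-- The cap `1_I ⇒ Tr_L(f f*)`. -/
def capL (f : C.Mor₁) : C.Mor₂ := unit₁ (unit₀ (dual₀ (C.dom f)) ∗₁ dual₀ (C.dom f) ◁₁ f)

/-- The cup `Tr_L(f f*) ⇒ 1_I`. -/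
def cupL (f : C.Mor₁) : C.Mor₂ := dual₂ (capL f)

end PivotalDefs

/-- A semi-strict pivotal 2-category. -/
class Pivotal (C : StrictTwoCategory.{u, v, w}) [SemistrictMonoidal C] [DualData C]
    [HasDuals C] where
  /-- the `2`-morphisms `φ_f : #f ⇒ f#` -/
  φ : C.Mor₁ → C.Mor₂
  src_φ : ∀ f, C.src (φ f) = lsharp₁ f
  tgt_φ : ∀ f, C.tgt (φ f) = rsharp₁ f
  unitary_φ : ∀ f, Unitary₂ (φ f)
  φ_natural : ∀ α : C.Mor₂, lsharp₂ α ⊡ᵥ φ (C.tgt α) = φ (C.src α) ⊡ᵥ rsharp₂ α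
  adjoint_φ : ∀ f, adjoint₂ (φ f) = φ (dual₁ f)
  φ_comp : ∀ f g, C.cod f = C.dom g →
    φ (f ∗₁ g) ⊡ᵥ rsharpComp f g = lsharpComp f g ⊡ᵥ (φ g ⊡ₕ φ f)
  lsharp₂_adjoint : ∀ α : C.Mor₂, lsharp₂ (adjoint₂ α) = leftAdjoint₂ (rsharp₂ α)
  adjoint_lsharp₂ : ∀ α : C.Mor₂, adjoint₂ (lsharp₂ α) = rsharp₂ (leftAdjoint₂ α)

open Pivotal

section ThetaDefs

variable {C : StrictTwoCategory.{u, v, w}} [SemistrictMonoidal C] [DualData C] [HasDuals C]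
  [Pivotal C]

/-- The `2`-isomorphism `θ^R : Tr_R(f g) ⇒ Tr_R(g f)` for `f : X → Y`, `g : Y → X`. -/
def thetaR (f g : C.Mor₁) : C.Mor₂ :=
  let X := C.dom f
  let X' := dual₀ X
  let Y := C.cod f
  let Y' := dual₀ Y
  (C.id₂ (unit₀ X ∗₁ f ▷₁ X') ⊡ₕ adjoint₂ (triangulator Y) ▷₂ X' ⊡ₕ
      C.id₂ (g ▷₁ X' ∗₁ counit₀ X')) ⊡ᵥ
    (C.id₂ (unit₀ X ∗₁ f ▷₁ X' ∗₁ Y ◁₁ (unit₀ Y' ▷₁ X')) ⊡ₕ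
      tensorator (counit₀ Y') (g ▷₁ X' ∗₁ counit₀ X')) ⊡ᵥ
    (C.id₂ (unit₀ X ∗₁ f ▷₁ X') ⊡ₕ Y ◁₂ φ g ⊡ₕ C.id₂ (counit₀ Y')) ⊡ᵥ
    (tensorator (unit₀ X ∗₁ f ▷₁ X') (unit₀ Y ∗₁ g ▷₁ Y') ⊡ₕ
      C.id₂ (Y ◁₁ (counit₀ X ▷₁ Y') ∗₁ counit₀ Y')) ⊡ᵥ
    (C.id₂ (unit₀ Y ∗₁ g ▷₁ Y' ∗₁ unit₀ X ▷₁ (X ⊗ₒ Y')) ⊡ₕ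
      tensorator f (counit₀ X) ▷₂ Y' ⊡ₕ C.id₂ (counit₀ Y')) ⊡ᵥ
    (C.id₂ (unit₀ Y ∗₁ g ▷₁ Y') ⊡ₕ triangulator X ▷₂ Y' ⊡ₕ
      C.id₂ (f ▷₁ Y' ∗₁ counit₀ Y'))

/-- The `2`-isomorphism `θ^L : Tr_L(f g) ⇒ Tr_L(g f)` for `f : X → Y`, `g : Y → X`: the mirror image
of `θ^R`. -/
def thetaL (f g : C.Mor₁) : C.Mor₂ :=
  let X := C.dom f
  let X' := dual₀ X
  let Y := C.cod f
  let Y' := dual₀ Y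
  (C.id₂ (unit₀ X' ∗₁ X' ◁₁ f) ⊡ₕ X' ◁₂ dual₂ (triangulator Y) ⊡ₕ
      C.id₂ (X' ◁₁ g ∗₁ counit₀ X)) ⊡ᵥ
    (C.id₂ (unit₀ X' ∗₁ X' ◁₁ f ∗₁ X' ◁₁ (unit₀ Y ▷₁ Y)) ⊡ₕ
      tensoratorInv (X' ◁₁ g ∗₁ counit₀ X) (counit₀ Y)) ⊡ᵥ
    (C.id₂ (unit₀ X' ∗₁ X' ◁₁ f) ⊡ₕ dual₂ (φ g) ▷₂ Y ⊡ₕ C.id₂ (counit₀ Y)) ⊡ᵥ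
    (tensoratorInv (unit₀ Y' ∗₁ Y' ◁₁ g) (unit₀ X' ∗₁ X' ◁₁ f) ⊡ₕ
      C.id₂ (Y' ◁₁ (counit₀ X' ▷₁ Y) ∗₁ counit₀ Y)) ⊡ᵥ
    (C.id₂ (unit₀ Y' ∗₁ Y' ◁₁ g ∗₁ (Y' ⊗ₒ X) ◁₁ unit₀ X') ⊡ₕ
      Y' ◁₂ tensoratorInv (counit₀ X') f ⊡ₕ C.id₂ (counit₀ Y)) ⊡ᵥ
    (C.id₂ (unit₀ Y' ∗₁ Y' ◁₁ g) ⊡ₕ Y' ◁₂ dual₂ (adjoint₂ (triangulator X)) ⊡ₕ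
      C.id₂ (Y' ◁₁ f ∗₁ counit₀ Y))

end ThetaDefs

/-- A semi-strict pivotal 2-category is consistent if caps and cups are compatible with `θ`. -/
class ConsistentPivotal (C : StrictTwoCategory.{u, v, w}) [SemistrictMonoidal C] [DualData C]
    [HasDuals C] [Pivotal C] : Prop where
  capR_theta : ∀ f : C.Mor₁, capR f ⊡ᵥ thetaR f (dual₁ f) = capR (dual₁ f)
  theta_cupR : ∀ f : C.Mor₁, thetaR f (dual₁ f) ⊡ᵥ cupR (dual₁ f) = cupR f
  capL_theta : ∀ f : C.Mor₁, capL f ⊡ᵥ thetaL f (dual₁ f) = capL (dual₁ f)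
  theta_cupL : ∀ f : C.Mor₁, thetaL f (dual₁ f) ⊡ᵥ cupL (dual₁ f) = cupL f

/-- A semi-strict spherical 2-category. -/
class Spherical (C : StrictTwoCategory.{u, v, w}) [SemistrictMonoidal C] [DualData C]
    [HasDuals C] [Pivotal C] [ConsistentPivotal C] where
  /-- the `2`-morphisms `σ_f : Tr_L(f) ⇒ Tr_R(f)` for `f : A → A` -/
  σ : C.Mor₁ → C.Mor₂
  src_σ : ∀ f, C.cod f = C.dom f → C.src (σ f) = trL₁ f
  tgt_σ : ∀ f, C.cod f = C.dom f → C.tgt (σ f) = trR₁ f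
  unitary_σ : ∀ f, C.cod f = C.dom f → Unitary₂ (σ f)
  σ_natural : ∀ α : C.Mor₂, C.cod (C.src α) = C.dom (C.src α) →
    σ (C.src α) ⊡ᵥ trR₂ α = trL₂ α ⊡ᵥ σ (C.tgt α)
  capL_σ : ∀ A : C.Obj, capL (C.id₁ A) ⊡ᵥ σ (C.id₁ A) = capR (C.id₁ A)
  σ_cupR : ∀ A : C.Obj, σ (C.id₁ A) ⊡ᵥ cupR (C.id₁ A) = cupL (C.id₁ A)

/-! ## Linearity, non-degeneracy and semi-simplicity -/

/-- A category linear over a field `F` is a 2-vector space of finite rank `n` if it is equivalent, by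
a linear functor, to `Vectⁿ`. -/
def IsTwoVectorSpace (F : Type x) [Field F] (n : ℕ) (D : Type v) [Category.{w} D] [Preadditive D]
    [Linear F D] : Prop :=
  ∃ e : D ≌ (Discrete (Fin n) ⥤ FGModuleCat.{x} F), ∃ _ : e.functor.Additive, e.functor.Linear F

/-- A finite set of objects of a 2-vector space is a basis if its members are simple (their only
endomorphisms are the scalars), there are no morphisms other than zero between different members,
and every object is a finite direct sum of members. -/
structure IsTwoBasis (F : Type x) [Field F] {D : Type v} [Category.{w} D] [Preadditive D]
    [Linear F D] (S : Finset D) : Prop where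
  simple : ∀ X ∈ S, Function.Bijective (fun c : F => c • 𝟙 X)
  disjoint : ∀ X ∈ S, ∀ Y ∈ S, X ≠ Y → Subsingleton (X ⟶ Y)
  generates : ∀ Z : D, ∃ (n : ℕ) (X : Fin n → D) (b : Bicone X),
    (∀ k, X k ∈ S) ∧ b.pt = Z ∧ Nonempty b.IsBilimit

namespace StrictTwoCategory

/-- A semi-strict monoidal 2-category is `Vect`-linear if all categories `Hom(A, B)` are 2-vector
spaces of finite rank and composition and tensor product are bilinear. -/
class VectLinear (F : Type x) [Field F] (C : StrictTwoCategory.{u, v, w}) [SemistrictMonoidal C]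
    [∀ A B : C.Obj, Preadditive (C.Hom A B)] [∀ A B : C.Obj, Linear F (C.Hom A B)] : Prop where
  twoVect : ∀ A B : C.Obj, ∃ n, IsTwoVectorSpace F n (C.Hom A B)
  add_hcomp : ∀ {A B D : C.Obj} {f f' : C.Hom A B} {g g' : C.Hom B D} (α α' : f ⟶ f')
    (β : g ⟶ g'), Hom.hcomp (α + α') β = Hom.hcomp α β + Hom.hcomp α' β
  smul_hcomp : ∀ {A B D : C.Obj} {f f' : C.Hom A B} {g g' : C.Hom B D} (c : F) (α : f ⟶ f')
    (β : g ⟶ g'), Hom.hcomp (c • α) β = c • Hom.hcomp α β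
  hcomp_add : ∀ {A B D : C.Obj} {f f' : C.Hom A B} {g g' : C.Hom B D} (α : f ⟶ f')
    (β β' : g ⟶ g'), Hom.hcomp α (β + β') = Hom.hcomp α β + Hom.hcomp α β'
  hcomp_smul : ∀ {A B D : C.Obj} {f f' : C.Hom A B} {g g' : C.Hom B D} (c : F) (α : f ⟶ f')
    (β : g ⟶ g'), Hom.hcomp α (c • β) = c • Hom.hcomp α β
  tensorLeft_add : ∀ {X Y : C.Obj} (A : C.Obj) {f g : C.Hom X Y} (α β : f ⟶ g),
    Hom.tensorLeft₂ A (α + β) = Hom.tensorLeft₂ A α + Hom.tensorLeft₂ A β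
  tensorLeft_smul : ∀ {X Y : C.Obj} (A : C.Obj) {f g : C.Hom X Y} (c : F) (α : f ⟶ g),
    Hom.tensorLeft₂ A (c • α) = c • Hom.tensorLeft₂ A α
  tensorRight_add : ∀ {X Y : C.Obj} {f g : C.Hom X Y} (α β : f ⟶ g) (A : C.Obj),
    Hom.tensorRight₂ (α + β) A = Hom.tensorRight₂ α A + Hom.tensorRight₂ β A
  tensorRight_smul : ∀ {X Y : C.Obj} {f g : C.Hom X Y} (c : F) (α : f ⟶ g) (A : C.Obj),
    Hom.tensorRight₂ (c • α) A = c • Hom.tensorRight₂ α A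

/-- `End(I)` is equivalent to `Vect`, and `2End(1_I)` is the field `F`. -/
class ScalarUnit (F : Type x) [Field F] (C : StrictTwoCategory.{u, v, w}) [SemistrictMonoidal C]
    [∀ A B : C.Obj, Preadditive (C.Hom A B)] [∀ A B : C.Obj, Linear F (C.Hom A B)] : Prop where
  end_unit : IsTwoVectorSpace F 1 (C.Hom (I : C.Obj) I)
  scalar : Function.Bijective (fun c : F => c • 𝟙 (idHom (I : C.Obj)))

section DualHoms

variable {C : StrictTwoCategory.{u, v, w}} [SemistrictMonoidal C] [DualData C]

/-- The dual of a `1`-morphism on the categories `Hom`. -/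
def Hom.dual {A B : C.Obj} (f : C.Hom A B) : C.Hom B A :=
  ⟨dual₁ f.1, (dom_dual₁ _).trans f.3, (cod_dual₁ _).trans f.2⟩

variable [HasDuals C]

/-- `Tr_R(f)` as an object of `End(I)`. -/
def trRHom {A : C.Obj} (f : C.Hom A A) : C.Hom I I :=
  have h1 : C.cod (unit₀ (C.dom f.1)) = C.dom (f.1 ▷₁ dual₀ (C.dom f.1)) := by
    rw [cod_unit₀, dom_tr₁]
  have h2 : C.cod (unit₀ (C.dom f.1) ∗₁ f.1 ▷₁ dual₀ (C.dom f.1)) =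
      C.dom (counit₀ (dual₀ (C.dom f.1))) := by
    rw [C.cod_comp _ _ h1, cod_tr₁, dom_counit₀, HasDuals.dual₀_dual₀, f.2, f.3]
  ⟨trR₁ f.1, ((C.dom_comp _ _ h2).trans (C.dom_comp _ _ h1)).trans (dom_unit₀ _),
    (C.cod_comp _ _ h2).trans (cod_counit₀ _)⟩

theorem capR_typing {A B : C.Obj} (f : C.Hom A B) :
    C.src (capR f.1) = C.id₁ I ∧ C.tgt (capR f.1) = trR₁ (f.1 ∗₁ dual₁ f.1) := by
  have h0 : C.cod f.1 = C.dom (dual₁ f.1) := (dom_dual₁ _).symm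
  have h1 : C.cod (unit₀ (C.dom f.1)) = C.dom (f.1 ▷₁ dual₀ (C.dom f.1)) := by
    rw [cod_unit₀, dom_tr₁]
  refine ⟨by rw [capR, src_unit₁, C.dom_comp _ _ h1, dom_unit₀], ?_⟩
  rw [capR, tgt_unit₁, HasDuals.dual₁_comp _ _ h1, HasDuals.dual₁_tr₁, trR₁, C.dom_comp _ _ h0,
    tr₁_comp _ _ _ h0, HasDuals.counit₀_dual, C.comp_assoc, C.comp_assoc, C.comp_assoc]
  all_goals simp [C.dom_comp, C.cod_comp, cod_unit₀, dom_tr₁, cod_tr₁, dom_dual₁, cod_dual₁]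

end DualHoms

section Linear

variable (F : Type x) [Field F] {C : StrictTwoCategory.{u, v, w}} [SemistrictMonoidal C]
  [∀ A B : C.Obj, Preadditive (C.Hom A B)] [∀ A B : C.Obj, Linear F (C.Hom A B)]

/-- The identification of `2End(1_I)` with `F`. -/
noncomputable def scalarEquiv [ScalarUnit F C] :
    (idHom (I : C.Obj) ⟶ idHom (I : C.Obj)) ≃ₗ[F] F :=
  (LinearEquiv.ofBijective (LinearMap.toSpanSingleton F _ (𝟙 (idHom (I : C.Obj))))
    ScalarUnit.scalar).symm

variable [VectLinear F C]

instance finite_hom {A B : C.Obj} (f g : C.Hom A B) : Module.Finite F (f ⟶ g) := by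
  obtain ⟨n, e, hadd, hlin⟩ := VectLinear.twoVect (F := F) (C := C) A B
  let m : (f ⟶ g) →ₗ[F] (∀ i : Discrete (Fin n),
      (e.functor.obj f).obj i ⟶ (e.functor.obj g).obj i) :=
    { toFun := fun α i => (e.functor.map α).app i
      map_add' := fun α β => by
        funext i
        simp [e.functor.map_add]
      map_smul' := fun c α => by
        funext i
        simp [e.functor.map_smul] }
  refine Module.Finite.of_injective m (fun α β h => e.functor.map_injective ?_)
  ext1
  funext i
  exact congrFun h i

/-- Vertical composition as a bilinear map. -/
def vcompₗ {A B : C.Obj} (f g h : C.Hom A B) : (f ⟶ g) →ₗ[F] (g ⟶ h) →ₗ[F] (f ⟶ h) :=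
  Linear.comp f g h

/-- Horizontal composition as a bilinear map. -/
def hcompₗ {A B D : C.Obj} (f f' : C.Hom A B) (g g' : C.Hom B D) :
    (f ⟶ f') →ₗ[F] (g ⟶ g') →ₗ[F] (f.comp g ⟶ f'.comp g') :=
  LinearMap.mk₂ F Hom.hcomp (VectLinear.add_hcomp F) VectLinear.smul_hcomp
    (VectLinear.hcomp_add F) VectLinear.hcomp_smul

/-- The linear map `α ↦ α ∘ g`; the source and target of `α ∘ g` may be presented by any `h`, `h'`
equal to them. -/
def whiskerRightₗ {A B D : C.Obj} {f f' : C.Hom A B} (g : C.Mor₁) (hg : C.dom g = B)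
    (h h' : C.Hom A D) (e : h.1 = f.1 ∗₁ g) (e' : h'.1 = f'.1 ∗₁ g) :
    (f ⟶ f') →ₗ[F] (h ⟶ h') where
  toFun α := ⟨α.1 ⊡ₕ C.id₂ g, by
    rw [C.src_hcomp _ _ (by rw [α.2, C.src_id₂, f.3, hg]), α.2, C.src_id₂, e], by
    rw [C.tgt_hcomp _ _ (by rw [α.2, C.src_id₂, f.3, hg]), α.3, C.tgt_id₂, e']⟩
  map_add' α β := by
    obtain rfl : C.cod g = D := by
      rw [← h.3, e, C.cod_comp _ _ (by rw [f.3, hg])]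
    let g' : C.Hom B (C.cod g) := ⟨g, hg, rfl⟩
    obtain rfl : h = f.comp g' := Hom.ext e
    obtain rfl : h' = f'.comp g' := Hom.ext e'
    exact VectLinear.add_hcomp F α β (𝟙 g')
  map_smul' c α := by
    obtain rfl : C.cod g = D := by
      rw [← h.3, e, C.cod_comp _ _ (by rw [f.3, hg])]
    let g' : C.Hom B (C.cod g) := ⟨g, hg, rfl⟩
    obtain rfl : h = f.comp g' := Hom.ext e
    obtain rfl : h' = f'.comp g' := Hom.ext e'
    exact VectLinear.smul_hcomp c α (𝟙 g')

/-- The linear map `α ↦ g ∘ α`. -/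
def whiskerLeftₗ {A B D : C.Obj} {f f' : C.Hom A B} (g : C.Mor₁) (hg : C.cod g = A)
    (h h' : C.Hom D B) (e : h.1 = g ∗₁ f.1) (e' : h'.1 = g ∗₁ f'.1) :
    (f ⟶ f') →ₗ[F] (h ⟶ h') where
  toFun α := ⟨C.id₂ g ⊡ₕ α.1, by
    rw [C.src_hcomp _ _ (by rw [α.2, C.src_id₂, f.2, hg]), α.2, C.src_id₂, e], by
    rw [C.tgt_hcomp _ _ (by rw [α.2, C.src_id₂, f.2, hg]), α.3, C.tgt_id₂, e']⟩
  map_add' α β := by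
    obtain rfl : C.dom g = D := by
      rw [← h.2, e, C.dom_comp _ _ (by rw [f.2, hg])]
    let g' : C.Hom (C.dom g) A := ⟨g, rfl, hg⟩
    obtain rfl : h = g'.comp f := Hom.ext e
    obtain rfl : h' = g'.comp f' := Hom.ext e'
    exact VectLinear.hcomp_add F (𝟙 g') α β
  map_smul' c α := by
    obtain rfl : C.dom g = D := by
      rw [← h.2, e, C.dom_comp _ _ (by rw [f.2, hg])]
    let g' : C.Hom (C.dom g) A := ⟨g, rfl, hg⟩
    obtain rfl : h = g'.comp f := Hom.ext e
    obtain rfl : h' = g'.comp f' := Hom.ext e'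
    exact VectLinear.hcomp_smul c (𝟙 g') α

/-- The linear map `α ↦ A ⊗ α`. -/
def tensorLeftₗ {X Y P Q : C.Obj} (A : C.Obj) {f f' : C.Hom X Y}
    (h h' : C.Hom P Q) (e : h.1 = A ◁₁ f.1) (e' : h'.1 = A ◁₁ f'.1) :
    (f ⟶ f') →ₗ[F] (h ⟶ h') where
  toFun α := ⟨A ◁₂ α.1, by rw [src_tl₂, α.2, e], by rw [tgt_tl₂, α.3, e']⟩
  map_add' α β := by
    obtain rfl : A ⊗ₒ X = P := by rw [← h.2, e, dom_tl₁, f.2]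
    obtain rfl : A ⊗ₒ Y = Q := by rw [← h.3, e, cod_tl₁, f.3]
    obtain rfl : h = f.tensorLeft A := Hom.ext e
    obtain rfl : h' = f'.tensorLeft A := Hom.ext e'
    exact VectLinear.tensorLeft_add F A α β
  map_smul' c α := by
    obtain rfl : A ⊗ₒ X = P := by rw [← h.2, e, dom_tl₁, f.2]
    obtain rfl : A ⊗ₒ Y = Q := by rw [← h.3, e, cod_tl₁, f.3]
    obtain rfl : h = f.tensorLeft A := Hom.ext e
    obtain rfl : h' = f'.tensorLeft A := Hom.ext e'
    exact VectLinear.tensorLeft_smul A c α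

/-- The linear map `α ↦ α ⊗ A`. -/
def tensorRightₗ {X Y P Q : C.Obj} (A : C.Obj) {f f' : C.Hom X Y}
    (h h' : C.Hom P Q) (e : h.1 = f.1 ▷₁ A) (e' : h'.1 = f'.1 ▷₁ A) :
    (f ⟶ f') →ₗ[F] (h ⟶ h') where
  toFun α := ⟨α.1 ▷₂ A, by rw [src_tr₂, α.2, e], by rw [tgt_tr₂, α.3, e']⟩
  map_add' α β := by
    obtain rfl : X ⊗ₒ A = P := by rw [← h.2, e, dom_tr₁, f.2]
    obtain rfl : Y ⊗ₒ A = Q := by rw [← h.3, e, cod_tr₁, f.3]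
    obtain rfl : h = f.tensorRight A := Hom.ext e
    obtain rfl : h' = f'.tensorRight A := Hom.ext e'
    exact VectLinear.tensorRight_add F α β A
  map_smul' c α := by
    obtain rfl : X ⊗ₒ A = P := by rw [← h.2, e, dom_tr₁, f.2]
    obtain rfl : Y ⊗ₒ A = Q := by rw [← h.3, e, cod_tr₁, f.3]
    obtain rfl : h = f.tensorRight A := Hom.ext e
    obtain rfl : h' = f'.tensorRight A := Hom.ext e'
    exact VectLinear.tensorRight_smul c α A

/-- `E` is a finite basis of simple objects: its members are non-zero and pairwise non-equivalent,
and for all `A`, `B` the composition functor `⨁_{X ∈ E} Hom(A, X) ⊗ Hom(X, B) → Hom(A, B)` is an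
equivalence.  On the generating objects `f ⊗ g` of the left-hand side the morphisms are
`2Hom(f, f') ⊗ 2Hom(g, g')` inside one summand and `0` between different summands, and every object
is a finite direct sum of generating ones; so the functor is fully faithful iff `full_faithful` and
`disjoint` hold, and essentially surjective iff `ess_surj` holds. -/
structure IsObjectBasis (E : Finset C.Obj) : Prop where
  nonzero : ∀ X ∈ E, NonzeroObj X
  nonequivalent : ∀ X ∈ E, ∀ Y ∈ E, X ≠ Y → ¬ Equivalent X Y
  full_faithful : ∀ (A B : C.Obj), ∀ X ∈ E, ∀ (f f' : C.Hom A X) (g g' : C.Hom X B),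
    Function.Bijective (TensorProduct.lift (hcompₗ F f f' g g'))
  disjoint : ∀ (A B : C.Obj), ∀ X ∈ E, ∀ Y ∈ E, X ≠ Y →
    ∀ (f : C.Hom A X) (g : C.Hom X B) (f' : C.Hom A Y) (g' : C.Hom Y B),
      Subsingleton (f.comp g ⟶ f'.comp g')
  ess_surj : ∀ (A B : C.Obj) (h : C.Hom A B), ∃ (n : ℕ) (X : Fin n → C.Obj)
    (f : ∀ k, C.Hom A (X k)) (g : ∀ k, C.Hom (X k) B) (b : Bicone fun k => (f k).comp (g k)),
    (∀ k, X k ∈ E) ∧ b.pt = h ∧ Nonempty b.IsBilimit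

section Pairing

variable [DualData C] [HasDuals C]

/-- The right trace functor on `2`-morphisms, as a linear map. -/
def trRₗ {A : C.Obj} (f f' : C.Hom A A) : (f ⟶ f') →ₗ[F] (trRHom f ⟶ trRHom f') :=
  have hm (f : C.Hom A A) : C.cod (unit₀ A) = C.dom (f.1 ▷₁ dual₀ A) := by
    rw [cod_unit₀, dom_tr₁, f.2]
  have hd (f : C.Hom A A) : C.dom (unit₀ A ∗₁ f.1 ▷₁ dual₀ A) = I := by
    rw [C.dom_comp _ _ (hm f), dom_unit₀]
  have hc (f : C.Hom A A) : C.cod (unit₀ A ∗₁ f.1 ▷₁ dual₀ A) = A ⊗ₒ dual₀ A := by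
    rw [C.cod_comp _ _ (hm f), cod_tr₁, f.3]
  whiskerRightₗ F (counit₀ (dual₀ A)) (by rw [dom_counit₀, HasDuals.dual₀_dual₀])
      (f := ⟨unit₀ A ∗₁ f.1 ▷₁ dual₀ A, hd f, hc f⟩)
      (f' := ⟨unit₀ A ∗₁ f'.1 ▷₁ dual₀ A, hd f', hc f'⟩) (trRHom f) (trRHom f')
      (by change trR₁ f.1 = _; rw [trR₁, f.2])
      (by change trR₁ f'.1 = _; rw [trR₁, f'.2]) ∘ₗ
    whiskerLeftₗ F (unit₀ A) (cod_unit₀ A) (f := f.tensorRight (dual₀ A))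
      (f' := f'.tensorRight (dual₀ A)) _ _ rfl rfl ∘ₗ
    tensorRightₗ F (dual₀ A) _ _ rfl rfl

theorem trRₗ_val {A : C.Obj} (f f' : C.Hom A A) (α : f ⟶ f') : (trRₗ F f f' α).1 = trR₂ α.1 := by
  rw [trR₂, α.2, f.2]
  rfl

/-- The linear map `γ ↦ ∩_f · Tr_R(γ ∘ 1_{f*}) · ∪_f` from `2End(f)` to `2End(1_I)`. -/
def closeUpₗ {A B : C.Obj} (f : C.Hom A B) :
    (f ⟶ f) →ₗ[F] (idHom (I : C.Obj) ⟶ idHom (I : C.Obj)) :=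
  Linear.rightComp F _ (show trRHom (f.comp f.dual) ⟶ idHom (I : C.Obj) from
      ⟨cupR f.1, (src_dual₂ _).trans (capR_typing f).2, (tgt_dual₂ _).trans (capR_typing f).1⟩) ∘ₗ
    Linear.leftComp F _ (show idHom (I : C.Obj) ⟶ trRHom (f.comp f.dual) from
      ⟨capR f.1, (capR_typing f).1, (capR_typing f).2⟩) ∘ₗ
    trRₗ F (f.comp f.dual) (f.comp f.dual) ∘ₗ
    whiskerRightₗ F (dual₁ f.1) f.dual.2 _ _ rfl rfl

theorem closeUpₗ_val {A B : C.Obj} (f : C.Hom A B) (γ : f ⟶ f) :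
    (closeUpₗ F f γ).1 =
      capR f.1 ⊡ᵥ trR₂ (γ.1 ⊡ₕ C.id₂ (dual₁ f.1)) ⊡ᵥ cupR f.1 := by
  change (capR f.1 ⊡ᵥ (trRₗ F _ _ _).1) ⊡ᵥ cupR f.1 = _
  rw [trRₗ_val]
  rfl

variable [ScalarUnit F C]

/-- The pairing `⟨α, β⟩ = ∩_f · Tr_R((α · β) ∘ 1_{f*}) · ∪_f ∈ 2End(1_I) = F` of `α : f ⇒ g` and
`β : g ⇒ f`. -/
noncomputable def pairing {A B : C.Obj} (f g : C.Hom A B) : (f ⟶ g) →ₗ[F] (g ⟶ f) →ₗ[F] F :=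
  (vcompₗ F f g f).compr₂ ((scalarEquiv F).toLinearMap ∘ₗ closeUpₗ F f)

/-- The pairing is the one of the closed formula above. -/
theorem pairing_spec {A B : C.Obj} (f g : C.Hom A B) (α : f ⟶ g) (β : g ⟶ f) :
    (pairing F f g α β • 𝟙 (idHom (I : C.Obj)) : idHom (I : C.Obj) ⟶ idHom I).1 =
      capR f.1 ⊡ᵥ trR₂ ((α.1 ⊡ᵥ β.1) ⊡ₕ C.id₂ (dual₁ f.1)) ⊡ᵥ cupR f.1 := by
  have h : (pairing F f g α β • 𝟙 (idHom (I : C.Obj)) : idHom (I : C.Obj) ⟶ idHom I) =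
      closeUpₗ F f (α ≫ β) := (scalarEquiv F).symm_apply_apply _
  rw [h, closeUpₗ_val]
  rfl

/-- The quantum dimension `⟨1_f, 1_f⟩` of a `1`-morphism. -/
noncomputable def qdim₁ {A B : C.Obj} (f : C.Hom A B) : F := pairing F f f (𝟙 f) (𝟙 f)

/-- The quantum dimension `⟨1_{1_A}, 1_{1_A}⟩` of an object. -/
noncomputable def qdim₀ (A : C.Obj) : F := qdim₁ F (idHom A)

end Pairing

end Linear

/-- `C` is non-degenerate if the pairings `2Hom(f, g) ⊗ 2Hom(g, f) → F` are. -/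
class Nondegenerate (F : Type x) [Field F] (C : StrictTwoCategory.{u, v, w}) [SemistrictMonoidal C]
    [∀ A B : C.Obj, Preadditive (C.Hom A B)] [∀ A B : C.Obj, Linear F (C.Hom A B)]
    [VectLinear F C] [DualData C] [HasDuals C] [ScalarUnit F C] : Prop where
  nondegenerate : ∀ {A B : C.Obj} (f g : C.Hom A B), (pairing F f g).Nondegenerate

section StateSpaces

/-! ## State spaces of tetrahedra

The label of an edge `(ij)` is an object `eᵢⱼ` and the label of a triangle `(ijk)` is a `1`-morphism
`fᵢⱼₖ : eᵢₖ → eⱼₖ ⊗ eᵢⱼ`. -/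

variable {C : StrictTwoCategory.{u, v, w}} [SemistrictMonoidal C]

/-- `f_{(ijk)l} = f_{ikl}(e_{kl} ⊗ f_{ijk})`, where `a, b, c, p, r` are the labels of the edges
`ij, jk, kl, ik, il`. -/
def leftComp {a b c p r : C.Obj} (fikl : C.Hom r (c ⊗ₒ p)) (fijk : C.Hom p (b ⊗ₒ a)) :
    C.Hom r (c ⊗ₒ b ⊗ₒ a) :=
  fikl.comp (fijk.tensorLeft c)

/-- `f_{i(jkl)} = f_{ijl}(f_{jkl} ⊗ e_{ij})`, where `a, b, c, q, r` are the labels of the edges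
`ij, jk, kl, jl, il`. -/
def rightComp {a b c q r : C.Obj} (fijl : C.Hom r (q ⊗ₒ a)) (fjkl : C.Hom q (c ⊗ₒ b)) :
    C.Hom r (c ⊗ₒ b ⊗ₒ a) :=
  ⟨(fijl.comp (fjkl.tensorRight a)).1, (fijl.comp (fjkl.tensorRight a)).2,
    (fijl.comp (fjkl.tensorRight a)).3.trans (tensor_assoc c b a)⟩

/-- The state space `2H(ijkl) = 2Hom(f_{(ijk)l}, f_{i(jkl)})`. -/
abbrev TetSpace {a b c p q r : C.Obj} (fijk : C.Hom p (b ⊗ₒ a)) (fijl : C.Hom r (q ⊗ₒ a))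
    (fikl : C.Hom r (c ⊗ₒ p)) (fjkl : C.Hom q (c ⊗ₒ b)) : Type w :=
  leftComp fikl fijk ⟶ rightComp fijl fjkl

/-- The space `2Hom(f_{i(jkl)}, f_{(ijk)l})`, paired with `2H(ijkl)`. -/
abbrev TetSpaceOp {a b c p q r : C.Obj} (fijk : C.Hom p (b ⊗ₒ a)) (fijl : C.Hom r (q ⊗ₒ a))
    (fikl : C.Hom r (c ⊗ₒ p)) (fjkl : C.Hom q (c ⊗ₒ b)) : Type w :=
  rightComp fijl fjkl ⟶ leftComp fikl fijk

/-- `f_{((012)3)4} = f_{034}(e_{34} ⊗ f_{023})(e_{34} ⊗ e_{23} ⊗ f_{012})`. -/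
def leftComp₄ {e01 e02 e03 e04 e12 e23 e34 : C.Obj} (f012 : C.Hom e02 (e12 ⊗ₒ e01))
    (f023 : C.Hom e03 (e23 ⊗ₒ e02)) (f034 : C.Hom e04 (e34 ⊗ₒ e03)) :
    C.Hom e04 (e34 ⊗ₒ e23 ⊗ₒ e12 ⊗ₒ e01) :=
  (leftComp f034 f023).comp ((f012.tensorLeft e23).tensorLeft e34)

/-- `f_{0(1(234))} = f_{014}(f_{124} ⊗ e_{01})(f_{234} ⊗ e_{12} ⊗ e_{01})`. -/
def rightComp₄ {e01 e04 e12 e14 e23 e24 e34 : C.Obj} (f014 : C.Hom e04 (e14 ⊗ₒ e01))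
    (f124 : C.Hom e14 (e24 ⊗ₒ e12)) (f234 : C.Hom e24 (e34 ⊗ₒ e23)) :
    C.Hom e04 (e34 ⊗ₒ e23 ⊗ₒ e12 ⊗ₒ e01) :=
  ⟨((rightComp f014 f124).comp (f234.tensorRight (e12 ⊗ₒ e01))).1,
    ((rightComp f014 f124).comp (f234.tensorRight (e12 ⊗ₒ e01))).2,
    ((rightComp f014 f124).comp (f234.tensorRight (e12 ⊗ₒ e01))).3.trans (tensor_assoc _ _ _)⟩

section Intermediate

variable {e01 e02 e03 e04 e12 e13 e14 e23 e24 e34 : C.Obj}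
  (f012 : C.Hom e02 (e12 ⊗ₒ e01)) (f013 : C.Hom e03 (e13 ⊗ₒ e01))
  (f014 : C.Hom e04 (e14 ⊗ₒ e01)) (f023 : C.Hom e03 (e23 ⊗ₒ e02))
  (f024 : C.Hom e04 (e24 ⊗ₒ e02)) (f034 : C.Hom e04 (e34 ⊗ₒ e03))
  (f123 : C.Hom e13 (e23 ⊗ₒ e12)) (f124 : C.Hom e14 (e24 ⊗ₒ e12))
  (f134 : C.Hom e14 (e34 ⊗ₒ e13)) (f234 : C.Hom e24 (e34 ⊗ₒ e23))

/-- `f_{024}(f_{234} ⊗ e_{02})(e_{34} ⊗ e_{23} ⊗ f_{012})`. -/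
def mid₁ : C.Hom e04 (e34 ⊗ₒ e23 ⊗ₒ e12 ⊗ₒ e01) :=
  (rightComp f024 f234).comp ((f012.tensorLeft e23).tensorLeft e34)

/-- `f_{024}(e_{24} ⊗ f_{012})(f_{234} ⊗ e_{12} ⊗ e_{01})`. -/
def mid₂ : C.Hom e04 (e34 ⊗ₒ e23 ⊗ₒ e12 ⊗ₒ e01) :=
  ⟨((leftComp f024 f012).comp (f234.tensorRight (e12 ⊗ₒ e01))).1,
    ((leftComp f024 f012).comp (f234.tensorRight (e12 ⊗ₒ e01))).2,
    ((leftComp f024 f012).comp (f234.tensorRight (e12 ⊗ₒ e01))).3.trans (tensor_assoc _ _ _)⟩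

/-- `f_{034}(e_{34} ⊗ f_{013})(e_{34} ⊗ f_{123} ⊗ e_{01})`. -/
def mid₃ : C.Hom e04 (e34 ⊗ₒ e23 ⊗ₒ e12 ⊗ₒ e01) :=
  ⟨((leftComp f034 f013).comp ((f123.tensorRight e01).tensorLeft e34)).1,
    ((leftComp f034 f013).comp ((f123.tensorRight e01).tensorLeft e34)).2,
    ((leftComp f034 f013).comp ((f123.tensorRight e01).tensorLeft e34)).3.trans
      (by rw [tensor_assoc])⟩

/-- `f_{014}(f_{134} ⊗ e_{01})(e_{34} ⊗ f_{123} ⊗ e_{01})`. -/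
def mid₄ : C.Hom e04 (e34 ⊗ₒ e23 ⊗ₒ e12 ⊗ₒ e01) :=
  ⟨((rightComp f014 f134).comp ((f123.tensorRight e01).tensorLeft e34)).1,
    ((rightComp f014 f134).comp ((f123.tensorRight e01).tensorLeft e34)).2,
    ((rightComp f014 f134).comp ((f123.tensorRight e01).tensorLeft e34)).3.trans
      (by rw [tensor_assoc])⟩

theorem mid₁_val : (mid₁ f012 f024 f234).1 =
    f024.1 ∗₁ (f234.1 ▷₁ e02 ∗₁ (e34 ⊗ₒ e23) ◁₁ f012.1) := by
  change (f024.1 ∗₁ f234.1 ▷₁ e02) ∗₁ e34 ◁₁ e23 ◁₁ f012.1 = _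
  rw [tl₁_tl₁, C.comp_assoc]
  · simp [dom_tr₁, f024.3, f234.2]
  · simp [cod_tr₁, dom_tl₁, f012.2, f234.3]

theorem mid₂_val : (mid₂ f012 f024 f234).1 =
    f024.1 ∗₁ (e24 ◁₁ f012.1 ∗₁ f234.1 ▷₁ (e12 ⊗ₒ e01)) := by
  change (f024.1 ∗₁ e24 ◁₁ f012.1) ∗₁ f234.1 ▷₁ (e12 ⊗ₒ e01) = _
  rw [C.comp_assoc]
  · simp [dom_tl₁, f024.3, f012.2]
  · simp [cod_tl₁, dom_tr₁, f012.3, f234.2]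

/-- The `2`-isomorphism `f_{024} ∘ ⊗_{f_{234}, f_{012}}`. -/
def crossing : mid₁ f012 f024 f234 ⟶ mid₂ f012 f024 f234 :=
  have h : C.cod (C.src (C.id₂ f024.1)) = C.dom (C.src (tensorator f234.1 f012.1)) := by
    simp [C.src_id₂, src_tensorator, C.dom_comp, cod_tr₁, dom_tl₁, dom_tr₁, f024.3, f234.2,
      f012.2]
  ⟨C.id₂ f024.1 ⊡ₕ tensorator f234.1 f012.1, by
    rw [C.src_hcomp _ _ h, C.src_id₂, src_tensorator, mid₁_val, f012.2, f234.3], by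
    rw [C.tgt_hcomp _ _ h, C.tgt_id₂, tgt_tensorator, mid₂_val, f012.3, f234.2]⟩

/-- The `2`-isomorphism `f_{024} ∘ ⊗⁻¹_{f_{234}, f_{012}}`. -/
def crossingInv : mid₂ f012 f024 f234 ⟶ mid₁ f012 f024 f234 :=
  have h : C.cod (C.src (C.id₂ f024.1)) = C.dom (C.src (tensoratorInv f234.1 f012.1)) := by
    simp [C.src_id₂, src_tensoratorInv, C.dom_comp, cod_tl₁, dom_tl₁, dom_tr₁, f024.3, f234.2,
      f012.2]
  ⟨C.id₂ f024.1 ⊡ₕ tensoratorInv f234.1 f012.1, by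
    rw [C.src_hcomp _ _ h, C.src_id₂, src_tensoratorInv, mid₂_val, f012.3, f234.2], by
    rw [C.tgt_hcomp _ _ h, C.tgt_id₂, tgt_tensoratorInv, mid₁_val, f012.2, f234.3]⟩

theorem leftComp₄_val : (leftComp₄ f012 f023 f034).1 =
    f034.1 ∗₁ e34 ◁₁ (f023.1 ∗₁ e23 ◁₁ f012.1) := by
  change (f034.1 ∗₁ e34 ◁₁ f023.1) ∗₁ e34 ◁₁ e23 ◁₁ f012.1 = _
  rw [tl₁_comp _ _ _ (by simp [dom_tl₁, f023.3, f012.2]), C.comp_assoc]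
  · simp [dom_tl₁, f034.3, f023.2]
  · simp [cod_tl₁, dom_tl₁, f023.3, f012.2]

theorem mid₃_val : (mid₃ f013 f034 f123).1 =
    f034.1 ∗₁ e34 ◁₁ (f013.1 ∗₁ f123.1 ▷₁ e01) := by
  change (f034.1 ∗₁ e34 ◁₁ f013.1) ∗₁ e34 ◁₁ (f123.1 ▷₁ e01) = _
  rw [tl₁_comp _ _ _ (by simp [dom_tr₁, f013.3, f123.2]), C.comp_assoc]
  · simp [dom_tl₁, f034.3, f013.2]
  · simp [cod_tl₁, dom_tl₁, dom_tr₁, f013.3, f123.2]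

theorem mid₄_val : (mid₄ f014 f123 f134).1 =
    f014.1 ∗₁ (f134.1 ∗₁ e34 ◁₁ f123.1) ▷₁ e01 := by
  change (f014.1 ∗₁ f134.1 ▷₁ e01) ∗₁ e34 ◁₁ (f123.1 ▷₁ e01) = _
  rw [tr₁_comp _ _ _ (by simp [dom_tl₁, f134.3, f123.2]), tr₁_tl₁, C.comp_assoc]
  · simp [dom_tr₁, f014.3, f134.2]
  · simp [cod_tr₁, dom_tl₁, dom_tr₁, f134.3, f123.2, tensor_assoc]

theorem rightComp₄_val : (rightComp₄ f014 f124 f234).1 =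
    f014.1 ∗₁ (f124.1 ∗₁ f234.1 ▷₁ e12) ▷₁ e01 := by
  change (f014.1 ∗₁ f124.1 ▷₁ e01) ∗₁ f234.1 ▷₁ (e12 ⊗ₒ e01) = _
  rw [tr₁_comp _ _ _ (by simp [dom_tr₁, f124.3, f234.2]), tr₁_tr₁, C.comp_assoc]
  · simp [dom_tr₁, f014.3, f124.2]
  · simp [cod_tr₁, dom_tr₁, f124.3, f234.2, tensor_assoc]

end Intermediate

end StateSpaces

section PartitionFunctions

variable (F : Type x) [Field F] {C : StrictTwoCategory.{u, v, w}} [SemistrictMonoidal C]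
  [∀ A B : C.Obj, Preadditive (C.Hom A B)] [∀ A B : C.Obj, Linear F (C.Hom A B)]
  [VectLinear F C]

/-! ## Composition maps of a labelled `4`-simplex -/

section Compositions

variable {e01 e02 e03 e04 e12 e13 e14 e23 e24 e34 : C.Obj}
  (f012 : C.Hom e02 (e12 ⊗ₒ e01)) (f013 : C.Hom e03 (e13 ⊗ₒ e01))
  (f014 : C.Hom e04 (e14 ⊗ₒ e01)) (f023 : C.Hom e03 (e23 ⊗ₒ e02))
  (f024 : C.Hom e04 (e24 ⊗ₒ e02)) (f034 : C.Hom e04 (e34 ⊗ₒ e03))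
  (f123 : C.Hom e13 (e23 ⊗ₒ e12)) (f124 : C.Hom e14 (e24 ⊗ₒ e12))
  (f134 : C.Hom e14 (e34 ⊗ₒ e13)) (f234 : C.Hom e24 (e34 ⊗ₒ e23))

/-- The composition map `2H(0234) ⊗ 2H(0124) → 2H(01234)`, `β ⊗ δ ↦ βδ`. -/
noncomputable def compTwo :
    TetSpace f023 f024 f034 f234 ⊗[F] TetSpace f012 f014 f024 f124 →ₗ[F]
      (leftComp₄ f012 f023 f034 ⟶ rightComp₄ f014 f124 f234) :=
  TensorProduct.lift ((vcompₗ F _ _ _).compl₁₂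
    (Linear.rightComp F _ (crossing f012 f024 f234) ∘ₗ
      whiskerRightₗ F (e34 ◁₁ e23 ◁₁ f012.1) ((f012.tensorLeft e23).tensorLeft e34).2
        (leftComp₄ f012 f023 f034) (mid₁ f012 f024 f234) rfl rfl)
    (whiskerRightₗ F (f234.1 ▷₁ (e12 ⊗ₒ e01)) (f234.tensorRight (e12 ⊗ₒ e01)).2
      (mid₂ f012 f024 f234) (rightComp₄ f014 f124 f234) rfl rfl))

theorem compTwo_tmul (β : TetSpace f023 f024 f034 f234) (δ : TetSpace f012 f014 f024 f124) :
    (compTwo F f012 f014 f023 f024 f034 f124 f234 (β ⊗ₜ δ)).1 =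
      (β.1 ⊡ₕ C.id₂ (e34 ◁₁ e23 ◁₁ f012.1)) ⊡ᵥ (C.id₂ f024.1 ⊡ₕ tensorator f234.1 f012.1) ⊡ᵥ
        (δ.1 ⊡ₕ C.id₂ (f234.1 ▷₁ (e12 ⊗ₒ e01))) := rfl

/-- The composition map `β ⊗ δ ↦ δβ` in the opposite direction. -/
noncomputable def compTwoOp :
    TetSpaceOp f023 f024 f034 f234 ⊗[F] TetSpaceOp f012 f014 f024 f124 →ₗ[F]
      (rightComp₄ f014 f124 f234 ⟶ leftComp₄ f012 f023 f034) :=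
  TensorProduct.lift ((vcompₗ F _ _ _).compl₁₂
    (Linear.rightComp F _ (crossingInv f012 f024 f234) ∘ₗ
      whiskerRightₗ F (f234.1 ▷₁ (e12 ⊗ₒ e01)) (f234.tensorRight (e12 ⊗ₒ e01)).2
        (rightComp₄ f014 f124 f234) (mid₂ f012 f024 f234) rfl rfl)
    (whiskerRightₗ F (e34 ◁₁ e23 ◁₁ f012.1) ((f012.tensorLeft e23).tensorLeft e34).2
      (mid₁ f012 f024 f234) (leftComp₄ f012 f023 f034) rfl rfl)).flip

theorem compTwoOp_tmul (β : TetSpaceOp f023 f024 f034 f234)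
    (δ : TetSpaceOp f012 f014 f024 f124) :
    (compTwoOp F f012 f014 f023 f024 f034 f124 f234 (β ⊗ₜ δ)).1 =
      (δ.1 ⊡ₕ C.id₂ (f234.1 ▷₁ (e12 ⊗ₒ e01))) ⊡ᵥ (C.id₂ f024.1 ⊡ₕ tensoratorInv f234.1 f012.1) ⊡ᵥ
        (β.1 ⊡ₕ C.id₂ (e34 ◁₁ e23 ◁₁ f012.1)) := rfl

/-- `α ↦ f_{014} ∘ (α ⊗ e_{01})`. -/
def stepAlpha : TetSpace f123 f124 f134 f234 →ₗ[F]
    (mid₄ f014 f123 f134 ⟶ rightComp₄ f014 f124 f234) :=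
  have h (g : C.Hom e14 (e34 ⊗ₒ e23 ⊗ₒ e12)) :
      C.cod (g.1 ▷₁ e01) = e34 ⊗ₒ e23 ⊗ₒ e12 ⊗ₒ e01 := by
    rw [cod_tr₁, g.3, tensor_assoc, tensor_assoc]
  whiskerLeftₗ F f014.1 f014.3
      (f := ⟨_, ((leftComp f134 f123).tensorRight e01).2, h _⟩)
      (f' := ⟨_, ((rightComp f124 f234).tensorRight e01).2, h _⟩) _ _
      (mid₄_val f014 f123 f134) (rightComp₄_val f014 f124 f234) ∘ₗ
    tensorRightₗ F e01 _ _ rfl rfl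

/-- `α ↦ f_{014} ∘ (α ⊗ e_{01})` in the opposite direction. -/
def stepAlphaOp : TetSpaceOp f123 f124 f134 f234 →ₗ[F]
    (rightComp₄ f014 f124 f234 ⟶ mid₄ f014 f123 f134) :=
  have h (g : C.Hom e14 (e34 ⊗ₒ e23 ⊗ₒ e12)) :
      C.cod (g.1 ▷₁ e01) = e34 ⊗ₒ e23 ⊗ₒ e12 ⊗ₒ e01 := by
    rw [cod_tr₁, g.3, tensor_assoc, tensor_assoc]
  whiskerLeftₗ F f014.1 f014.3
      (f := ⟨_, ((rightComp f124 f234).tensorRight e01).2, h _⟩)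
      (f' := ⟨_, ((leftComp f134 f123).tensorRight e01).2, h _⟩) _ _
      (rightComp₄_val f014 f124 f234) (mid₄_val f014 f123 f134) ∘ₗ
    tensorRightₗ F e01 _ _ rfl rfl

/-- `ε ↦ f_{034} ∘ (e_{34} ⊗ ε)`. -/
def stepEpsilon : TetSpace f012 f013 f023 f123 →ₗ[F]
    (leftComp₄ f012 f023 f034 ⟶ mid₃ f013 f034 f123) :=
  whiskerLeftₗ F f034.1 f034.3 (f := (leftComp f023 f012).tensorLeft e34)
      (f' := (rightComp f013 f123).tensorLeft e34) _ _
      (leftComp₄_val f012 f023 f034) (mid₃_val f013 f034 f123) ∘ₗ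
    tensorLeftₗ F e34 _ _ rfl rfl

/-- `ε ↦ f_{034} ∘ (e_{34} ⊗ ε)` in the opposite direction. -/
def stepEpsilonOp : TetSpaceOp f012 f013 f023 f123 →ₗ[F]
    (mid₃ f013 f034 f123 ⟶ leftComp₄ f012 f023 f034) :=
  whiskerLeftₗ F f034.1 f034.3 (f := (rightComp f013 f123).tensorLeft e34)
      (f' := (leftComp f023 f012).tensorLeft e34) _ _
      (mid₃_val f013 f034 f123) (leftComp₄_val f012 f023 f034) ∘ₗ
    tensorLeftₗ F e34 _ _ rfl rfl

/-- The composition map `2H(1234) ⊗ 2H(0134) ⊗ 2H(0123) → 2H(01234)`, `α ⊗ γ ⊗ ε ↦ εγα`. -/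
noncomputable def compThree :
    TetSpace f123 f124 f134 f234 ⊗[F] TetSpace f013 f014 f034 f134 ⊗[F]
        TetSpace f012 f013 f023 f123 →ₗ[F]
      (leftComp₄ f012 f023 f034 ⟶ rightComp₄ f014 f124 f234) :=
  TensorProduct.lift ((vcompₗ F _ _ _).flip.compl₁₂
    (TensorProduct.lift ((vcompₗ F _ _ _).flip.compl₁₂
      (stepAlpha F f014 f123 f124 f134 f234)
      (whiskerRightₗ F (e34 ◁₁ (f123.1 ▷₁ e01)) ((f123.tensorRight e01).tensorLeft e34).2
        (mid₃ f013 f034 f123) (mid₄ f014 f123 f134) rfl rfl)))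
    (stepEpsilon F f012 f013 f023 f034 f123))

theorem compThree_tmul (α : TetSpace f123 f124 f134 f234) (γ : TetSpace f013 f014 f034 f134)
    (ε : TetSpace f012 f013 f023 f123) :
    (compThree F f012 f013 f014 f023 f034 f123 f124 f134 f234 (α ⊗ₜ γ ⊗ₜ ε)).1 =
      (C.id₂ f034.1 ⊡ₕ e34 ◁₂ ε.1) ⊡ᵥ ((γ.1 ⊡ₕ C.id₂ (e34 ◁₁ (f123.1 ▷₁ e01))) ⊡ᵥ
        (C.id₂ f014.1 ⊡ₕ α.1 ▷₂ e01)) := rfl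

/-- The composition map `α ⊗ γ ⊗ ε ↦ αγε` in the opposite direction. -/
noncomputable def compThreeOp :
    TetSpaceOp f123 f124 f134 f234 ⊗[F] TetSpaceOp f013 f014 f034 f134 ⊗[F]
        TetSpaceOp f012 f013 f023 f123 →ₗ[F]
      (rightComp₄ f014 f124 f234 ⟶ leftComp₄ f012 f023 f034) :=
  TensorProduct.lift ((vcompₗ F _ _ _).compl₁₂
    (TensorProduct.lift ((vcompₗ F _ _ _).compl₁₂
      (stepAlphaOp F f014 f123 f124 f134 f234)
      (whiskerRightₗ F (e34 ◁₁ (f123.1 ▷₁ e01)) ((f123.tensorRight e01).tensorLeft e34).2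
        (mid₄ f014 f123 f134) (mid₃ f013 f034 f123) rfl rfl)))
    (stepEpsilonOp F f012 f013 f023 f034 f123))

theorem compThreeOp_tmul (α : TetSpaceOp f123 f124 f134 f234)
    (γ : TetSpaceOp f013 f014 f034 f134) (ε : TetSpaceOp f012 f013 f023 f123) :
    (compThreeOp F f012 f013 f014 f023 f034 f123 f124 f134 f234 (α ⊗ₜ γ ⊗ₜ ε)).1 =
      (C.id₂ f014.1 ⊡ₕ α.1 ▷₂ e01) ⊡ᵥ (γ.1 ⊡ₕ C.id₂ (e34 ◁₁ (f123.1 ▷₁ e01))) ⊡ᵥ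
        (C.id₂ f034.1 ⊡ₕ e34 ◁₂ ε.1) := rfl

/-! ## Partition functions -/

variable [DualData C] [HasDuals C] [ScalarUnit F C] [Nondegenerate F C]

instance isPerfPair_pairing {A B : C.Obj} (f g : C.Hom A B) : (pairing F f g).IsPerfPair :=
  LinearMap.IsPerfPair.of_injective (LinearMap.separatingLeft_iff_ker_eq_bot.mp
      (Nondegenerate.nondegenerate f g).1 |> LinearMap.ker_eq_bot.mp)
    (LinearMap.separatingRight_iff_flip_ker_eq_bot.mp
      (Nondegenerate.nondegenerate f g).2 |> LinearMap.ker_eq_bot.mp)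

/-- The partition function `Z(+(01234))`: it sends `t` to the element `z` with
`⟨z, α ⊗ γ ⊗ ε⟩ = ⟨comp t, αγε⟩` for all `α, γ, ε`, where
`⟨x ⊗ y ⊗ z, α ⊗ γ ⊗ ε⟩ = ⟨x, α⟩⟨y, γ⟩⟨z, ε⟩`. -/
noncomputable def Zplus :
    TetSpace f023 f024 f034 f234 ⊗[F] TetSpace f012 f014 f024 f124 →ₗ[F]
      TetSpace f123 f124 f134 f234 ⊗[F] TetSpace f013 f014 f034 f134 ⊗[F]
        TetSpace f012 f013 f023 f123 :=
  ((TensorProduct.congr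
      (TensorProduct.congr (pairing F (leftComp f134 f123) (rightComp f124 f234)).toPerfPair
          (pairing F (leftComp f034 f013) (rightComp f014 f134)).toPerfPair ≪≫ₗ
        TensorProduct.dualDistribEquiv F _ _)
      (pairing F (leftComp f023 f012) (rightComp f013 f123)).toPerfPair ≪≫ₗ
    TensorProduct.dualDistribEquiv F _ _).symm).toLinearMap ∘ₗ
  LinearMap.lcomp F F (compThreeOp F f012 f013 f014 f023 f034 f123 f124 f134 f234) ∘ₗ
  pairing F (leftComp₄ f012 f023 f034) (rightComp₄ f014 f124 f234) ∘ₗ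
  compTwo F f012 f014 f023 f024 f034 f124 f234

/-- The partition function `Z(-(01234))`: it sends `t` to the element `z` with
`⟨β ⊗ δ, z⟩ = ⟨δβ, comp t⟩` for all `β, δ`, where `⟨β ⊗ δ, x ⊗ y⟩ = ⟨β, x⟩⟨δ, y⟩`. -/
noncomputable def Zminus :
    TetSpace f123 f124 f134 f234 ⊗[F] TetSpace f013 f014 f034 f134 ⊗[F]
        TetSpace f012 f013 f023 f123 →ₗ[F]
      TetSpace f023 f024 f034 f234 ⊗[F] TetSpace f012 f014 f024 f124 :=
  ((TensorProduct.congr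
      (pairing F (rightComp f024 f234) (leftComp f034 f023)).flip.toPerfPair
      (pairing F (rightComp f014 f124) (leftComp f024 f012)).flip.toPerfPair ≪≫ₗ
    TensorProduct.dualDistribEquiv F _ _).symm).toLinearMap ∘ₗ
  LinearMap.lcomp F F (compTwoOp F f012 f014 f023 f024 f034 f124 f234) ∘ₗ
  (pairing F (rightComp₄ f014 f124 f234) (leftComp₄ f012 f023 f034)).flip ∘ₗ
  compThree F f012 f013 f014 f023 f034 f123 f124 f134 f234

end Compositions

/-! ## Summation over the interior labels -/

section Sums

/-- The labels `e_{13} ∈ E`, `f_{013}`, `f_{123}`, `f_{134}` of the simplices containing the edge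
`(13)`, for given labels of the other edges; `E` is the chosen set of objects and `ℱ A B` the chosen
set of objects of `Hom(A, B)`. -/
abbrev InnerLabel (E : Finset C.Obj) (ℱ : ∀ A B : C.Obj, Finset (C.Hom A B))
    (e01 e03 e12 e14 e23 e34 : C.Obj) : Type (max u v) :=
  Σ e13 : E, ℱ e03 (e13.1 ⊗ₒ e01) × ℱ e13.1 (e23 ⊗ₒ e12) × ℱ e14 (e34 ⊗ₒ e13.1)

variable (E : Finset C.Obj) (ℱ : ∀ A B : C.Obj, Finset (C.Hom A B))
  {e01 e02 e03 e04 e12 e14 e23 e24 e34 : C.Obj}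
  (f012 : C.Hom e02 (e12 ⊗ₒ e01)) (f014 : C.Hom e04 (e14 ⊗ₒ e01))
  (f023 : C.Hom e03 (e23 ⊗ₒ e02)) (f034 : C.Hom e04 (e34 ⊗ₒ e03))
  (f124 : C.Hom e14 (e24 ⊗ₒ e12)) (f234 : C.Hom e24 (e34 ⊗ₒ e23))

/-- `⨁_{f_{024}} 2H(0234) ⊗ 2H(0124)`. -/
abbrev SumTwo : Type (max v w) :=
  DirectSum (ℱ e04 (e24 ⊗ₒ e02)) fun f024 =>
    TetSpace f023 f024.1 f034 f234 ⊗[F] TetSpace f012 f014 f024.1 f124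

/-- `⨁_{e_{13}, f_{013}, f_{123}, f_{134}} 2H(1234) ⊗ 2H(0134) ⊗ 2H(0123)`. -/
abbrev SumThree : Type (max u v w) :=
  DirectSum (InnerLabel E ℱ e01 e03 e12 e14 e23 e34) fun l =>
    TetSpace l.2.2.1.1 f124 l.2.2.2.1 f234 ⊗[F] TetSpace l.2.1.1 f014 f034 l.2.2.2.1 ⊗[F]
      TetSpace f012 l.2.1.1 f023 l.2.2.1.1

open Classical in
/-- The composition map `⨁ 2H(0234) ⊗ 2H(0124) → 2H(01234)`. -/
noncomputable def leftMap :
    SumTwo F ℱ f012 f014 f023 f034 f124 f234 →ₗ[F]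
      (leftComp₄ f012 f023 f034 ⟶ rightComp₄ f014 f124 f234) :=
  DirectSum.toModule F _ _ fun f024 => compTwo F f012 f014 f023 f024.1 f034 f124 f234

open Classical in
/-- The composition map `⨁ 2H(1234) ⊗ 2H(0134) ⊗ 2H(0123) → 2H(01234)`. -/
noncomputable def rightMap :
    SumThree F E ℱ f012 f014 f023 f034 f124 f234 →ₗ[F]
      (leftComp₄ f012 f023 f034 ⟶ rightComp₄ f014 f124 f234) :=
  DirectSum.toModule F _ _ fun l =>
    compThree F f012 l.2.1.1 f014 f023 f034 l.2.2.1.1 f124 l.2.2.2.1 f234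

variable [DualData C] [HasDuals C] [ScalarUnit F C] [Nondegenerate F C]

open Classical in
/-- The map `Φ`, whose component from the summand `f_{024}` to the summand
`(e_{13}, f_{013}, f_{123}, f_{134})` is
`dim_q(e_{13})⁻¹ dim_q(f_{013}) dim_q(f_{123}) dim_q(f_{134}) Z(+(01234))`. -/
noncomputable def Phi :
    SumTwo F ℱ f012 f014 f023 f034 f124 f234 →ₗ[F]
      SumThree F E ℱ f012 f014 f023 f034 f124 f234 :=
  DirectSum.toModule F _ _ fun f024 =>
    ∑ l : InnerLabel E ℱ e01 e03 e12 e14 e23 e34,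
      ((qdim₀ F l.1.1)⁻¹ * qdim₁ F l.2.1.1 * qdim₁ F l.2.2.1.1 * qdim₁ F l.2.2.2.1) •
        (DirectSum.lof F (InnerLabel E ℱ e01 e03 e12 e14 e23 e34) (fun l =>
            TetSpace l.2.2.1.1 f124 l.2.2.2.1 f234 ⊗[F] TetSpace l.2.1.1 f014 f034 l.2.2.2.1 ⊗[F]
              TetSpace f012 l.2.1.1 f023 l.2.2.1.1) l ∘ₗ
          Zplus F f012 l.2.1.1 f014 f023 f024.1 f034 l.2.2.1.1 f124 l.2.2.2.1 f234)

open Classical in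
/-- The map whose component from the summand `(e_{13}, f_{013}, f_{123}, f_{134})` to the summand
`f_{024}` is `dim_q(f_{024}) Z(-(01234))`. -/
noncomputable def PhiInv :
    SumThree F E ℱ f012 f014 f023 f034 f124 f234 →ₗ[F]
      SumTwo F ℱ f012 f014 f023 f034 f124 f234 :=
  DirectSum.toModule F _ _ fun l =>
    ∑ f024 : ℱ e04 (e24 ⊗ₒ e02),
      qdim₁ F f024.1 •
        (DirectSum.lof F (ℱ e04 (e24 ⊗ₒ e02)) (fun f024 =>
            TetSpace f023 f024.1 f034 f234 ⊗[F] TetSpace f012 f014 f024.1 f124) f024 ∘ₗ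
          Zminus F f012 l.2.1.1 f014 f023 f024.1 f034 l.2.2.1.1 f124 l.2.2.2.1 f234)

end Sums

end PartitionFunctions

end StrictTwoCategory

universe y


/-! Let W be 2H(01234), paired with the 2-morphisms in the opposite direction by the trace pairing
B. Each of the two direct sums is an orthogonal decomposition of W. For one label, the composition
map multiplies the pairing of the summand by a non-zero constant 1/c_i. For two different labels the
composites are orthogonal. All composites together span W. This is `isOrthogonalPair_compTwo` and
`isOrthogonalPair_compThree`. The rest is linear algebra: a vector w is Σ c_i L_i(z_i), where z_i is
determined by q_i(z_i, t') = B(w, L'_i t'). The partition functions are defined by this very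
equation, so the two weighted maps re-expand one decomposition in the other and are mutually inverse
(`IsOrthogonalPair.crossing`).

The constants come from a calculus of traces. Closing up is cyclic, and a composite 1-morphism may
be closed one factor at a time. When βδ is paired with δ'β', the loop of `f012` slides through the
tensorator across `f234` and closes δδ' to a 2-morphism between two labels `f024`. By Schur this is
zero for different labels and otherwise a scalar s with s·dim(f024) = ⟨δ,δ'⟩, whence c = dim(f024).
When εγα is paired with α'γ'ε', both ε'ε and αα' are scalars by Schur, and the remaining loop of
`f123` contributes dim(f123)/dim(e13). Comparing these scalars with ⟨ε,ε'⟩ and ⟨α,α'⟩ gives c =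
dim(e13)⁻¹ dim(f013) dim(f123) dim(f134).

Spanning on the left: creating a pair `f234`*, `f234` writes any ω as some βδ with a possibly
non-simple middle 1-morphism, which is then decomposed in the chosen basis. Spanning on the right:
decompose the identities of f_{(012)3} and f_{1(234)} through the 1-morphisms of the other
bracketing. What remains in the middle is a 2-morphism between composites ending in e34 ⊗ f123 ⊗
e01, and semi-simplicity forces it to be γ ∘ 1 or zero.

Semi-simplicity is given for composites f g through a basis object, whereas here g is tensored with
further objects. Duals of objects repair this: bending a tensor factor to the source is an
equivalence compatible with composition (`BendData`, `WhiskerFull.bend`), so full faithfulness and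
generation pass to f (g ⊗ D) and f (D ⊗ g). -/

namespace StrictTwoCategory

/-! ## Planar calculus -/

attribute [simp] dom_tgt cod_tgt dom_id₁ cod_id₁ dom_comp cod_comp src_id₂ tgt_id₂ src_vcomp
  tgt_vcomp src_hcomp tgt_hcomp Hom.dom_eq Hom.cod_eq Hom₂.src_eq Hom₂.tgt_eq dom_tl₁ cod_tl₁
  dom_tr₁ cod_tr₁ src_tl₂ tgt_tl₂ src_tr₂ tgt_tr₂ src_tensorator tgt_tensorator
  src_tensoratorInv tgt_tensoratorInv src_dual₂ tgt_dual₂ dom_dual₁ cod_dual₁ src_unit₁ tgt_unit₁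
  src_counit₁ tgt_counit₁ dom_unit₀ cod_unit₀ dom_counit₀ cod_counit₀ src_triangulator
  tgt_triangulator HasDuals.dual₀_dual₀ HasDuals.dual₁_dual₁ HasDuals.dual₂_dual₂
  unit_tensor tensor_unit tl₁_id₁ tr₁_id₁ tl₁_comp tr₁_comp HasDuals.dual₁_id₁ HasDuals.dual₁_comp
  HasDuals.dual₁_tl₁ HasDuals.dual₁_tr₁ tr₁_tl₁

section Values

variable {C : StrictTwoCategory.{u, v, w}}

@[simp] theorem Hom.comp_val {A B D : C.Obj} (f : C.Hom A B) (g : C.Hom B D) :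
    (f.comp g).1 = f.1 ∗₁ g.1 := rfl

@[simp] theorem idHom_val (A : C.Obj) : (idHom A : C.Hom A A).1 = C.id₁ A := rfl

@[simp] theorem Hom.hcomp_val {A B D : C.Obj} {f f' : C.Hom A B} {g g' : C.Hom B D}
    (α : f ⟶ f') (β : g ⟶ g') : (Hom.hcomp α β).1 = α.1 ⊡ₕ β.1 := rfl

@[simp] theorem Hom.vcomp_val {A B : C.Obj} {f g h : C.Hom A B} (α : f ⟶ g) (β : g ⟶ h) :
    (α ≫ β).1 = α.1 ⊡ᵥ β.1 := rfl

@[simp] theorem Hom.id_val {A B : C.Obj} (f : C.Hom A B) : Hom₂.val (𝟙 f) = C.id₂ f.1 := rfl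

variable [SemistrictMonoidal C]

@[simp] theorem Hom.tensorLeft_val {X Y : C.Obj} (A : C.Obj) (f : C.Hom X Y) :
    (f.tensorLeft A).1 = A ◁₁ f.1 := rfl

@[simp] theorem Hom.tensorRight_val {X Y : C.Obj} (A : C.Obj) (f : C.Hom X Y) :
    (f.tensorRight A).1 = f.1 ▷₁ A := rfl

end Values

/-! ### Whiskering and exchange laws. -/

section Whiskering

variable (C : StrictTwoCategory.{u, v, w})

theorem vcomp_hcomp_id₂ (α β : C.Mor₂) (f : C.Mor₁) (h : C.tgt α = C.src β)
    (h' : C.cod (C.src α) = C.dom f) :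
    (α ⊡ᵥ β) ⊡ₕ C.id₂ f = (α ⊡ₕ C.id₂ f) ⊡ᵥ (β ⊡ₕ C.id₂ f) := by
  have := C.interchange α β (C.id₂ f) (C.id₂ f) h (by simp) (by simpa)
  rw [← this]
  congr 1
  simpa using (C.id₂_vcomp (C.id₂ f)).symm

theorem id₂_hcomp_vcomp (α β : C.Mor₂) (f : C.Mor₁) (h : C.tgt α = C.src β)
    (h' : C.cod f = C.dom (C.src α)) :
    C.id₂ f ⊡ₕ (α ⊡ᵥ β) = (C.id₂ f ⊡ₕ α) ⊡ᵥ (C.id₂ f ⊡ₕ β) := by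
  have := C.interchange (C.id₂ f) (C.id₂ f) α β (by simp) h (by simpa)
  rw [← this]
  congr 1
  simpa using (C.id₂_vcomp (C.id₂ f)).symm

theorem exchange_left (α β : C.Mor₂) (f g : C.Mor₁) (h : C.cod (C.src α) = C.dom (C.src β))
    (hf : C.src β = f) (hg : C.tgt α = g) :
    (α ⊡ₕ C.id₂ f) ⊡ᵥ (C.id₂ g ⊡ₕ β) = α ⊡ₕ β := by
  subst hf hg
  rw [← C.interchange α _ _ β (by simp) (by simp) (by simpa), C.vcomp_id₂, C.id₂_vcomp]

theorem exchange_right (α β : C.Mor₂) (f g : C.Mor₁) (h : C.cod (C.src α) = C.dom (C.src β))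
    (hf : C.src α = f) (hg : C.tgt β = g) :
    (C.id₂ f ⊡ₕ β) ⊡ᵥ (α ⊡ₕ C.id₂ g) = α ⊡ₕ β := by
  subst hf hg
  rw [← C.interchange _ α β _ (by simp) (by simp) (by simpa), C.vcomp_id₂, C.id₂_vcomp]

/-- The exchange law for 2-morphisms on adjacent 1-morphisms. -/
theorem exchange (α β : C.Mor₂) (f f' g g' : C.Mor₁) (h : C.cod (C.src α) = C.dom (C.src β))
    (hf : C.src α = f) (hf' : C.tgt α = f') (hg : C.src β = g) (hg' : C.tgt β = g') :
    (α ⊡ₕ C.id₂ g) ⊡ᵥ (C.id₂ f' ⊡ₕ β) = (C.id₂ f ⊡ₕ β) ⊡ᵥ (α ⊡ₕ C.id₂ g') := by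
  rw [exchange_left C α β _ _ h hg hf', exchange_right C α β _ _ h hf hg']

theorem hcomp_id₂_id₂ (α : C.Mor₂) (f g : C.Mor₁) (h : C.cod (C.src α) = C.dom f)
    (h' : C.cod f = C.dom g) : α ⊡ₕ C.id₂ f ⊡ₕ C.id₂ g = α ⊡ₕ C.id₂ (f ∗₁ g) := by
  rw [C.id₂_comp _ _ h', C.hcomp_assoc _ _ _ (by simpa) (by simpa)]

theorem id₂_id₂_hcomp (α : C.Mor₂) (f g : C.Mor₁) (h : C.cod g = C.dom (C.src α))
    (h' : C.cod f = C.dom g) : C.id₂ f ⊡ₕ (C.id₂ g ⊡ₕ α) = C.id₂ (f ∗₁ g) ⊡ₕ α := by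
  rw [C.id₂_comp _ _ h', C.hcomp_assoc _ _ _ (by simpa) (by simpa)]

theorem id₂_hcomp_id₂ (α : C.Mor₂) (f g : C.Mor₁) (h : C.cod f = C.dom (C.src α))
    (h' : C.cod (C.src α) = C.dom g) :
    C.id₂ f ⊡ₕ α ⊡ₕ C.id₂ g = C.id₂ f ⊡ₕ (α ⊡ₕ C.id₂ g) :=
  C.hcomp_assoc _ _ _ (by simpa) (by simpa)

theorem hcomp_id₂_id₁ (α : C.Mor₂) (A : C.Obj) (h : C.cod (C.src α) = A) :
    α ⊡ₕ C.id₂ (C.id₁ A) = α := by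
  subst h; exact C.hcomp_id α

theorem id₂_id₁_hcomp (α : C.Mor₂) (A : C.Obj) (h : C.dom (C.src α) = A) :
    C.id₂ (C.id₁ A) ⊡ₕ α = α := by
  subst h; exact C.id_hcomp α

theorem id₂_vcomp' (α : C.Mor₂) (f : C.Mor₁) (h : C.src α = f) : C.id₂ f ⊡ᵥ α = α := by
  subst h; exact C.id₂_vcomp α

theorem vcomp_id₂' (α : C.Mor₂) (f : C.Mor₁) (h : C.tgt α = f) : α ⊡ᵥ C.id₂ f = α := by
  subst h; exact C.vcomp_id₂ α

theorem id₁_comp' (f : C.Mor₁) (A : C.Obj) (h : C.dom f = A) : C.id₁ A ∗₁ f = f := by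
  subst h; exact C.id₁_comp f

theorem comp_id₁' (f : C.Mor₁) (A : C.Obj) (h : C.cod f = A) : f ∗₁ C.id₁ A = f := by
  subst h; exact C.comp_id₁ f

end Whiskering

attribute [simp] comp_assoc id₁_comp' comp_id₁' tensor_assoc tl₁_tl₁ tr₁_tr₁


/-! ### Mates and adjoints of 2-morphisms. -/

variable {C : StrictTwoCategory.{u, v, w}} [SemistrictMonoidal C] [DualData C] [HasDuals C]

/-- The inverse mate of `κ : 1 ⇒ g k`. -/
theorem unit₁_vcomp_mate {A B : C.Obj} (g : C.Hom A B) (k : C.Hom B A) (κ : C.Mor₂)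
    (hs : C.src κ = C.id₁ A) (ht : C.tgt κ = g.1 ∗₁ k.1) :
    unit₁ g.1 ⊡ᵥ (C.id₂ g.1 ⊡ₕ ((C.id₂ (dual₁ g.1) ⊡ₕ κ) ⊡ᵥ (counit₁ g.1 ⊡ₕ C.id₂ k.1))) = κ := by
  rw [id₂_hcomp_vcomp C _ _ _ (by simp (maxDischargeDepth := 9) [*]) (by simp (maxDischargeDepth := 9) [*]),
    id₂_id₂_hcomp C _ _ _ (by simp (maxDischargeDepth := 9) [*]) (by simp (maxDischargeDepth := 9)),
    ← C.vcomp_assoc _ _ _ (by simp (maxDischargeDepth := 9) [*]) (by simp (maxDischargeDepth := 9) [*])]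
  -- κ and the unit of g act on adjacent 1-morphisms. After exchanging them, unit and counit of g
  -- meet in a zigzag and only κ is left.
  have h1 := C.exchange (unit₁ g.1) κ _ _ _ _ (by simp (maxDischargeDepth := 9) [*]) rfl rfl rfl rfl
  rw [hs, ht, hcomp_id₂_id₁ C _ _ (by simp (maxDischargeDepth := 9))] at h1
  simp only [tgt_unit₁, src_unit₁, Hom.dom_eq] at h1
  rw [h1, id₂_id₁_hcomp C _ _ (by simp [hs]), C.vcomp_assoc _ _ _ (by simp (maxDischargeDepth := 9) [*])
    (by simp (maxDischargeDepth := 9) [*]), ← C.hcomp_id₂_id₂ _ _ _ (by simp (maxDischargeDepth := 9)) (by simp (maxDischargeDepth := 9)),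
    ← id₂_hcomp_id₂ _ _ _ _ (by simp (maxDischargeDepth := 9)) (by simp (maxDischargeDepth := 9)),
    ← vcomp_hcomp_id₂ _ _ _ _ (by simp (maxDischargeDepth := 9)) (by simp (maxDischargeDepth := 9)), HasDuals.zigzag,
    ← C.id₂_comp _ _ (by simp (maxDischargeDepth := 9))]
  exact vcomp_id₂' _ _ _ ht

/-- The other half of the bijection between 2-morphisms 1 ⇒ g k and g* ⇒ k. It gives uniqueness, so
an adjoint can be recognised by its sliding property alone. -/
theorem mate_unit₁_vcomp {A B : C.Obj} (g : C.Hom A B) (k : C.Hom B A) (ρ : C.Mor₂)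
    (hs : C.src ρ = dual₁ g.1) (ht : C.tgt ρ = k.1) :
    (C.id₂ (dual₁ g.1) ⊡ₕ (unit₁ g.1 ⊡ᵥ (C.id₂ g.1 ⊡ₕ ρ))) ⊡ᵥ (counit₁ g.1 ⊡ₕ C.id₂ k.1) = ρ := by
  rw [id₂_hcomp_vcomp C _ _ _ (by simp (maxDischargeDepth := 9) [*]) (by simp (maxDischargeDepth := 9) [*]),
    id₂_id₂_hcomp C _ _ _ (by simp (maxDischargeDepth := 9) [*]) (by simp (maxDischargeDepth := 9)),
    C.vcomp_assoc _ _ _ (by simp (maxDischargeDepth := 9) [*]) (by simp (maxDischargeDepth := 9) [*])]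
  have h1 := C.exchange (counit₁ g.1) ρ _ _ _ _ (by simp (maxDischargeDepth := 9) [*]) rfl rfl rfl rfl
  rw [hs, ht] at h1
  simp only [tgt_counit₁, src_counit₁, Hom.cod_eq] at h1
  rw [← h1, id₂_id₁_hcomp C _ _ (by simp [hs]), ← C.vcomp_assoc _ _ _
    (by simp (maxDischargeDepth := 9) [*]) (by simp (maxDischargeDepth := 9) [*]), HasDuals.zigzag_dual]
  exact id₂_vcomp' _ _ _ hs

/-- Exhibits α† as the mate of i_f · (α ∘ f*), which makes the mate bijection applicable to it. -/
theorem adjoint₂_eq_mate {A B : C.Obj} {f g : C.Hom A B} (α : f ⟶ g) :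
    adjoint₂ α.1 = (C.id₂ (dual₁ g.1) ⊡ₕ (unit₁ f.1 ⊡ᵥ (α.1 ⊡ₕ C.id₂ (dual₁ f.1)))) ⊡ᵥ
      (counit₁ g.1 ⊡ₕ C.id₂ (dual₁ f.1)) := by
  rw [adjoint₂, Hom₂.src_eq, Hom₂.tgt_eq, id₂_hcomp_id₂ _ _ _ _ (by simp (maxDischargeDepth := 9)) (by simp (maxDischargeDepth := 9)),
    ← id₂_hcomp_vcomp _ _ _ _ (by simp (maxDischargeDepth := 9)) (by simp (maxDischargeDepth := 9))]

@[simp] theorem src_adjoint₂ (α : C.Mor₂) : C.src (adjoint₂ α) = dual₁ (C.tgt α) := by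
  rw [adjoint₂]; simp (maxDischargeDepth := 9)

@[simp] theorem tgt_adjoint₂ (α : C.Mor₂) : C.tgt (adjoint₂ α) = dual₁ (C.src α) := by
  rw [adjoint₂]; simp (maxDischargeDepth := 9)

/-- Sliding a 2-morphism around the unit. -/
theorem unit₁_slide {A B : C.Obj} {f g : C.Hom A B} (α : f ⟶ g) :
    unit₁ g.1 ⊡ᵥ (C.id₂ g.1 ⊡ₕ adjoint₂ α.1) = unit₁ f.1 ⊡ᵥ (α.1 ⊡ₕ C.id₂ (dual₁ f.1)) := by
  rw [adjoint₂_eq_mate]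
  exact unit₁_vcomp_mate g ⟨dual₁ f.1, by simp (maxDischargeDepth := 9), by simp (maxDischargeDepth := 9)⟩ _ (by simp (maxDischargeDepth := 9)) (by simp (maxDischargeDepth := 9))

theorem eq_adjoint₂ {A B : C.Obj} {f g : C.Hom A B} (α : f ⟶ g) (ρ : C.Mor₂)
    (hs : C.src ρ = dual₁ g.1) (ht : C.tgt ρ = dual₁ f.1)
    (h : unit₁ g.1 ⊡ᵥ (C.id₂ g.1 ⊡ₕ ρ) = unit₁ f.1 ⊡ᵥ (α.1 ⊡ₕ C.id₂ (dual₁ f.1))) :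
    ρ = adjoint₂ α.1 := by
  rw [adjoint₂_eq_mate, ← h]
  exact (mate_unit₁_vcomp g ⟨dual₁ f.1, by simp (maxDischargeDepth := 9), by simp (maxDischargeDepth := 9)⟩ ρ hs ht).symm

theorem adjoint₂_id₂ {A B : C.Obj} (f : C.Hom A B) :
    adjoint₂ (C.id₂ f.1) = C.id₂ (dual₁ f.1) := by
  refine (eq_adjoint₂ (𝟙 f) _ (by simp (maxDischargeDepth := 9)) (by simp (maxDischargeDepth := 9)) ?_).symm
  change _ = unit₁ f.1 ⊡ᵥ (C.id₂ f.1 ⊡ₕ _)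
  rfl

/-- By uniqueness of mates it suffices that β† · α† slides around the unit to α · β. The factors are
slid one after the other, with an exchange of β past α† in between. -/
theorem adjoint₂_vcomp {A B : C.Obj} {f g h : C.Hom A B} (α : f ⟶ g) (β : g ⟶ h) :
    adjoint₂ (α.1 ⊡ᵥ β.1) = adjoint₂ β.1 ⊡ᵥ adjoint₂ α.1 := by
  refine (eq_adjoint₂ (α ≫ β) _ (by simp (maxDischargeDepth := 9)) (by simp (maxDischargeDepth := 9)) ?_).symm
  change _ = unit₁ f.1 ⊡ᵥ ((α.1 ⊡ᵥ β.1) ⊡ₕ _)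
  rw [id₂_hcomp_vcomp _ _ _ _ (by simp (maxDischargeDepth := 9)) (by simp (maxDischargeDepth := 9)), ← C.vcomp_assoc _ _ _ (by simp (maxDischargeDepth := 9)) (by simp (maxDischargeDepth := 9)),
    unit₁_slide, C.vcomp_assoc _ _ _ (by simp (maxDischargeDepth := 9)) (by simp (maxDischargeDepth := 9)),
    C.exchange β.1 (adjoint₂ α.1) g.1 h.1 (dual₁ g.1) (dual₁ f.1) (by simp (maxDischargeDepth := 9)) (by simp (maxDischargeDepth := 9)) (by simp (maxDischargeDepth := 9))
      (by simp (maxDischargeDepth := 9)) (by simp (maxDischargeDepth := 9)), ← C.vcomp_assoc _ _ _ (by simp (maxDischargeDepth := 9)) (by simp (maxDischargeDepth := 9)), unit₁_slide,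
    C.vcomp_assoc _ _ _ (by simp (maxDischargeDepth := 9)) (by simp (maxDischargeDepth := 9)), ← vcomp_hcomp_id₂ _ _ _ _ (by simp (maxDischargeDepth := 9)) (by simp (maxDischargeDepth := 9))]

/-! ### Traces of endomorphisms of 1-morphisms, and partial traces. -/

section Traces

variable {C : StrictTwoCategory.{u, v, w}} [SemistrictMonoidal C] [DualData C] [HasDuals C]

/-- The dual of a 2-morphism on the categories `Hom`. -/
def Hom.dual₂ {A B : C.Obj} {f g : C.Hom A B} (α : f ⟶ g) : g ⟶ f :=
  ⟨DualData.dual₂ α.1, by simp, by simp⟩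

/-- Sliding a 2-morphism around the dual of the unit. -/
theorem slide_dual₂_unit₁ {A B : C.Obj} {f g : C.Hom A B} (α : f ⟶ g) :
    (α.1 ⊡ₕ C.id₂ (dual₁ g.1)) ⊡ᵥ dual₂ (unit₁ g.1) =
      (C.id₂ f.1 ⊡ₕ adjoint₂ α.1) ⊡ᵥ dual₂ (unit₁ f.1) := by
  -- The unit law is applied to α* and then dualised; the axiom α†* = α*† turns the result into a
  -- statement about α†.
  have h := congrArg dual₂ (unit₁_slide (Hom.dual₂ α))
  simp only [Hom.dual₂] at h
  rw [HasDuals.dual₂_vcomp _ _ (by simp (maxDischargeDepth := 9)), HasDuals.dual₂_vcomp _ _ (by simp (maxDischargeDepth := 9)),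
    HasDuals.dual₂_hcomp _ _ (by simp (maxDischargeDepth := 9)), HasDuals.dual₂_hcomp _ _ (by simp (maxDischargeDepth := 9)),
    HasDuals.dual₂_adjoint₂, HasDuals.dual₂_id₂, HasDuals.dual₂_id₂, HasDuals.dual₂_dual₂] at h
  exact h.symm

/-- The trace `i_f · (γ ∘ f*) · i_f*` of an endomorphism of `f`. -/
def trace {A B : C.Obj} (f : C.Hom A B) (γ : f ⟶ f) : idHom A ⟶ idHom A :=
  ⟨unit₁ f.1 ⊡ᵥ (γ.1 ⊡ₕ C.id₂ (dual₁ f.1)) ⊡ᵥ dual₂ (unit₁ f.1), by simp (maxDischargeDepth := 9), by simp (maxDischargeDepth := 9)⟩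

/-- The partial trace of a 2-morphism `f g ⇒ f' g` over `g`. -/
def partialTrace {A B D : C.Obj} {f f' : C.Hom A B} (g : C.Hom B D) (ζ : f.comp g ⟶ f'.comp g) :
    f ⟶ f' :=
  ⟨(C.id₂ f.1 ⊡ₕ unit₁ g.1) ⊡ᵥ (ζ.1 ⊡ₕ C.id₂ (dual₁ g.1)) ⊡ᵥ (C.id₂ f'.1 ⊡ₕ dual₂ (unit₁ g.1)),
    by simp (maxDischargeDepth := 9), by simp (maxDischargeDepth := 9)⟩

/-- α travels around the loop: over the unit it becomes α† on the dual strand, passes β by exchange,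
and returns over the dual of the unit on the other side of β. -/
theorem trace_comm {A B : C.Obj} {f g : C.Hom A B} (α : f ⟶ g) (β : g ⟶ f) :
    trace f (α ≫ β) = trace g (β ≫ α) := by
  apply Hom₂.ext
  change unit₁ f.1 ⊡ᵥ ((α.1 ⊡ᵥ β.1) ⊡ₕ _) ⊡ᵥ _ = unit₁ g.1 ⊡ᵥ ((β.1 ⊡ᵥ α.1) ⊡ₕ _) ⊡ᵥ _
  rw [vcomp_hcomp_id₂ _ _ _ _ (by simp (maxDischargeDepth := 9)) (by simp (maxDischargeDepth := 9)), ← C.vcomp_assoc _ _ _ (by simp (maxDischargeDepth := 9)) (by simp (maxDischargeDepth := 9)),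
    ← unit₁_slide, C.vcomp_assoc (unit₁ g.1) _ _ (by simp (maxDischargeDepth := 9)) (by simp (maxDischargeDepth := 9)),
    ← C.exchange β.1 (adjoint₂ α.1) g.1 f.1 (dual₁ g.1) (dual₁ f.1) (by simp (maxDischargeDepth := 9)) (by simp (maxDischargeDepth := 9)) (by simp (maxDischargeDepth := 9))
      (by simp (maxDischargeDepth := 9)) (by simp (maxDischargeDepth := 9)), C.vcomp_assoc _ _ _ (by simp (maxDischargeDepth := 9)) (by simp (maxDischargeDepth := 9)),
    C.vcomp_assoc _ _ _ (by simp (maxDischargeDepth := 9)) (by simp (maxDischargeDepth := 9)), ← slide_dual₂_unit₁,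
    vcomp_hcomp_id₂ _ _ _ _ (by simp (maxDischargeDepth := 9)) (by simp (maxDischargeDepth := 9)), C.vcomp_assoc _ _ _ (by simp (maxDischargeDepth := 9)) (by simp (maxDischargeDepth := 9)),
    C.vcomp_assoc _ _ _ (by simp (maxDischargeDepth := 9)) (by simp (maxDischargeDepth := 9))]

/-- The unit of a composite is the unit of g nested inside that of f, so the loop of f g consists of
two nested loops and the inner one may be closed first. -/
theorem trace_comp {A B D : C.Obj} (f : C.Hom A B) (g : C.Hom B D) (ζ : f.comp g ⟶ f.comp g) :
    trace (f.comp g) ζ = trace f (partialTrace g ζ) := by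
  have hs : C.src ζ.1 = f.1 ∗₁ g.1 := ζ.2
  have ht : C.tgt ζ.1 = f.1 ∗₁ g.1 := ζ.3
  apply Hom₂.ext
  change unit₁ (f.1 ∗₁ g.1) ⊡ᵥ (ζ.1 ⊡ₕ C.id₂ (dual₁ (f.1 ∗₁ g.1))) ⊡ᵥ
    dual₂ (unit₁ (f.1 ∗₁ g.1)) = unit₁ f.1 ⊡ᵥ
      (((C.id₂ f.1 ⊡ₕ unit₁ g.1) ⊡ᵥ (ζ.1 ⊡ₕ C.id₂ (dual₁ g.1)) ⊡ᵥ
        (C.id₂ f.1 ⊡ₕ dual₂ (unit₁ g.1))) ⊡ₕ C.id₂ (dual₁ f.1)) ⊡ᵥ dual₂ (unit₁ f.1)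
  rw [HasDuals.unit₁_comp _ _ (by simp (maxDischargeDepth := 9)), HasDuals.dual₁_comp _ _ (by simp (maxDischargeDepth := 9)),
    HasDuals.dual₂_vcomp _ _ (by simp (maxDischargeDepth := 9)), HasDuals.dual₂_hcomp _ _ (by simp (maxDischargeDepth := 9)),
    HasDuals.dual₂_hcomp _ _ (by simp (maxDischargeDepth := 9)), HasDuals.dual₂_id₂, HasDuals.dual₂_id₂,
    vcomp_hcomp_id₂ _ _ _ _ (by simp (maxDischargeDepth := 9) [*]) (by simp (maxDischargeDepth := 9) [*]),
    vcomp_hcomp_id₂ _ _ _ _ (by simp (maxDischargeDepth := 9) [*]) (by simp (maxDischargeDepth := 9) [*]),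
    C.hcomp_id₂_id₂ ζ.1 _ _ (by simp (maxDischargeDepth := 9) [*]) (by simp (maxDischargeDepth := 9))]
  simp (maxDischargeDepth := 9) [C.vcomp_assoc, C.comp_assoc, id₁_comp', comp_id₁', hs, ht]

/-- The law for units of composites gives i = i · i, and the zigzag gives i · e = 1 for i the unit
and e the counit of 1_A. Hence 1 = i · e = i · i · e = i. -/
theorem unit₁_id₁ (A : C.Obj) : unit₁ (C.id₁ A) = C.id₂ (C.id₁ A) := by
  have h1 := HasDuals.zigzag (C.id₁ A)
  have h2 := HasDuals.unit₁_comp (C.id₁ A) (C.id₁ A) (by simp (maxDischargeDepth := 9))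
  rw [HasDuals.dual₁_id₁, id₂_id₁_hcomp _ _ _ (by simp (maxDischargeDepth := 9)), hcomp_id₂_id₁ _ _ _ (by
    simp [HasDuals.dual₁_id₁]), comp_id₁' _ _ _ (by simp)] at h2
  rw [id₂_id₁_hcomp _ _ _ (by simp [HasDuals.dual₁_id₁, comp_id₁']), hcomp_id₂_id₁ _ _ _ (by
    simp)] at h1
  have h3 := congrArg (· ⊡ᵥ counit₁ (C.id₁ A)) h2
  beta_reduce at h3
  rw [h1, C.vcomp_assoc _ _ _ (by simp [HasDuals.dual₁_id₁, comp_id₁'])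
    (by simp [HasDuals.dual₁_id₁, comp_id₁']), h1, vcomp_id₂' _ _ _
    (by simp [HasDuals.dual₁_id₁, comp_id₁'])] at h3
  exact h3.symm

theorem trace_idHom {A : C.Obj} (ζ : idHom A ⟶ idHom A) : trace (idHom A) ζ = ζ := by
  have hs : C.src ζ.1 = C.id₁ A := ζ.2
  have ht : C.tgt ζ.1 = C.id₁ A := ζ.3
  apply Hom₂.ext
  change unit₁ (C.id₁ A) ⊡ᵥ (ζ.1 ⊡ₕ C.id₂ (dual₁ (C.id₁ A))) ⊡ᵥ dual₂ (unit₁ (C.id₁ A)) = _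
  rw [unit₁_id₁, HasDuals.dual₁_id₁, HasDuals.dual₂_id₂, hcomp_id₂_id₁ _ _ _ (by simp (maxDischargeDepth := 9) [*]),
    id₂_vcomp' _ _ _ hs, vcomp_id₂' _ _ _ ht]

/-- The cap of f is the unit of i_A (f ⊗ A*), hence the loop of f nested in the loop of i_A. The
closed formula therefore sees γ only through its trace in 2End(1_A), and every trace identity
becomes an identity of pairings. -/
theorem closeUp_raw {A B : C.Obj} (f : C.Hom A B) (γ : f ⟶ f) :
    capR f.1 ⊡ᵥ trR₂ (γ.1 ⊡ₕ C.id₂ (dual₁ f.1)) ⊡ᵥ cupR f.1 =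
      unit₁ (unit₀ A) ⊡ᵥ (C.id₂ (unit₀ A) ⊡ₕ (trace f γ).1 ▷₂ dual₀ A ⊡ₕ
        C.id₂ (dual₁ (unit₀ A))) ⊡ᵥ dual₂ (unit₁ (unit₀ A)) := by
  have hf : C.dom (C.src (γ.1 ⊡ₕ C.id₂ (dual₁ f.1))) = A := by simp (maxDischargeDepth := 9)
  simp only [cupR, capR, trR₂, trace, hf, Hom.dom_eq]
  rw [HasDuals.unit₁_comp _ _ (by simp (maxDischargeDepth := 9)), HasDuals.unit₁_tr₁,
    HasDuals.dual₂_vcomp _ _ (by simp (maxDischargeDepth := 9)), HasDuals.dual₂_hcomp _ _ (by simp (maxDischargeDepth := 9)),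
    HasDuals.dual₂_hcomp _ _ (by simp (maxDischargeDepth := 9)), HasDuals.dual₂_id₂, HasDuals.dual₂_id₂,
    HasDuals.dual₂_tr₂, tr₂_vcomp _ _ _ (by simp (maxDischargeDepth := 9)), tr₂_vcomp _ _ _ (by simp (maxDischargeDepth := 9)),
    id₂_hcomp_vcomp _ _ _ _ (by simp (maxDischargeDepth := 9)) (by simp (maxDischargeDepth := 9)), id₂_hcomp_vcomp _ _ _ _ (by simp (maxDischargeDepth := 9)) (by simp (maxDischargeDepth := 9)),
    vcomp_hcomp_id₂ _ _ _ _ (by simp (maxDischargeDepth := 9)) (by simp (maxDischargeDepth := 9)), vcomp_hcomp_id₂ _ _ _ _ (by simp (maxDischargeDepth := 9)) (by simp (maxDischargeDepth := 9)),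
    HasDuals.counit₀_dual]
  simp (maxDischargeDepth := 9) [C.vcomp_assoc, C.comp_assoc, id₁_comp', comp_id₁']

end Traces

/-! ### Closing up to scalars: symmetry of the pairing and quantum dimensions. -/

section CloseUp

variable (F : Type x) [Field F] {C : StrictTwoCategory.{u, v, w}} [SemistrictMonoidal C]
  [∀ A B : C.Obj, Preadditive (C.Hom A B)] [∀ A B : C.Obj, Linear F (C.Hom A B)]
  [VectLinear F C] [DualData C] [HasDuals C]

theorem closeUp_eq_of_trace {A B B' : C.Obj} {f : C.Hom A B} {g : C.Hom A B'} {γ : f ⟶ f}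
    {γ' : g ⟶ g} (h : trace f γ = trace g γ') : closeUpₗ F f γ = closeUpₗ F g γ' := by
  apply Hom₂.ext
  rw [closeUpₗ_val, closeUpₗ_val, closeUp_raw, closeUp_raw, h]

theorem closeUp_trace {A B : C.Obj} (f : C.Hom A B) (γ : f ⟶ f) :
    closeUpₗ F (idHom A) (trace f γ) = closeUpₗ F f γ :=
  closeUp_eq_of_trace F (trace_idHom _)

theorem closeUp_comm {A B : C.Obj} {f g : C.Hom A B} (α : f ⟶ g) (β : g ⟶ f) :
    closeUpₗ F f (α ≫ β) = closeUpₗ F g (β ≫ α) :=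
  closeUp_eq_of_trace F (trace_comm α β)

theorem closeUp_comp {A B D : C.Obj} (f : C.Hom A B) (g : C.Hom B D)
    (ζ : f.comp g ⟶ f.comp g) :
    closeUpₗ F (f.comp g) ζ = closeUpₗ F f (partialTrace g ζ) :=
  closeUp_eq_of_trace F (trace_comp f g ζ)

theorem trace_congr {A B B' : C.Obj} {f : C.Hom A B} {g : C.Hom A B'} {γ : f ⟶ f}
    {γ' : g ⟶ g} (h : f.1 = g.1) (h' : γ.1 = γ'.1) : trace f γ = trace g γ' := by
  apply Hom₂.ext
  simp only [trace, h, h']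

theorem closeUp_congr {A B B' : C.Obj} {f : C.Hom A B} {g : C.Hom A B'} {γ : f ⟶ f}
    {γ' : g ⟶ g} (h : f.1 = g.1) (h' : γ.1 = γ'.1) : closeUpₗ F f γ = closeUpₗ F g γ' :=
  closeUp_eq_of_trace F (trace_congr h h')

variable [ScalarUnit F C]

theorem pairing_apply {A B : C.Obj} (f g : C.Hom A B) (α : f ⟶ g) (β : g ⟶ f) :
    pairing F f g α β = scalarEquiv F (closeUpₗ F f (α ≫ β)) := rfl

theorem pairing_symm {A B : C.Obj} (f g : C.Hom A B) (α : f ⟶ g) (β : g ⟶ f) :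
    pairing F f g α β = pairing F g f β α := by
  rw [pairing_apply, pairing_apply, closeUp_comm]

theorem qdim₁_eq {A B : C.Obj} (f : C.Hom A B) :
    qdim₁ F f = scalarEquiv F (closeUpₗ F f (𝟙 f)) := by
  rw [qdim₁, pairing_apply, Category.comp_id]

end CloseUp

/-! ### Sliding loops through the tensorator. -/

section TensoratorSlides

variable {C : StrictTwoCategory.{u, v, w}} [SemistrictMonoidal C] [DualData C] [HasDuals C]

/-- Unitarity says that the dual is an inverse, and inverses are unique. -/
theorem dual₂_tensorator (f g : C.Mor₁) : dual₂ (tensorator f g) = tensoratorInv f g := by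
  have h1 := (HasDuals.unitary_tensorator f g).1
  have h2 := congrArg (tensoratorInv f g ⊡ᵥ ·) h1
  beta_reduce at h2
  rw [← C.vcomp_assoc _ _ _ (by simp (maxDischargeDepth := 9)) (by simp (maxDischargeDepth := 9)), inv_tensorator, id₂_vcomp' _ _ _ (by simp (maxDischargeDepth := 9)),
    vcomp_id₂' _ _ _ (by simp (maxDischargeDepth := 9))] at h2
  exact h2

theorem dual₂_tensoratorInv (f g : C.Mor₁) : dual₂ (tensoratorInv f g) = tensorator f g := by
  rw [← dual₂_tensorator, HasDuals.dual₂_dual₂]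

/-- Sliding the unit of `g` through the tensorator. -/
theorem unit_tensorator_slide {X X' Y Y' : C.Obj} (f : C.Hom X X') (g : C.Hom Y Y') :
    (C.id₂ (f.1 ▷₁ Y) ⊡ₕ unit₁ (X' ◁₁ g.1)) ⊡ᵥ
        (tensorator f.1 g.1 ⊡ₕ C.id₂ (X' ◁₁ dual₁ g.1)) =
      (unit₁ (X ◁₁ g.1) ⊡ₕ C.id₂ (f.1 ▷₁ Y)) ⊡ᵥ
        (C.id₂ (X ◁₁ g.1) ⊡ₕ tensoratorInv f.1 (dual₁ g.1)) := by
  -- Naturality at the unit of g relates the identity tensorator of f with 1_Y to that of f with g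
  -- g*. The latter splits into those with g and with g*, and the second is moved to the other side
  -- by its inverse.
  have h1 := tensorator_natural (C.id₂ f.1) (unit₁ g.1)
  have h2 := tensorator_comp_right f.1 g.1 (dual₁ g.1) (by simp (maxDischargeDepth := 9))
  simp only [src_unit₁, tgt_unit₁, Hom.dom_eq, Hom.cod_eq, src_id₂, tgt_id₂, dom_id₁, cod_id₁,
    tr₂_id₂, tensorator_id_right] at h1 h2
  rw [h2, id₂_vcomp' _ _ _ (by simp (maxDischargeDepth := 9)), ← C.vcomp_assoc _ _ _ (by simp (maxDischargeDepth := 9)) (by simp (maxDischargeDepth := 9))] at h1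
  have h3 := congrArg (· ⊡ᵥ (C.id₂ (X ◁₁ g.1) ⊡ₕ tensoratorInv f.1 (dual₁ g.1))) h1
  beta_reduce at h3
  rw [C.vcomp_assoc _ _ _ (by simp (maxDischargeDepth := 9)) (by simp (maxDischargeDepth := 9)), ← id₂_hcomp_vcomp _ _ _ _ (by simp (maxDischargeDepth := 9)) (by simp (maxDischargeDepth := 9)),
    tensorator_inv, ← C.id₂_comp _ _ (by simp (maxDischargeDepth := 9)), vcomp_id₂' _ _ _ (by simp (maxDischargeDepth := 9))] at h3
  rw [HasDuals.unit₁_tl₁, HasDuals.unit₁_tl₁, h3]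

/-- Sliding the dual of the unit of `g` through the tensorator. -/
theorem tensorator_dual_unit_slide {X X' Y Y' : C.Obj} (f : C.Hom X X') (g : C.Hom Y Y') :
    (tensoratorInv f.1 g.1 ⊡ₕ C.id₂ (X' ◁₁ dual₁ g.1)) ⊡ᵥ
        (C.id₂ (f.1 ▷₁ Y) ⊡ₕ dual₂ (unit₁ (X' ◁₁ g.1))) =
      (C.id₂ (X ◁₁ g.1) ⊡ₕ tensorator f.1 (dual₁ g.1)) ⊡ᵥ
        (dual₂ (unit₁ (X ◁₁ g.1)) ⊡ₕ C.id₂ (f.1 ▷₁ Y)) := by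
  have h := congrArg dual₂ (unit_tensorator_slide f g)
  rw [HasDuals.dual₂_vcomp _ _ (by simp (maxDischargeDepth := 9)), HasDuals.dual₂_vcomp _ _ (by simp (maxDischargeDepth := 9)),
    HasDuals.dual₂_hcomp _ _ (by simp (maxDischargeDepth := 9)), HasDuals.dual₂_hcomp _ _ (by simp (maxDischargeDepth := 9)),
    HasDuals.dual₂_hcomp _ _ (by simp (maxDischargeDepth := 9)), HasDuals.dual₂_hcomp _ _ (by simp (maxDischargeDepth := 9))] at h
  simpa only [HasDuals.dual₂_id₂, dual₂_tensorator, dual₂_tensoratorInv] using h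

/-- Sliding the unit of `f*` through the tensorator. -/
theorem unit_dual_tensorator_slide {X X' Y Y' : C.Obj} (f : C.Hom X X') (g : C.Hom Y Y') :
    (unit₁ (dual₁ f.1 ▷₁ Y) ⊡ₕ C.id₂ (X' ◁₁ g.1)) ⊡ᵥ
        (C.id₂ (dual₁ f.1 ▷₁ Y) ⊡ₕ tensorator f.1 g.1) ⊡ᵥ
        (tensorator (dual₁ f.1) g.1 ⊡ₕ C.id₂ (f.1 ▷₁ Y')) =
      C.id₂ (X' ◁₁ g.1) ⊡ₕ unit₁ (dual₁ f.1 ▷₁ Y') := by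
  -- The same principle in the first variable, at the unit of f*; here both factors of the
  -- tensorator of f* f with g stay on one side.
  have h1 := tensorator_natural (unit₁ (dual₁ f.1)) (C.id₂ g.1)
  have h2 := tensorator_comp_left (dual₁ f.1) f.1 g.1 (by simp (maxDischargeDepth := 9))
  simp only [src_unit₁, tgt_unit₁, Hom.dom_eq, Hom.cod_eq, src_id₂, tgt_id₂, dom_id₁, cod_id₁,
    tl₂_id₂, tensorator_id_left, dom_dual₁, HasDuals.dual₁_dual₁] at h1 h2
  rw [h2, id₂_vcomp' _ _ _ (by simp (maxDischargeDepth := 9)), ← C.vcomp_assoc _ _ _ (by simp (maxDischargeDepth := 9)) (by simp (maxDischargeDepth := 9))] at h1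
  rw [HasDuals.unit₁_tr₁, HasDuals.unit₁_tr₁, h1]

/-- The partial trace over `K = X' ⊗ g` of a 2-morphism conjugated by the tensorator. -/
theorem partialTrace_tensorator {Z X X' Y Y' : C.Obj} (f : C.Hom X X') (g : C.Hom Y Y')
    (P P' : C.Hom Z (X ⊗ₒ Y)) (ζ : C.Mor₂) (hs : C.src ζ = P.1 ∗₁ X ◁₁ g.1)
    (ht : C.tgt ζ = P'.1 ∗₁ X ◁₁ g.1) :
    (C.id₂ (P.1 ∗₁ f.1 ▷₁ Y) ⊡ₕ unit₁ (X' ◁₁ g.1)) ⊡ᵥ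
        (((C.id₂ P.1 ⊡ₕ tensorator f.1 g.1) ⊡ᵥ ((ζ ⊡ₕ C.id₂ (f.1 ▷₁ Y')) ⊡ᵥ
          (C.id₂ P'.1 ⊡ₕ tensoratorInv f.1 g.1))) ⊡ₕ C.id₂ (dual₁ (X' ◁₁ g.1))) ⊡ᵥ
        (C.id₂ (P'.1 ∗₁ f.1 ▷₁ Y) ⊡ₕ dual₂ (unit₁ (X' ◁₁ g.1))) =
      ((C.id₂ P.1 ⊡ₕ unit₁ (X ◁₁ g.1)) ⊡ᵥ (ζ ⊡ₕ C.id₂ (dual₁ (X ◁₁ g.1))) ⊡ᵥ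
        (C.id₂ P'.1 ⊡ₕ dual₂ (unit₁ (X ◁₁ g.1)))) ⊡ₕ C.id₂ (f.1 ▷₁ Y) := by
  -- The loop of g is pulled across f: its top (`a1`) and bottom (`a2`) each exchange a tensorator
  -- with g for one with g*, on the other side of f.
  have a1 : (C.id₂ (P.1 ∗₁ f.1 ▷₁ Y) ⊡ₕ unit₁ (X' ◁₁ g.1)) ⊡ᵥ
      ((C.id₂ P.1 ⊡ₕ tensorator f.1 g.1) ⊡ₕ C.id₂ (X' ◁₁ dual₁ g.1)) =
      (C.id₂ P.1 ⊡ₕ unit₁ (X ◁₁ g.1) ⊡ₕ C.id₂ (f.1 ▷₁ Y)) ⊡ᵥ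
        (C.id₂ (P.1 ∗₁ X ◁₁ g.1) ⊡ₕ tensoratorInv f.1 (dual₁ g.1)) := by
    rw [← id₂_id₂_hcomp _ _ _ _ (by simp (maxDischargeDepth := 9)) (by simp (maxDischargeDepth := 9)), id₂_hcomp_id₂ _ _ _ _ (by simp (maxDischargeDepth := 9)) (by simp (maxDischargeDepth := 9)),
      ← id₂_hcomp_vcomp _ _ _ _ (by simp (maxDischargeDepth := 9)) (by simp (maxDischargeDepth := 9)), unit_tensorator_slide f g,
      id₂_hcomp_vcomp _ _ _ _ (by simp (maxDischargeDepth := 9)) (by simp (maxDischargeDepth := 9)), id₂_id₂_hcomp _ _ _ _ (by simp (maxDischargeDepth := 9)) (by simp (maxDischargeDepth := 9)),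
      id₂_hcomp_id₂ _ _ _ _ (by simp (maxDischargeDepth := 9)) (by simp (maxDischargeDepth := 9))]
  have a2 : ((C.id₂ P'.1 ⊡ₕ tensoratorInv f.1 g.1) ⊡ₕ C.id₂ (X' ◁₁ dual₁ g.1)) ⊡ᵥ
      (C.id₂ (P'.1 ∗₁ f.1 ▷₁ Y) ⊡ₕ dual₂ (unit₁ (X' ◁₁ g.1))) =
      (C.id₂ (P'.1 ∗₁ X ◁₁ g.1) ⊡ₕ tensorator f.1 (dual₁ g.1)) ⊡ᵥ
        (C.id₂ P'.1 ⊡ₕ dual₂ (unit₁ (X ◁₁ g.1)) ⊡ₕ C.id₂ (f.1 ▷₁ Y)) := by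
    rw [← id₂_id₂_hcomp _ _ _ _ (by simp (maxDischargeDepth := 9)) (by simp (maxDischargeDepth := 9)), id₂_hcomp_id₂ _ _ _ _ (by simp (maxDischargeDepth := 9)) (by simp (maxDischargeDepth := 9)),
      ← id₂_hcomp_vcomp _ _ _ _ (by simp (maxDischargeDepth := 9)) (by simp (maxDischargeDepth := 9)), tensorator_dual_unit_slide f g,
      id₂_hcomp_vcomp _ _ _ _ (by simp (maxDischargeDepth := 9)) (by simp (maxDischargeDepth := 9)), id₂_id₂_hcomp _ _ _ _ (by simp (maxDischargeDepth := 9)) (by simp (maxDischargeDepth := 9)),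
      id₂_hcomp_id₂ _ _ _ _ (by simp (maxDischargeDepth := 9)) (by simp (maxDischargeDepth := 9))]
  -- The two tensorators with g* lie to the right of ζ, so they commute past it and cancel.
  have hc : (C.id₂ (P.1 ∗₁ X ◁₁ g.1) ⊡ₕ tensoratorInv f.1 (dual₁ g.1)) ⊡ᵥ
      (ζ ⊡ₕ C.id₂ (f.1 ▷₁ Y' ∗₁ X' ◁₁ dual₁ g.1)) ⊡ᵥ
      (C.id₂ (P'.1 ∗₁ X ◁₁ g.1) ⊡ₕ tensorator f.1 (dual₁ g.1)) =
      ζ ⊡ₕ C.id₂ (X ◁₁ dual₁ g.1 ∗₁ f.1 ▷₁ Y) := by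
    rw [exchange_right _ _ _ _ _ (by simp (maxDischargeDepth := 9) [*]) hs (by simp (maxDischargeDepth := 9)),
      ← exchange_left _ _ _ (X ◁₁ dual₁ g.1 ∗₁ f.1 ▷₁ Y) _ (by simp (maxDischargeDepth := 9) [*]) (by simp (maxDischargeDepth := 9)) ht,
      C.vcomp_assoc _ _ _ (by simp (maxDischargeDepth := 9) [*]) (by simp (maxDischargeDepth := 9) [*]), ← id₂_hcomp_vcomp _ _ _ _ (by simp (maxDischargeDepth := 9)) (by simp (maxDischargeDepth := 9))]
    have := inv_tensorator f.1 (dual₁ g.1)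
    simp only [Hom.dom_eq, Hom.cod_eq, cod_dual₁] at this
    rw [this, ← C.id₂_comp _ _ (by simp (maxDischargeDepth := 9))]
    exact vcomp_id₂' _ _ _ (by simp (maxDischargeDepth := 9) [*])
  rw [HasDuals.dual₁_tl₁, HasDuals.dual₁_tl₁, vcomp_hcomp_id₂ _ _ _ _ (by simp (maxDischargeDepth := 9) [*]) (by simp (maxDischargeDepth := 9) [*]),
    vcomp_hcomp_id₂ _ _ _ _ (by simp (maxDischargeDepth := 9) [*]) (by simp (maxDischargeDepth := 9) [*]), ← C.vcomp_assoc _ _ _ (by simp (maxDischargeDepth := 9) [*]) (by simp (maxDischargeDepth := 9) [*]), a1,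
    C.vcomp_assoc _ _ _ (by simp (maxDischargeDepth := 9) [*]) (by simp (maxDischargeDepth := 9) [*]), C.vcomp_assoc _ _ _ (by simp (maxDischargeDepth := 9) [*]) (by simp (maxDischargeDepth := 9) [*]),
    C.vcomp_assoc _ _ _ (by simp (maxDischargeDepth := 9) [*]) (by simp (maxDischargeDepth := 9) [*]), a2,
    hcomp_id₂_id₂ _ ζ _ _ (by simp (maxDischargeDepth := 9) [*]) (by simp (maxDischargeDepth := 9)), C.vcomp_assoc _ _ _ (by simp (maxDischargeDepth := 9) [*]) (by simp (maxDischargeDepth := 9) [*]),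
    ← C.vcomp_assoc _ (C.id₂ (P'.1 ∗₁ X ◁₁ g.1) ⊡ₕ tensorator f.1 (dual₁ g.1)) _
      (by simp (maxDischargeDepth := 9) [*]) (by simp (maxDischargeDepth := 9) [*]),
    ← C.vcomp_assoc _ (_ ⊡ᵥ _) _ (by simp (maxDischargeDepth := 9) [*]) (by simp (maxDischargeDepth := 9) [*]),
    ← C.vcomp_assoc _ (ζ ⊡ₕ _) _ (by simp (maxDischargeDepth := 9) [*]) (by simp (maxDischargeDepth := 9) [*]), hc,
    vcomp_hcomp_id₂ _ _ _ _ (by simp (maxDischargeDepth := 9) [*]) (by simp (maxDischargeDepth := 9) [*]), vcomp_hcomp_id₂ _ _ _ _ (by simp (maxDischargeDepth := 9) [*]) (by simp (maxDischargeDepth := 9) [*]),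
    hcomp_id₂_id₂ _ ζ _ _ (by simp (maxDischargeDepth := 9) [*]) (by simp (maxDischargeDepth := 9))]

end TensoratorSlides

/-- φ does not touch the strand g, so it can be pulled out of the loop. -/
theorem partialTrace_comp_hcomp {C : StrictTwoCategory.{u, v, w}} [SemistrictMonoidal C]
    [DualData C] [HasDuals C] {A B D : C.Obj} {f f' f'' : C.Hom A B} (g : C.Hom B D)
    (ξ : f.comp g ⟶ f'.comp g) (φ : f' ⟶ f'') :
    partialTrace g (ξ ≫ Hom.hcomp φ (𝟙 g)) = partialTrace g ξ ≫ φ := by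
  have hs : C.src ξ.1 = f.1 ∗₁ g.1 := ξ.2
  have ht : C.tgt ξ.1 = f'.1 ∗₁ g.1 := ξ.3
  apply Hom₂.ext
  change (C.id₂ f.1 ⊡ₕ unit₁ g.1) ⊡ᵥ ((ξ.1 ⊡ᵥ (φ.1 ⊡ₕ C.id₂ g.1)) ⊡ₕ C.id₂ (dual₁ g.1)) ⊡ᵥ
    (C.id₂ f''.1 ⊡ₕ dual₂ (unit₁ g.1)) = ((C.id₂ f.1 ⊡ₕ unit₁ g.1) ⊡ᵥ
      (ξ.1 ⊡ₕ C.id₂ (dual₁ g.1)) ⊡ᵥ (C.id₂ f'.1 ⊡ₕ dual₂ (unit₁ g.1))) ⊡ᵥ φ.1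
  rw [vcomp_hcomp_id₂ _ _ _ _ (by simp (maxDischargeDepth := 9) [*]) (by simp (maxDischargeDepth := 9) [*]), hcomp_id₂_id₂ _ _ _ _ (by simp (maxDischargeDepth := 9)) (by simp (maxDischargeDepth := 9)),
    C.vcomp_assoc _ _ _ (by simp (maxDischargeDepth := 9) [*]) (by simp (maxDischargeDepth := 9) [*]), C.vcomp_assoc _ _ _ (by simp (maxDischargeDepth := 9) [*]) (by simp (maxDischargeDepth := 9) [*]),
    C.exchange φ.1 (dual₂ (unit₁ g.1)) f'.1 f''.1 (g.1 ∗₁ dual₁ g.1) (C.id₁ B) (by simp (maxDischargeDepth := 9)) (by simp (maxDischargeDepth := 9))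
      (by simp (maxDischargeDepth := 9)) (by simp (maxDischargeDepth := 9)) (by simp (maxDischargeDepth := 9)), hcomp_id₂_id₁ _ φ.1 _ (by simp (maxDischargeDepth := 9)),
    C.vcomp_assoc _ _ _ (by simp (maxDischargeDepth := 9) [*]) (by simp (maxDischargeDepth := 9) [*]), C.vcomp_assoc _ _ _ (by simp (maxDischargeDepth := 9) [*]) (by simp (maxDischargeDepth := 9) [*])]

/-! ## Bending of objects -/

/-- An invertible 2-morphism. -/
def IsIso₂ {C : StrictTwoCategory.{u, v, w}} (α : C.Mor₂) : Prop :=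
  ∃ β, C.src β = C.tgt α ∧ C.tgt β = C.src α ∧ α ⊡ᵥ β = C.id₂ (C.src α) ∧
    β ⊡ᵥ α = C.id₂ (C.tgt α)

section IsIso₂

variable {C : StrictTwoCategory.{u, v, w}}

theorem IsIso₂.isIso {A B : C.Obj} {f g : C.Hom A B} {α : f ⟶ g} (h : IsIso₂ α.1) : IsIso α := by
  obtain ⟨β, h1, h2, h3, h4⟩ := h
  refine ⟨⟨⟨β, h1.trans α.3, h2.trans α.2⟩, Hom₂.ext ?_, Hom₂.ext ?_⟩⟩
  · exact h3.trans (by rw [α.2]; rfl)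
  · exact h4.trans (by rw [α.3]; rfl)

theorem IsIso₂.vcomp {α β : C.Mor₂} (hα : IsIso₂ α) (hβ : IsIso₂ β) (h : C.tgt α = C.src β) :
    IsIso₂ (α ⊡ᵥ β) := by
  obtain ⟨α', h1, h2, h3, h4⟩ := hα
  obtain ⟨β', k1, k2, k3, k4⟩ := hβ
  refine ⟨β' ⊡ᵥ α', by simp (maxDischargeDepth := 9) [*], by simp (maxDischargeDepth := 9) [*], ?_, ?_⟩
  · rw [C.vcomp_assoc _ _ _ (by simp (maxDischargeDepth := 9) [*]) (by simp (maxDischargeDepth := 9) [*]), ← C.vcomp_assoc β _ _ (by simp (maxDischargeDepth := 9) [*]) (by simp (maxDischargeDepth := 9) [*]), k3,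
      id₂_vcomp' _ _ _ (by simp (maxDischargeDepth := 9) [*]), h3, C.src_vcomp _ _ h]
  · rw [C.vcomp_assoc _ _ _ (by simp (maxDischargeDepth := 9) [*]) (by simp (maxDischargeDepth := 9) [*]), ← C.vcomp_assoc α' _ _ (by simp (maxDischargeDepth := 9) [*]) (by simp (maxDischargeDepth := 9) [*]), h4,
      id₂_vcomp' _ _ _ (by simp (maxDischargeDepth := 9) [*]), k4, C.tgt_vcomp _ _ h]

theorem IsIso₂.hcomp_id₂ {α : C.Mor₂} (hα : IsIso₂ α) (f : C.Mor₁)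
    (h : C.cod (C.src α) = C.dom f) : IsIso₂ (α ⊡ₕ C.id₂ f) := by
  obtain ⟨α', h1, h2, h3, h4⟩ := hα
  refine ⟨α' ⊡ₕ C.id₂ f, by simp (maxDischargeDepth := 9) [*], by simp (maxDischargeDepth := 9) [*], ?_, ?_⟩
  · rw [← vcomp_hcomp_id₂ _ _ _ _ h1.symm h, h3, ← C.id₂_comp _ _ h, C.src_hcomp _ _ (by simp (maxDischargeDepth := 9) [*]),
      C.src_id₂]
  · rw [← vcomp_hcomp_id₂ _ _ _ _ h2 (by simp (maxDischargeDepth := 9) [*]), h4, ← C.id₂_comp _ _ (by simp (maxDischargeDepth := 9) [*]),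
      C.tgt_hcomp _ _ (by simp (maxDischargeDepth := 9) [*]), C.tgt_id₂]

theorem IsIso₂.id₂_hcomp {α : C.Mor₂} (hα : IsIso₂ α) (f : C.Mor₁)
    (h : C.cod f = C.dom (C.src α)) : IsIso₂ (C.id₂ f ⊡ₕ α) := by
  obtain ⟨α', h1, h2, h3, h4⟩ := hα
  refine ⟨C.id₂ f ⊡ₕ α', by simp (maxDischargeDepth := 9) [*], by simp (maxDischargeDepth := 9) [*], ?_, ?_⟩
  · rw [← id₂_hcomp_vcomp _ _ _ _ h1.symm h, h3, ← C.id₂_comp _ _ h, C.src_hcomp _ _ (by simp (maxDischargeDepth := 9) [*]),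
      C.src_id₂]
  · rw [← id₂_hcomp_vcomp _ _ _ _ h2 (by simp (maxDischargeDepth := 9) [*]), h4, ← C.id₂_comp _ _ (by simp (maxDischargeDepth := 9) [*]),
      C.tgt_hcomp _ _ (by simp (maxDischargeDepth := 9) [*]), C.tgt_id₂]

end IsIso₂

/-- A strict 2-functor from a strict 2-category to itself. -/
structure StrictEndo (C : StrictTwoCategory.{u, v, w}) where
  /-- action on objects -/
  obj : C.Obj → C.Obj
  /-- action on 1-morphisms -/
  map₁ : C.Mor₁ → C.Mor₁
  /-- action on 2-morphisms -/
  map₂ : C.Mor₂ → C.Mor₂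
  dom_map₁ : ∀ f, C.dom (map₁ f) = obj (C.dom f)
  cod_map₁ : ∀ f, C.cod (map₁ f) = obj (C.cod f)
  src_map₂ : ∀ α, C.src (map₂ α) = map₁ (C.src α)
  tgt_map₂ : ∀ α, C.tgt (map₂ α) = map₁ (C.tgt α)
  map₁_comp : ∀ f g, C.cod f = C.dom g → map₁ (f ∗₁ g) = map₁ f ∗₁ map₁ g
  map₂_id₂ : ∀ f, map₂ (C.id₂ f) = C.id₂ (map₁ f)
  map₂_vcomp : ∀ α β, C.tgt α = C.src β → map₂ (α ⊡ᵥ β) = map₂ α ⊡ᵥ map₂ β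
  map₂_hcomp : ∀ α β, C.cod (C.src α) = C.dom (C.src β) → map₂ (α ⊡ₕ β) = map₂ α ⊡ₕ map₂ β

namespace StrictEndo

attribute [simp] dom_map₁ cod_map₁ src_map₂ tgt_map₂ map₁_comp map₂_id₂

variable {C : StrictTwoCategory.{u, v, w}} (S : StrictEndo C)

/-- The action on 1-morphisms with given ends. -/
def hom {A B : C.Obj} (f : C.Hom A B) : C.Hom (S.obj A) (S.obj B) :=
  ⟨S.map₁ f.1, by simp, by simp⟩

@[simp] theorem hom_val {A B : C.Obj} (f : C.Hom A B) : (S.hom f).1 = S.map₁ f.1 := rfl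

/-- The action on 2-morphisms with given ends. -/
def hom₂ {A B : C.Obj} {f g : C.Hom A B} (α : f ⟶ g) : S.hom f ⟶ S.hom g :=
  ⟨S.map₂ α.1, by simp, by simp⟩

/-- A strict 2-functor is linear if it is on all categories `Hom`. -/
structure IsLinear (F : Type x) [Field F] [∀ A B : C.Obj, Preadditive (C.Hom A B)]
    [∀ A B : C.Obj, Linear F (C.Hom A B)] : Prop where
  map_add : ∀ {A B : C.Obj} {f g : C.Hom A B} (α β : f ⟶ g),
    S.hom₂ (α + β) = S.hom₂ α + S.hom₂ β
  map_smul : ∀ {A B : C.Obj} {f g : C.Hom A B} (c : F) (α : f ⟶ g),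
    S.hom₂ (c • α) = c • S.hom₂ α

end StrictEndo

/-- A strict 2-functor `S` with a right adjoint `S'` acting on sources: a pseudonatural unit and
counit satisfying the triangle laws up to isomorphism. -/
structure BendData (C : StrictTwoCategory.{u, v, w}) where
  /-- the 2-functor applied to targets -/
  S : StrictEndo C
  /-- the 2-functor applied to sources -/
  S' : StrictEndo C
  /-- the unit `Z → S S' Z` -/
  unit : C.Obj → C.Mor₁
  /-- the counit `S' S X → X` -/
  counit : C.Obj → C.Mor₁
  /-- pseudonaturality of the unit -/
  unitCell : C.Mor₁ → C.Mor₂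
  /-- pseudonaturality of the counit -/
  counitCell : C.Mor₁ → C.Mor₂
  /-- the first triangle -/
  triangle : C.Obj → C.Mor₂
  /-- the second triangle -/
  triangle' : C.Obj → C.Mor₂
  dom_unit : ∀ Z, C.dom (unit Z) = Z
  cod_unit : ∀ Z, C.cod (unit Z) = S.obj (S'.obj Z)
  dom_counit : ∀ X, C.dom (counit X) = S'.obj (S.obj X)
  cod_counit : ∀ X, C.cod (counit X) = X
  src_unitCell : ∀ f, C.src (unitCell f) = unit (C.dom f) ∗₁ S.map₁ (S'.map₁ f)
  tgt_unitCell : ∀ f, C.tgt (unitCell f) = f ∗₁ unit (C.cod f)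
  src_counitCell : ∀ f, C.src (counitCell f) = S'.map₁ (S.map₁ f) ∗₁ counit (C.cod f)
  tgt_counitCell : ∀ f, C.tgt (counitCell f) = counit (C.dom f) ∗₁ f
  src_triangle : ∀ X, C.src (triangle X) = unit (S.obj X) ∗₁ S.map₁ (counit X)
  tgt_triangle : ∀ X, C.tgt (triangle X) = C.id₁ (S.obj X)
  src_triangle' : ∀ Z, C.src (triangle' Z) = S'.map₁ (unit Z) ∗₁ counit (S'.obj Z)
  tgt_triangle' : ∀ Z, C.tgt (triangle' Z) = C.id₁ (S'.obj Z)
  isIso_unitCell : ∀ f, IsIso₂ (unitCell f)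
  isIso_counitCell : ∀ f, IsIso₂ (counitCell f)
  isIso_triangle : ∀ X, IsIso₂ (triangle X)
  isIso_triangle' : ∀ X, IsIso₂ (triangle' X)
  unitCell_natural : ∀ α : C.Mor₂,
    (C.id₂ (unit (C.dom (C.src α))) ⊡ₕ S.map₂ (S'.map₂ α)) ⊡ᵥ unitCell (C.tgt α) =
      unitCell (C.src α) ⊡ᵥ (α ⊡ₕ C.id₂ (unit (C.cod (C.src α))))
  counitCell_natural : ∀ α : C.Mor₂,
    (S'.map₂ (S.map₂ α) ⊡ₕ C.id₂ (counit (C.cod (C.src α)))) ⊡ᵥ counitCell (C.tgt α) =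
      counitCell (C.src α) ⊡ᵥ (C.id₂ (counit (C.dom (C.src α))) ⊡ₕ α)

namespace BendData

attribute [simp] dom_unit cod_unit dom_counit cod_counit src_unitCell tgt_unitCell src_counitCell tgt_counitCell src_triangle tgt_triangle
  src_triangle' tgt_triangle'

variable {C : StrictTwoCategory.{u, v, w}} (T : BendData C)

/-- The unit with its ends. -/
def unitHom (Z : C.Obj) : C.Hom Z (T.S.obj (T.S'.obj Z)) := ⟨T.unit Z, by simp, by simp⟩

/-- The counit with its ends. -/
def counitHom (X : C.Obj) : C.Hom (T.S'.obj (T.S.obj X)) X := ⟨T.counit X, by simp, by simp⟩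

@[simp] theorem unitHom_val (Z : C.Obj) : (T.unitHom Z).1 = T.unit Z := rfl

@[simp] theorem counitHom_val (X : C.Obj) : (T.counitHom X).1 = T.counit X := rfl

/-- Bending: `x : Z → S X` is sent to `S'(x) c : S' Z → X`. -/
@[simps obj map]
def bend (Z X : C.Obj) : C.Hom Z (T.S.obj X) ⥤ C.Hom (T.S'.obj Z) X where
  obj x := (T.S'.hom x).comp (T.counitHom X)
  map α := Hom.hcomp (T.S'.hom₂ α) (𝟙 _)
  map_id x := Hom₂.ext (by
    change T.S'.map₂ (C.id₂ x.1) ⊡ₕ C.id₂ _ = C.id₂ _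
    rw [T.S'.map₂_id₂, ← C.id₂_comp _ _ (by simp)]
    rfl)
  map_comp α β := Hom₂.ext (by
    change T.S'.map₂ (α.1 ⊡ᵥ β.1) ⊡ₕ C.id₂ _ = (T.S'.map₂ α.1 ⊡ₕ _) ⊡ᵥ (T.S'.map₂ β.1 ⊡ₕ _)
    rw [T.S'.map₂_vcomp _ _ (by simp)]
    exact (vcomp_hcomp_id₂ _ _ _ _ (by simp) (by simp)))

/-- Unbending: `y : S' Z → X` is sent to `n S(y) : Z → S X`. -/
@[simps obj map]
def unbend (Z X : C.Obj) : C.Hom (T.S'.obj Z) X ⥤ C.Hom Z (T.S.obj X) where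
  obj y := (T.unitHom Z).comp (T.S.hom y)
  map α := Hom.hcomp (𝟙 _) (T.S.hom₂ α)
  map_id x := Hom₂.ext (by
    change C.id₂ _ ⊡ₕ T.S.map₂ (C.id₂ x.1) = C.id₂ _
    rw [T.S.map₂_id₂, ← C.id₂_comp _ _ (by simp)]
    rfl)
  map_comp α β := Hom₂.ext (by
    change C.id₂ _ ⊡ₕ T.S.map₂ (α.1 ⊡ᵥ β.1) = (_ ⊡ₕ T.S.map₂ α.1) ⊡ᵥ (_ ⊡ₕ T.S.map₂ β.1)
    rw [T.S.map₂_vcomp _ _ (by simp)]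
    exact (id₂_hcomp_vcomp _ _ _ _ (by simp) (by simp)))

/-- The 2-morphism `unbend (bend x) ⇒ x`. -/
def unbendBend {Z X : C.Obj} (x : C.Hom Z (T.S.obj X)) :
    (T.unbend Z X).obj ((T.bend Z X).obj x) ⟶ x :=
  ⟨(T.unitCell x.1 ⊡ₕ C.id₂ (T.S.map₁ (T.counit X))) ⊡ᵥ (C.id₂ x.1 ⊡ₕ T.triangle X),
    by simp (maxDischargeDepth := 9), by simp (maxDischargeDepth := 9)⟩

/-- Pseudonaturality of the unit moves n past x, giving n S S'(x) S(c) ≅ x n S(c), and the triangle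
removes n S(c). -/
theorem isIso_unbendBend {Z X : C.Obj} (x : C.Hom Z (T.S.obj X)) : IsIso (T.unbendBend x) :=
  IsIso₂.isIso (((T.isIso_unitCell _).hcomp_id₂ _ (by simp (maxDischargeDepth := 9))).vcomp
    ((T.isIso_triangle _).id₂_hcomp _ (by simp (maxDischargeDepth := 9))) (by simp (maxDischargeDepth := 9)))

/-- The 2-morphism `bend (unbend y) ⇒ y`. -/
def bendUnbend {Z X : C.Obj} (y : C.Hom (T.S'.obj Z) X) :
    (T.bend Z X).obj ((T.unbend Z X).obj y) ⟶ y :=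
  ⟨(C.id₂ (T.S'.map₁ (T.unit Z)) ⊡ₕ T.counitCell y.1) ⊡ᵥ (T.triangle' Z ⊡ₕ C.id₂ y.1),
    by simp (maxDischargeDepth := 9), by simp (maxDischargeDepth := 9)⟩

theorem isIso_bendUnbend {Z X : C.Obj} (y : C.Hom (T.S'.obj Z) X) : IsIso (T.bendUnbend y) :=
  IsIso₂.isIso (((T.isIso_counitCell _).id₂_hcomp _ (by simp (maxDischargeDepth := 9))).vcomp
    ((T.isIso_triangle' _).hcomp_id₂ _ (by simp (maxDischargeDepth := 9))) (by simp (maxDischargeDepth := 9)))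

/-- The equivalence of categories given by bending. -/
noncomputable def bendEquiv (Z X : C.Obj) : C.Hom Z (T.S.obj X) ≌ C.Hom (T.S'.obj Z) X :=
  -- `Equivalence.mk` adjusts the unit so that the triangle law of an adjoint equivalence holds; no
  -- coherence between `triangle` and `triangle'` enters.
  CategoryTheory.Equivalence.mk (T.bend Z X) (T.unbend Z X)
    (NatIso.ofComponents (fun x => haveI := T.isIso_unbendBend x; asIso (T.unbendBend x)) (by
      intro x x' α
      apply Hom₂.ext
      change (C.id₂ (T.unit Z) ⊡ₕ T.S.map₂ (T.S'.map₂ α.1 ⊡ₕ C.id₂ (T.counit X))) ⊡ᵥ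
        ((T.unitCell x'.1 ⊡ₕ C.id₂ (T.S.map₁ (T.counit X))) ⊡ᵥ (C.id₂ x'.1 ⊡ₕ T.triangle X)) =
        ((T.unitCell x.1 ⊡ₕ C.id₂ (T.S.map₁ (T.counit X))) ⊡ᵥ (C.id₂ x.1 ⊡ₕ T.triangle X)) ⊡ᵥ α.1
      have h := T.unitCell_natural α.1
      simp only [Hom₂.src_eq, Hom₂.tgt_eq, Hom.dom_eq, Hom.cod_eq] at h
      have h2 := C.exchange α.1 (T.triangle X) x.1 x'.1 _ _ (by simp (maxDischargeDepth := 9)) (by simp (maxDischargeDepth := 9)) (by simp (maxDischargeDepth := 9)) rfl rfl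
      rw [T.src_triangle, T.tgt_triangle, hcomp_id₂_id₁ _ α.1 _ (by simp (maxDischargeDepth := 9))] at h2
      rw [T.S.map₂_hcomp _ _ (by simp (maxDischargeDepth := 9)), T.S.map₂_id₂, ← id₂_hcomp_id₂ _ _ _ _ (by simp (maxDischargeDepth := 9)) (by simp (maxDischargeDepth := 9)),
        ← C.vcomp_assoc _ _ _ (by simp (maxDischargeDepth := 9)) (by simp (maxDischargeDepth := 9)), ← vcomp_hcomp_id₂ _ _ _ _ (by simp (maxDischargeDepth := 9)) (by simp (maxDischargeDepth := 9)), h,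
        vcomp_hcomp_id₂ _ _ _ _ (by simp (maxDischargeDepth := 9)) (by simp (maxDischargeDepth := 9)), hcomp_id₂_id₂ _ α.1 _ _ (by simp (maxDischargeDepth := 9)) (by simp (maxDischargeDepth := 9)),
        C.vcomp_assoc _ _ _ (by simp (maxDischargeDepth := 9)) (by simp (maxDischargeDepth := 9)), h2, C.vcomp_assoc _ _ _ (by simp (maxDischargeDepth := 9)) (by simp (maxDischargeDepth := 9))])).symm
    (NatIso.ofComponents (fun y => haveI := T.isIso_bendUnbend y; asIso (T.bendUnbend y)) (by
      intro y y' α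
      apply Hom₂.ext
      change (T.S'.map₂ (C.id₂ (T.unit Z) ⊡ₕ T.S.map₂ α.1) ⊡ₕ C.id₂ (T.counit X)) ⊡ᵥ
        ((C.id₂ (T.S'.map₁ (T.unit Z)) ⊡ₕ T.counitCell y'.1) ⊡ᵥ
          (T.triangle' Z ⊡ₕ C.id₂ y'.1)) =
        ((C.id₂ (T.S'.map₁ (T.unit Z)) ⊡ₕ T.counitCell y.1) ⊡ᵥ
          (T.triangle' Z ⊡ₕ C.id₂ y.1)) ⊡ᵥ α.1
      have h := T.counitCell_natural α.1
      simp only [Hom₂.src_eq, Hom₂.tgt_eq, Hom.dom_eq, Hom.cod_eq] at h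
      have h2 := C.exchange (T.triangle' Z) α.1 _ _ y.1 y'.1 (by simp (maxDischargeDepth := 9)) rfl rfl (by simp (maxDischargeDepth := 9)) (by simp (maxDischargeDepth := 9))
      rw [T.src_triangle', T.tgt_triangle', id₂_id₁_hcomp _ α.1 _ (by simp (maxDischargeDepth := 9))] at h2
      rw [T.S'.map₂_hcomp _ _ (by simp (maxDischargeDepth := 9)), T.S'.map₂_id₂, id₂_hcomp_id₂ _ _ _ _ (by simp (maxDischargeDepth := 9)) (by simp (maxDischargeDepth := 9)),
        ← C.vcomp_assoc _ _ _ (by simp (maxDischargeDepth := 9)) (by simp (maxDischargeDepth := 9)), ← id₂_hcomp_vcomp _ _ _ _ (by simp (maxDischargeDepth := 9)) (by simp (maxDischargeDepth := 9)), h,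
        id₂_hcomp_vcomp _ _ _ _ (by simp (maxDischargeDepth := 9)) (by simp (maxDischargeDepth := 9)), id₂_id₂_hcomp _ α.1 _ _ (by simp (maxDischargeDepth := 9)) (by simp (maxDischargeDepth := 9)),
        C.vcomp_assoc _ _ _ (by simp (maxDischargeDepth := 9)) (by simp (maxDischargeDepth := 9)), ← h2, C.vcomp_assoc _ _ _ (by simp (maxDischargeDepth := 9)) (by simp (maxDischargeDepth := 9))]))

/-- Bending commutes with composition: `bend (x S(g)) ⇒ bend(x) g`. -/
def bendComp {Z X B : C.Obj} (x : C.Hom Z (T.S.obj X)) (g : C.Hom X B) :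
    (T.bend Z B).obj (x.comp (T.S.hom g)) ⟶ ((T.bend Z X).obj x).comp g :=
  ⟨C.id₂ (T.S'.map₁ x.1) ⊡ₕ T.counitCell g.1, by simp (maxDischargeDepth := 9), by simp (maxDischargeDepth := 9)⟩

theorem isIso_bendComp {Z X B : C.Obj} (x : C.Hom Z (T.S.obj X)) (g : C.Hom X B) :
    IsIso (T.bendComp x g) :=
  IsIso₂.isIso ((T.isIso_counitCell _).id₂_hcomp _ (by simp (maxDischargeDepth := 9)))

/-- Naturality of the counit cell at ζ. On 2-morphisms, bending thus turns γ ∘ S(ζ) into bend(γ) ∘ ζ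
and strips the functor S off the right-hand factor. -/
theorem bendComp_natural {Z X B : C.Obj} {x x' : C.Hom Z (T.S.obj X)} {g g' : C.Hom X B}
    (γ : x ⟶ x') (ζ : g ⟶ g') :
    (T.bend Z B).map (Hom.hcomp γ (T.S.hom₂ ζ)) ≫ T.bendComp x' g' =
      T.bendComp x g ≫ Hom.hcomp ((T.bend Z X).map γ) ζ := by
  apply Hom₂.ext
  change (T.S'.map₂ (γ.1 ⊡ₕ T.S.map₂ ζ.1) ⊡ₕ C.id₂ (T.counit B)) ⊡ᵥ
      (C.id₂ (T.S'.map₁ x'.1) ⊡ₕ T.counitCell g'.1) =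
    (C.id₂ (T.S'.map₁ x.1) ⊡ₕ T.counitCell g.1) ⊡ᵥ
      ((T.S'.map₂ γ.1 ⊡ₕ C.id₂ (T.counit X)) ⊡ₕ ζ.1)
  have h := T.counitCell_natural ζ.1
  simp only [Hom₂.src_eq, Hom₂.tgt_eq, Hom.dom_eq, Hom.cod_eq] at h
  rw [T.S'.map₂_hcomp _ _ (by simp (maxDischargeDepth := 9)), C.hcomp_assoc _ _ _ (by simp (maxDischargeDepth := 9)) (by simp (maxDischargeDepth := 9)),
    ← C.interchange _ _ _ _ (by simp (maxDischargeDepth := 9)) (by simp (maxDischargeDepth := 9)) (by simp (maxDischargeDepth := 9)), h, vcomp_id₂' _ _ _ (by simp (maxDischargeDepth := 9)),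
    C.hcomp_assoc _ _ _ (by simp (maxDischargeDepth := 9)) (by simp (maxDischargeDepth := 9)), ← C.interchange _ _ _ _ (by simp (maxDischargeDepth := 9)) (by simp (maxDischargeDepth := 9)) (by simp (maxDischargeDepth := 9)),
    id₂_vcomp' _ _ _ (by simp (maxDischargeDepth := 9))]

end BendData

/-! ### Duals of objects as bending data. -/

section Tensor

variable {C : StrictTwoCategory.{u, v, w}} [SemistrictMonoidal C]

/-- `D ⊗ -` as a strict 2-functor. -/
@[simps]
def tensorLeftEndo (D : C.Obj) : StrictEndo C where
  obj A := D ⊗ₒ A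
  map₁ f := D ◁₁ f
  map₂ α := D ◁₂ α
  dom_map₁ := dom_tl₁ D
  cod_map₁ := cod_tl₁ D
  src_map₂ := src_tl₂ D
  tgt_map₂ := tgt_tl₂ D
  map₁_comp := tl₁_comp D
  map₂_id₂ := tl₂_id₂ D
  map₂_vcomp := tl₂_vcomp D
  map₂_hcomp := tl₂_hcomp D

/-- `- ⊗ D` as a strict 2-functor. -/
@[simps]
def tensorRightEndo (D : C.Obj) : StrictEndo C where
  obj A := A ⊗ₒ D
  map₁ f := f ▷₁ D
  map₂ α := α ▷₂ D
  dom_map₁ f := dom_tr₁ f D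
  cod_map₁ f := cod_tr₁ f D
  src_map₂ α := src_tr₂ α D
  tgt_map₂ α := tgt_tr₂ α D
  map₁_comp f g := tr₁_comp f g D
  map₂_id₂ f := tr₂_id₂ f D
  map₂_vcomp α β := tr₂_vcomp α β D
  map₂_hcomp α β := tr₂_hcomp α β D

theorem isIso₂_tensorator (f g : C.Mor₁) : IsIso₂ (tensorator f g) :=
  ⟨tensoratorInv f g, by simp, by simp, by simpa using tensorator_inv f g,
    by simpa using inv_tensorator f g⟩

theorem isIso₂_tensoratorInv (f g : C.Mor₁) : IsIso₂ (tensoratorInv f g) :=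
  ⟨tensorator f g, by simp, by simp, by simpa using inv_tensorator f g,
    by simpa using tensorator_inv f g⟩

theorem IsIso₂.tl₂ {α : C.Mor₂} (h : IsIso₂ α) (A : C.Obj) : IsIso₂ (A ◁₂ α) := by
  obtain ⟨β, h1, h2, h3, h4⟩ := h
  refine ⟨A ◁₂ β, by simp [h1], by simp [h2], ?_, ?_⟩
  · rw [← tl₂_vcomp _ _ _ h1.symm, h3, tl₂_id₂, src_tl₂]
  · rw [← tl₂_vcomp _ _ _ h2, h4, tl₂_id₂, tgt_tl₂]

theorem IsIso₂.tr₂ {α : C.Mor₂} (h : IsIso₂ α) (A : C.Obj) : IsIso₂ (α ▷₂ A) := by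
  obtain ⟨β, h1, h2, h3, h4⟩ := h
  refine ⟨β ▷₂ A, by simp [h1], by simp [h2], ?_, ?_⟩
  · rw [← tr₂_vcomp _ _ _ h1.symm, h3, tr₂_id₂, src_tr₂]
  · rw [← tr₂_vcomp _ _ _ h2, h4, tr₂_id₂, tgt_tr₂]

/-- Naturality of the tensorator, conjugated by its inverses on both ends. -/
theorem tensoratorInv_natural (α β : C.Mor₂) :
    (C.dom (C.src α) ◁₂ β ⊡ₕ α ▷₂ C.cod (C.src β)) ⊡ᵥ tensoratorInv (C.tgt α) (C.tgt β) =
      tensoratorInv (C.src α) (C.src β) ⊡ᵥ (α ▷₂ C.dom (C.src β) ⊡ₕ C.cod (C.src α) ◁₂ β) := by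
  have h := congrArg (fun t => tensoratorInv (C.src α) (C.src β) ⊡ᵥ t ⊡ᵥ
    tensoratorInv (C.tgt α) (C.tgt β)) (tensorator_natural α β)
  beta_reduce at h
  rw [C.vcomp_assoc _ _ _ (by simp (maxDischargeDepth := 9)) (by simp (maxDischargeDepth := 9)), C.vcomp_assoc _ _ _ (by simp (maxDischargeDepth := 9)) (by simp (maxDischargeDepth := 9)),
    tensorator_inv, vcomp_id₂' _ _ _ (by simp (maxDischargeDepth := 9)), ← C.vcomp_assoc (tensoratorInv _ _) _ _ (by simp (maxDischargeDepth := 9))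
    (by simp (maxDischargeDepth := 9)), inv_tensorator, id₂_vcomp' _ _ _ (by simp (maxDischargeDepth := 9))] at h
  exact h.symm

variable [DualData C] [HasDuals C]

theorem isIso₂_triangulator (A : C.Obj) : IsIso₂ (triangulator A) :=
  ⟨dual₂ (triangulator A), by simp, by simp, (HasDuals.unitary_triangulator A).1,
    (HasDuals.unitary_triangulator A).2⟩

/-- Taking adjoints is a contravariant functor for vertical composition, so it carries the inverse
of α to an inverse of α†. -/
theorem isIso₂_adjoint₂ {A B : C.Obj} {f g : C.Hom A B} (α : f ⟶ g) (h : IsIso₂ α.1) :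
    IsIso₂ (adjoint₂ α.1) := by
  obtain ⟨β, h1, h2, h3, h4⟩ := h
  let β' : g ⟶ f := ⟨β, by simp [h1], by simp [h2]⟩
  refine ⟨adjoint₂ β, by simp [h2], by simp [h1], ?_, ?_⟩
  · have := adjoint₂_vcomp β' α
    change adjoint₂ (β ⊡ᵥ α.1) = _ ⊡ᵥ adjoint₂ β at this
    rw [← this, h4, Hom₂.tgt_eq, adjoint₂_id₂]
    simp
  · have := adjoint₂_vcomp α β'
    change adjoint₂ (α.1 ⊡ᵥ β) = adjoint₂ β ⊡ᵥ _ at this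
    rw [← this, h3, Hom₂.src_eq, adjoint₂_id₂]
    simp

/-- The other triangle of an object and its dual. -/
theorem exists_dual_triangulator (A : C.Obj) : ∃ t : C.Mor₂,
    C.src t = A ◁₁ unit₀ (dual₀ A) ∗₁ counit₀ (dual₀ A) ▷₁ A ∧ C.tgt t = C.id₁ A ∧ IsIso₂ t := by
  let f : C.Hom A A := ⟨unit₀ A ▷₁ A ∗₁ A ◁₁ counit₀ A, by simp (maxDischargeDepth := 9), by simp (maxDischargeDepth := 9)⟩
  let T : f ⟶ idHom A := ⟨triangulator A, by simp [f], by simp⟩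
  -- Taking adjoints reverses the 1-morphisms of the triangulator and replaces i_A, e_A by e_{A*},
  -- i_{A*}. So T_A† goes from 1_A to the other triangle, and its inverse β is the required cell.
  obtain ⟨β, h1, h2, h3, h4⟩ := isIso₂_adjoint₂ T (isIso₂_triangulator A)
  have hs : C.src (adjoint₂ T.1) = C.id₁ A := by
    rw [src_adjoint₂, Hom₂.tgt_eq, idHom_val, HasDuals.dual₁_id₁]
  have ht : C.tgt (adjoint₂ T.1) = A ◁₁ unit₀ (dual₀ A) ∗₁ counit₀ (dual₀ A) ▷₁ A := by
    rw [tgt_adjoint₂, Hom₂.src_eq, HasDuals.dual₁_comp _ _ (by simp (maxDischargeDepth := 9)), HasDuals.dual₁_tl₁,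
      HasDuals.dual₁_tr₁, HasDuals.unit₀_dual, HasDuals.counit₀_dual]
  exact ⟨β, h1.trans ht, h2.trans hs, _, h2.symm, h1.symm, by rw [h4, h1], by rw [h3, h2]⟩

/-- Bending of a right tensor factor. -/
noncomputable def tensorRightBend (D : C.Obj) : BendData C where
  S := tensorRightEndo D
  S' := tensorRightEndo (dual₀ D)
  unit Z := Z ◁₁ unit₀ (dual₀ D)
  counit X := X ◁₁ counit₀ (dual₀ D)
  unitCell f := tensoratorInv f (unit₀ (dual₀ D))
  counitCell f := tensorator f (counit₀ (dual₀ D))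
  -- The two triangles have opposite handedness: this one is (D ⊗ i_{D*})(e_{D*} ⊗ D), while the
  -- second is the source of the triangulator of D*.
  triangle X := X ◁₂ (exists_dual_triangulator D).choose
  triangle' Z := Z ◁₂ triangulator (dual₀ D)
  dom_unit Z := by simp
  cod_unit Z := by simp [tensor_assoc]
  dom_counit Z := by simp [tensor_assoc]
  cod_counit Z := by simp
  src_unitCell f := by simp [tr₁_tr₁]
  tgt_unitCell f := by simp [tr₁_unit]
  src_counitCell f := by simp [tr₁_tr₁]
  tgt_counitCell f := by simp [tr₁_unit]
  src_triangle X := by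
    rw [src_tl₂, (exists_dual_triangulator D).choose_spec.1]
    simp (maxDischargeDepth := 9)
  tgt_triangle X := by
    rw [tgt_tl₂, (exists_dual_triangulator D).choose_spec.2.1]
    simp
  src_triangle' Z := by
    simp (maxDischargeDepth := 9)
  tgt_triangle' Z := by simp
  isIso_unitCell f := isIso₂_tensoratorInv _ _
  isIso_counitCell f := isIso₂_tensorator _ _
  isIso_triangle X := (exists_dual_triangulator D).choose_spec.2.2.tl₂ X
  isIso_triangle' Z := (isIso₂_triangulator _).tl₂ Z
  unitCell_natural α := by
    have h := tensoratorInv_natural α (C.id₂ (unit₀ (dual₀ D)))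
    simpa [tl₂_id₂, tr₂_unit, tr₂_tr₂] using h
  counitCell_natural α := by
    have h := tensorator_natural α (C.id₂ (counit₀ (dual₀ D)))
    simpa [tl₂_id₂, tr₂_unit, tr₂_tr₂] using h

/-- Bending of a left tensor factor. -/
noncomputable def tensorLeftBend (D : C.Obj) : BendData C where
  S := tensorLeftEndo D
  S' := tensorLeftEndo (dual₀ D)
  unit Z := unit₀ D ▷₁ Z
  counit X := counit₀ D ▷₁ X
  unitCell f := tensorator (unit₀ D) f
  counitCell f := tensoratorInv (counit₀ D) f
  triangle X := triangulator D ▷₂ X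
  triangle' Z := (exists_dual_triangulator (dual₀ D)).choose ▷₂ Z
  dom_unit Z := by simp
  cod_unit Z := by simp [tensor_assoc]
  dom_counit Z := by simp [tensor_assoc]
  cod_counit Z := by simp
  src_unitCell f := by simp [tl₁_tl₁]
  tgt_unitCell f := by simp [tl₁_unit]
  src_counitCell f := by simp [tl₁_tl₁]
  tgt_counitCell f := by simp [tl₁_unit]
  src_triangle X := by
    simp (maxDischargeDepth := 9)
  tgt_triangle X := by simp
  src_triangle' Z := by
    rw [src_tr₂, (exists_dual_triangulator (dual₀ D)).choose_spec.1]
    simp (maxDischargeDepth := 9)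
  tgt_triangle' Z := by
    rw [tgt_tr₂, (exists_dual_triangulator (dual₀ D)).choose_spec.2.1]
    simp
  isIso_unitCell f := isIso₂_tensorator _ _
  isIso_counitCell f := isIso₂_tensoratorInv _ _
  isIso_triangle X := (isIso₂_triangulator _).tr₂ X
  isIso_triangle' Z := (exists_dual_triangulator (dual₀ D)).choose_spec.2.2.tr₂ Z
  unitCell_natural α := by
    have h := tensorator_natural (C.id₂ (unit₀ D)) α
    simpa [tr₂_id₂, tl₂_unit, tl₂_tl₂] using h
  counitCell_natural α := by
    have h := tensoratorInv_natural (C.id₂ (counit₀ D)) α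
    simpa [tr₂_id₂, tl₂_unit, tl₂_tl₂] using h

end Tensor

end StrictTwoCategory

/-! ## Simple families and generation in linear categories -/

section LinearCategories

variable (F : Type x) [Field F] {D : Type v} [Category.{w} D] [Preadditive D] [Linear F D]

/-- A family of pairwise orthogonal objects whose endomorphisms are scalars. -/
structure IsSimpleFamily {ι : Type y} (o : ι → D) : Prop where
  scalar : ∀ i (φ : o i ⟶ o i), ∃ s : F, φ = s • 𝟙 _
  orthogonal : ∀ i j, i ≠ j → ∀ φ : o i ⟶ o j, φ = 0

/-- The identity of `X` is a linear combination of morphisms factoring through objects in `P`. -/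
def GeneratedBy (P : D → Prop) (X : D) : Prop :=
  𝟙 X ∈ Submodule.span F {φ : X ⟶ X | ∃ S, P S ∧ ∃ (a : X ⟶ S) (b : S ⟶ X), a ≫ b = φ}

variable {F}

theorem GeneratedBy.of_mem {P : D → Prop} {X : D} (h : P X) : GeneratedBy F P X :=
  Submodule.subset_span ⟨X, h, 𝟙 X, 𝟙 X, Category.comp_id _⟩

/-- In each summand a · b through S, the expansion of 1_S is inserted between a and b. Generation
asks less than a direct sum decomposition: no projections are needed, it passes through linear
functors, and it is what the spanning arguments use. -/
theorem GeneratedBy.trans {P Q : D → Prop} {X : D} (h : GeneratedBy F P X)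
    (hPQ : ∀ S, P S → GeneratedBy F Q S) : GeneratedBy F Q X := by
  refine (Submodule.span_le.mpr ?_ : Submodule.span F _ ≤ _) h
  rintro _ ⟨S, hS, a, b, rfl⟩
  let m : (S ⟶ S) →ₗ[F] (X ⟶ X) := Linear.leftComp F X a ∘ₗ Linear.rightComp F S b
  have hm : a ≫ b = m (𝟙 S) := by simp [m]
  change a ≫ b ∈ Submodule.span F _
  rw [hm]
  have h1 := Submodule.mem_map_of_mem (f := m) (hPQ S hS)
  rw [Submodule.map_span] at h1
  refine Submodule.span_mono ?_ h1
  rintro _ ⟨_, ⟨R, hR, c, d, rfl⟩, rfl⟩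
  exact ⟨R, hR, a ≫ c, d ≫ b, by simp [m]⟩

theorem GeneratedBy.of_iso {P : D → Prop} {X Y : D} (h : GeneratedBy F P X) (e : X ≅ Y) :
    GeneratedBy F P Y := by
  refine GeneratedBy.trans (P := (· = X)) ?_ (by rintro _ rfl; exact h)
  exact Submodule.subset_span ⟨X, rfl, e.inv, e.hom, by simp⟩

theorem GeneratedBy.map {D' : Type*} [Category D'] [Preadditive D'] [Linear F D']
    {P : D → Prop} {X : D} (h : GeneratedBy F P X) (o : D → D')
    (m : ∀ Y Z, (Y ⟶ Z) →ₗ[F] (o Y ⟶ o Z)) (hid : m X X (𝟙 X) = 𝟙 (o X))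
    (hcomp : ∀ (Y Z : D) (f : Y ⟶ Z) (g : Z ⟶ Y), m Y Y (f ≫ g) = m Y Z f ≫ m Z Y g) :
    GeneratedBy F (fun Y => ∃ S, P S ∧ o S = Y) (o X) := by
  have h1 := Submodule.mem_map_of_mem (f := m X X) h
  rw [Submodule.map_span, hid] at h1
  refine Submodule.span_mono ?_ h1
  rintro _ ⟨_, ⟨R, hR, c, d, rfl⟩, rfl⟩
  exact ⟨o R, ⟨R, hR, rfl⟩, m _ _ c, m _ _ d, (hcomp _ _ _ _).symm⟩

/-- The identity of a direct sum is the sum of the idempotents π_k · ι_k. -/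
theorem GeneratedBy.of_bicone {n : ℕ} {X : Fin n → D} (b : Bicone X) (hb : b.IsBilimit) :
    GeneratedBy F (fun Y => ∃ k, X k = Y) b.pt := by
  have h := IsBilimit.total hb
  rw [GeneratedBy, ← h]
  exact Submodule.sum_mem _ fun k _ => Submodule.subset_span ⟨X k, ⟨k, rfl⟩, b.π k, b.ι k, rfl⟩

theorem IsTwoBasis.generatedBy {S : Finset D} (hS : IsTwoBasis F S) (X : D) :
    GeneratedBy F (· ∈ S) X := by
  obtain ⟨n, Y, b, hY, rfl, ⟨hb⟩⟩ := hS.generates X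
  exact (GeneratedBy.of_bicone b hb).trans (by rintro _ ⟨k, rfl⟩; exact .of_mem (hY k))

theorem IsTwoBasis.isSimpleFamily {S : Finset D} (hS : IsTwoBasis F S) :
    IsSimpleFamily F (fun X : S => X.1) where
  scalar X φ := by
    obtain ⟨s, hs⟩ := (hS.simple X.1 X.2).2 φ
    exact ⟨s, hs.symm⟩
  orthogonal X Y h φ := (hS.disjoint X.1 X.2 Y.1 Y.2 (fun e => h (Subtype.ext e))).elim _ _

end LinearCategories

namespace StrictTwoCategory

/-! ### Semi-simplicity transported along bending. -/

section Linear

variable (F : Type x) [Field F] {C : StrictTwoCategory.{u, v, w}}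
  [∀ A B : C.Obj, Preadditive (C.Hom A B)] [∀ A B : C.Obj, Linear F (C.Hom A B)]

/-- Reading a 2-morphism between different presentations of the same 1-morphisms. -/
def recast {A B B' : C.Obj} {f g : C.Hom A B} {f' g' : C.Hom A B'} (hf : f.1 = f'.1)
    (hg : g.1 = g'.1) : (f ⟶ g) ≃ₗ[F] (f' ⟶ g') where
  toFun α := ⟨α.1, α.2.trans hf, α.3.trans hg⟩
  invFun α := ⟨α.1, α.2.trans hf.symm, α.3.trans hg.symm⟩
  left_inv _ := rfl
  right_inv _ := rfl
  map_add' α β := by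
    obtain rfl : B = B' := by rw [← f.3, hf, f'.3]
    obtain rfl : f = f' := Hom.ext hf
    obtain rfl : g = g' := Hom.ext hg
    rfl
  map_smul' c α := by
    obtain rfl : B = B' := by rw [← f.3, hf, f'.3]
    obtain rfl : f = f' := Hom.ext hf
    obtain rfl : g = g' := Hom.ext hg
    rfl

@[simp] theorem recast_val {A B B' : C.Obj} {f g : C.Hom A B} {f' g' : C.Hom A B'}
    (hf : f.1 = f'.1) (hg : g.1 = g'.1) (α : f ⟶ g) : (recast F hf hg α).1 = α.1 := rfl

/-- A strict 2-functor as a linear map on 2-morphisms. -/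
def StrictEndo.homₗ {S : StrictEndo C} (hS : S.IsLinear F) {A B : C.Obj} (f g : C.Hom A B) :
    (f ⟶ g) →ₗ[F] (S.hom f ⟶ S.hom g) where
  toFun := S.hom₂
  map_add' := hS.map_add
  map_smul' := hS.map_smul

variable [SemistrictMonoidal C] [VectLinear F C]

theorem tensorLeftEndo_isLinear (D : C.Obj) : (tensorLeftEndo D).IsLinear F where
  map_add := VectLinear.tensorLeft_add F D
  map_smul := VectLinear.tensorLeft_smul D

theorem tensorRightEndo_isLinear (D : C.Obj) : (tensorRightEndo D).IsLinear F where
  map_add α β := VectLinear.tensorRight_add F α β D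
  map_smul c α := VectLinear.tensorRight_smul c α D

@[simp] theorem hcompₗ_apply {A B D : C.Obj} (f f' : C.Hom A B) (g g' : C.Hom B D) (α : f ⟶ f')
    (β : g ⟶ g') : hcompₗ F f f' g g' α β = Hom.hcomp α β := rfl

/-- A bending by linear 2-functors. -/
structure BendData.IsLinear (T : BendData C) : Prop where
  left : T.S.IsLinear F
  right : T.S'.IsLinear F

variable {F} {T : BendData C}

/-- Bending as a linear equivalence on 2-morphisms. -/
noncomputable def BendData.IsLinear.bendₗ (hT : T.IsLinear F) {Z X : C.Obj}
    (x x' : C.Hom Z (T.S.obj X)) :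
    (x ⟶ x') ≃ₗ[F] ((T.bend Z X).obj x ⟶ (T.bend Z X).obj x') :=
  LinearEquiv.ofBijective
    ((hcompₗ F _ _ _ _).flip (𝟙 (T.counitHom X)) ∘ₗ StrictEndo.homₗ F hT.right x x')
    ((T.bendEquiv Z X).fullyFaithfulFunctor.map_bijective x x')

theorem BendData.IsLinear.bendₗ_apply (hT : T.IsLinear F) {Z X : C.Obj}
    {x x' : C.Hom Z (T.S.obj X)} (α : x ⟶ x') : hT.bendₗ x x' α = (T.bend Z X).map α := rfl

theorem BendData.IsLinear.unbend_generatedBy (hT : T.IsLinear F) {Z X : C.Obj}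
    {P : C.Hom (T.S'.obj Z) X → Prop} {Y : C.Hom (T.S'.obj Z) X} (h : GeneratedBy F P Y) :
    GeneratedBy F (fun R => ∃ S, P S ∧ (T.unbend Z X).obj S = R) ((T.unbend Z X).obj Y) :=
  h.map (T.unbend Z X).obj
    (fun f g => hcompₗ F _ _ _ _ (𝟙 (T.unitHom Z)) ∘ₗ StrictEndo.homₗ F hT.left f g)
    ((T.unbend Z X).map_id _) (fun _ _ f g => (T.unbend Z X).map_comp f g)

/-- Bending the source, followed by the isomorphism `bend (x S(g)) ≅ bend(x) g`. -/
noncomputable def BendData.IsLinear.bendCompₗ (hT : T.IsLinear F) {Z X X' B : C.Obj}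
    (x : C.Hom Z (T.S.obj X)) (x' : C.Hom Z (T.S.obj X')) (g : C.Hom X B) (g' : C.Hom X' B) :
    (x.comp (T.S.hom g) ⟶ x'.comp (T.S.hom g')) ≃ₗ[F]
      (((T.bend Z X).obj x).comp g ⟶ ((T.bend Z X').obj x').comp g') :=
  haveI := T.isIso_bendComp x g
  haveI := T.isIso_bendComp x' g'
  hT.bendₗ (x.comp (T.S.hom g)) (x'.comp (T.S.hom g')) ≪≫ₗ
    Linear.homCongr F (asIso (T.bendComp x g)) (asIso (T.bendComp x' g'))

/-- The linear isomorphism between the two spaces of 2-morphisms respects horizontal products; this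
is what makes the square in `WhiskerFull.bend` commute. -/
theorem BendData.IsLinear.bendCompₗ_hcomp (hT : T.IsLinear F) {Z X B : C.Obj}
    {x x' : C.Hom Z (T.S.obj X)} {g g' : C.Hom X B} (γ : x ⟶ x') (ζ : g ⟶ g') :
    hT.bendCompₗ x x' g g' (Hom.hcomp γ (T.S.hom₂ ζ)) =
      Hom.hcomp (hT.bendₗ x x' γ) ζ := by
  have := T.isIso_bendComp x g
  have h := T.bendComp_natural γ ζ
  simp only [bendCompₗ, LinearEquiv.trans_apply, Linear.homCongr_apply, bendₗ_apply, asIso_hom,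
    asIso_inv]
  rw [Category.assoc, h, IsIso.inv_hom_id_assoc]

variable (F) in
/-- All 2-morphisms `x h ⇒ x' h'` are linear combinations of `γ ∘ ρ(v)`, in a unique way. -/
def WhiskerFull {Y B : C.Obj} {h h' : C.Hom Y B} {V : Type*} [AddCommGroup V] [Module F V]
    (ρ : V →ₗ[F] (h ⟶ h')) : Prop :=
  ∀ (Z : C.Obj) (x x' : C.Hom Z Y),
    Function.Bijective (TensorProduct.lift ((hcompₗ F x x' h h').compl₂ ρ))

/-- There are no 2-morphisms `x h ⇒ x' h'`. -/
def WhiskerDisjoint {Y Y' B : C.Obj} (h : C.Hom Y B) (h' : C.Hom Y' B) : Prop :=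
  ∀ (Z : C.Obj) (x : C.Hom Z Y) (x' : C.Hom Z Y'), Subsingleton (x.comp h ⟶ x'.comp h')

/-- Bending identifies the map γ ⊗ v ↦ γ ∘ S(ρ v) at x, x' with γ ⊗ v ↦ γ ∘ ρ(v) at the bent
1-morphisms. Since the source changes from Z to S' Z, the hypothesis has to quantify over all
sources. The conclusion has the same form, so several bendings can be chained. -/
theorem WhiskerFull.bend (hT : T.IsLinear F) {Y B : C.Obj} {h h' : C.Hom Y B} {V : Type*}
    [AddCommGroup V] [Module F V] {ρ : V →ₗ[F] (h ⟶ h')} (hρ : WhiskerFull F ρ) :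
    WhiskerFull F (StrictEndo.homₗ F hT.left h h' ∘ₗ ρ) := by
  intro Z x x'
  have key : (hT.bendCompₗ x x' h h').toLinearMap ∘ₗ
      TensorProduct.lift ((hcompₗ F x x' (T.S.hom h) (T.S.hom h')).compl₂
        (StrictEndo.homₗ F hT.left h h' ∘ₗ ρ)) =
      TensorProduct.lift ((hcompₗ F _ _ h h').compl₂ ρ) ∘ₗ
        (TensorProduct.congr (hT.bendₗ x x') (LinearEquiv.refl F V)).toLinearMap := by
    refine TensorProduct.ext' fun γ v => ?_
    exact hT.bendCompₗ_hcomp γ (ρ v)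
  have hb := (hρ _ ((T.bend Z Y).obj x) ((T.bend Z Y).obj x')).comp
    (TensorProduct.congr (hT.bendₗ x x') (LinearEquiv.refl F V)).bijective
  have hk := congrArg (fun m : _ →ₗ[F] _ => (m : _ → _)) key
  simp only [LinearMap.coe_comp, LinearEquiv.coe_coe] at hk
  rw [← hk] at hb
  exact (Function.Bijective.of_comp_iff' (hT.bendCompₗ x x' h h').bijective _).1 hb

theorem WhiskerDisjoint.bend (hT : T.IsLinear F) {Y Y' B : C.Obj} {h : C.Hom Y B}
    {h' : C.Hom Y' B} (hd : WhiskerDisjoint h h') :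
    WhiskerDisjoint (T.S.hom h) (T.S.hom h') := fun _ x x' =>
  have := hd _ ((T.bend _ _).obj x) ((T.bend _ _).obj x')
  (hT.bendCompₗ x x' h h').toEquiv.subsingleton

section ObjectBasis

variable {E : Finset C.Obj} (hE : IsObjectBasis F E)
include hE

theorem IsObjectBasis.whiskerFull {X B : C.Obj} (hX : X ∈ E) (g g' : C.Hom X B) :
    WhiskerFull F (LinearMap.id : (g ⟶ g') →ₗ[F] (g ⟶ g')) := fun _ x x' =>
  hE.full_faithful _ _ X hX x x' g g'

theorem IsObjectBasis.whiskerDisjoint {X X' B : C.Obj} (hX : X ∈ E) (hX' : X' ∈ E) (h : X ≠ X')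
    (g : C.Hom X B) (g' : C.Hom X' B) : WhiskerDisjoint g g' := fun _ x x' =>
  hE.disjoint _ _ X hX X' hX' h x g x' g'

end ObjectBasis

end Linear

section Recast

variable {F : Type x} [Field F] {C : StrictTwoCategory.{u, v, w}}
  [∀ A B : C.Obj, Preadditive (C.Hom A B)] [∀ A B : C.Obj, Linear F (C.Hom A B)]

theorem isSimpleFamily_recast {A B B' : C.Obj} {ι : Type y} {o : ι → C.Hom A B}
    (h : IsSimpleFamily F o) (o' : ι → C.Hom A B') (e : ∀ i, (o i).1 = (o' i).1) :
    IsSimpleFamily F o' where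
  scalar i φ := by
    obtain ⟨s, hs⟩ := h.scalar i ((recast F (e i) (e i)).symm φ)
    refine ⟨s, ?_⟩
    rw [LinearEquiv.symm_apply_eq, map_smul] at hs
    rw [hs]
    congr 1
    exact Hom₂.ext (by simp [e i])
  orthogonal i j hij φ := by
    have := h.orthogonal i j hij ((recast F (e i) (e j)).symm φ)
    rwa [LinearEquiv.symm_apply_eq, map_zero] at this

theorem generatedBy_recast {A B B' : C.Obj} {P : C.Hom A B → Prop} {X : C.Hom A B}
    (h : GeneratedBy F P X) (X' : C.Hom A B') (e : X.1 = X'.1) :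
    GeneratedBy F (fun R' => ∃ R, P R ∧ R.1 = R'.1) X' := by
  obtain rfl : B = B' := by rw [← X.3, e, X'.3]
  obtain rfl : X = X' := Hom.ext e
  exact h.trans fun R hR => .of_mem ⟨R, hR, rfl⟩

end Recast

/-! ### Simple and generating families of composites. -/

section Families

variable {F : Type x} [Field F] {C : StrictTwoCategory.{u, v, w}} [SemistrictMonoidal C]
  [∀ A B : C.Obj, Preadditive (C.Hom A B)] [∀ A B : C.Obj, Linear F (C.Hom A B)]
  [VectLinear F C]

theorem hcomp_smul_id {A B D : C.Obj} (f : C.Hom A B) (g : C.Hom B D) (a b : F) :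
    Hom.hcomp (a • 𝟙 f) (b • 𝟙 g) = (a * b) • 𝟙 (f.comp g) := by
  rw [VectLinear.smul_hcomp, VectLinear.hcomp_smul, smul_smul]
  congr 1
  exact Hom₂.ext (C.id₂_comp _ _ (by simp)).symm

theorem StrictEndo.hom₂_smul_id {S : StrictEndo C} (hS : S.IsLinear F) {A B : C.Obj}
    (f : C.Hom A B) (a : F) : S.hom₂ (a • 𝟙 f) = a • 𝟙 (S.hom f) := by
  rw [hS.map_smul]
  congr 1
  exact Hom₂.ext (S.map₂_id₂ _)

theorem WhiskerFull.eq_zero {Y B : C.Obj} {h h' : C.Hom Y B} {V : Type*} [AddCommGroup V]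
    [Module F V] {ρ : V →ₗ[F] (h ⟶ h')} (hρ : WhiskerFull F ρ) {Z : C.Obj} {x x' : C.Hom Z Y}
    (h0 : (∀ γ : x ⟶ x', γ = 0) ∨ ∀ v, ρ v = 0) (φ : x.comp h ⟶ x'.comp h') : φ = 0 := by
  obtain ⟨t, rfl⟩ := (hρ _ x x').2 φ
  induction t using TensorProduct.induction_on with
  | zero => simp
  | tmul γ v =>
    change hcompₗ F x x' h h' γ (ρ v) = 0
    rcases h0 with h0 | h0
    · rw [h0 γ, map_zero, LinearMap.zero_apply]
    · rw [h0 v, map_zero]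
  | add a b ha hb => rw [map_add, ha, hb, add_zero]

/-- Each ρ(v) is a scalar, which bilinearity moves onto γ. -/
theorem WhiskerFull.exists_hcomp {Y B : C.Obj} {h : C.Hom Y B} {V : Type*} [AddCommGroup V]
    [Module F V] {ρ : V →ₗ[F] (h ⟶ h)} (hρ : WhiskerFull F ρ) {Z : C.Obj} {x x' : C.Hom Z Y}
    (h1 : ∀ v, ∃ s : F, ρ v = s • 𝟙 h) (φ : x.comp h ⟶ x'.comp h) :
    ∃ γ : x ⟶ x', φ = Hom.hcomp γ (𝟙 h) := by
  obtain ⟨t, rfl⟩ := (hρ _ x x').2 φ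
  induction t using TensorProduct.induction_on with
  | zero => exact ⟨0, ((hcompₗ F x x' h h).map_zero₂ _).symm⟩
  | tmul γ v =>
    obtain ⟨s, hs⟩ := h1 v
    refine ⟨s • γ, ?_⟩
    change Hom.hcomp γ (ρ v) = _
    rw [hs, VectLinear.hcomp_smul, VectLinear.smul_hcomp]
  | add a b ha hb =>
    obtain ⟨γ, hγ⟩ := ha
    obtain ⟨γ', hγ'⟩ := hb
    exact ⟨γ + γ', by rw [map_add, hγ, hγ', VectLinear.add_hcomp F]⟩

variable {E : Finset C.Obj} (hE : IsObjectBasis F E)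
  {ℱ : ∀ A B : C.Obj, Finset (C.Hom A B)} (hℱ : ∀ A B : C.Obj, IsTwoBasis F (ℱ A B))

section One

variable {T : BendData C} (hT : T.IsLinear F)
include hE hℱ hT

/-- Schur's lemma for composites: 2-morphisms between members are spanned by γ ∘ S(ζ). Different
objects X allow none, and for equal X one factor runs between basis 1-morphisms, where it vanishes
or is scalar. -/
theorem isSimpleFamily_comp (Z B : C.Obj) :
    IsSimpleFamily F (fun l : Σ X : E, ℱ Z (T.S.obj X.1) × ℱ X.1 B =>
      l.2.1.1.comp (T.S.hom l.2.2.1)) where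
  scalar := by
    rintro ⟨X, f, g⟩ φ
    obtain ⟨γ, rfl⟩ := ((hE.whiskerFull X.2 g.1 g.1).bend hT).exists_hcomp (fun v => by
      obtain ⟨s, rfl⟩ := (hℱ _ _).isSimpleFamily.scalar g v
      exact ⟨s, StrictEndo.hom₂_smul_id hT.left _ s⟩) φ
    obtain ⟨s, rfl⟩ := (hℱ _ _).isSimpleFamily.scalar f γ
    refine ⟨s, ?_⟩
    have := hcomp_smul_id f.1 (T.S.hom g.1) s (1 : F)
    rwa [one_smul, mul_one] at this
  orthogonal := by
    rintro ⟨X, f, g⟩ ⟨X', f', g'⟩ hne φ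
    by_cases hX : X = X'
    · subst hX
      refine ((hE.whiskerFull X.2 g.1 g'.1).bend hT).eq_zero ?_ φ
      by_cases hf : f = f'
      · have hg : g ≠ g' := by
          rintro rfl
          exact hne (by rw [hf])
        refine Or.inr fun v => ?_
        rw [LinearMap.comp_apply, LinearMap.id_apply,
          (hℱ _ _).isSimpleFamily.orthogonal g g' hg v, map_zero]
      · exact Or.inl ((hℱ _ _).isSimpleFamily.orthogonal f f' hf)
    · have hd := (hE.whiskerDisjoint X.2 X'.2 (fun e => hX (Subtype.ext e)) g.1 g'.1).bend hT
        _ f.1 f'.1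
      exact hd.elim _ _

/-- Essential surjectivity of composition is used for the bent 1-morphism and then unbent. The two
factors found in this way are arbitrary, and are decomposed separately in their bases. -/
theorem generatedBy_comp {Z B : C.Obj} (Y : C.Hom Z (T.S.obj B)) :
    GeneratedBy F (fun R => ∃ l : Σ X : E, ℱ Z (T.S.obj X.1) × ℱ X.1 B,
      l.2.1.1.comp (T.S.hom l.2.2.1) = R) Y := by
  have h1 : GeneratedBy F (fun R => ∃ X : E, ∃ (f : C.Hom (T.S'.obj Z) X) (g : C.Hom X.1 B),
      f.comp g = R) ((T.bend Z B).obj Y) := by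
    obtain ⟨n, X, f, g, b, hX, hb, ⟨hb'⟩⟩ := hE.ess_surj _ _ ((T.bend Z B).obj Y)
    rw [← hb]
    refine (GeneratedBy.of_bicone b hb').trans ?_
    rintro _ ⟨k, rfl⟩
    exact .of_mem ⟨⟨X k, hX k⟩, f k, g k, rfl⟩
  have := T.isIso_unbendBend Y
  refine ((hT.unbend_generatedBy h1).of_iso (asIso (T.unbendBend Y))).trans ?_
  rintro _ ⟨_, ⟨X, f, g, rfl⟩, rfl⟩
  -- A strict equality, because S preserves composition strictly.
  have e : (T.unbend Z B).obj (f.comp g) = ((T.unbend Z X).obj f).comp (T.S.hom g) :=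
    Hom.ext (by simp (maxDischargeDepth := 9))
  rw [e]
  refine (((hℱ _ _).generatedBy ((T.unbend Z X).obj f)).map (fun y => y.comp (T.S.hom g))
    (fun y y' => (hcompₗ F y y' (T.S.hom g) (T.S.hom g)).flip (𝟙 _)) ?_ ?_).trans ?_
  · exact Hom₂.ext (C.id₂_comp _ _ (by simp)).symm
  · intro y y' α β
    exact Hom₂.ext (vcomp_hcomp_id₂ _ _ _ _ (by simp) (by simp))
  rintro _ ⟨y, hy, rfl⟩
  refine (((hℱ _ _).generatedBy g).map (fun g => y.comp (T.S.hom g))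
    (fun g g' => hcompₗ F y y (T.S.hom g) (T.S.hom g') (𝟙 _) ∘ₗ StrictEndo.homₗ F hT.left g g')
    ?_ ?_).trans ?_
  · refine Hom₂.ext ?_
    change C.id₂ _ ⊡ₕ T.S.map₂ (C.id₂ _) = C.id₂ _
    rw [T.S.map₂_id₂, ← C.id₂_comp _ _ (by simp)]
    rfl
  · intro g g' α β
    refine Hom₂.ext ?_
    change C.id₂ _ ⊡ₕ T.S.map₂ (α.1 ⊡ᵥ β.1) = _
    rw [T.S.map₂_vcomp _ _ (by simp)]
    exact id₂_hcomp_vcomp _ _ _ _ (by simp) (by simp)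
  rintro _ ⟨g', hg', rfl⟩
  exact .of_mem ⟨⟨X, ⟨y, hy⟩, ⟨g', hg'⟩⟩, rfl⟩

end One

section Two

variable {T T' : BendData C} (hT : T.IsLinear F) (hT' : T'.IsLinear F)
include hE hℱ hT hT'

/-- Two bendings in a row, as required for the 1-morphism e34 ⊗ f123 ⊗ e01 with a factor on each
side. -/
theorem exists_eq_hcomp_hom_hom {Z B : C.Obj} {X : E} (g : ℱ X.1 B)
    {x y : C.Hom Z (T'.S.obj (T.S.obj X.1))}
    (φ : x.comp (T'.S.hom (T.S.hom g.1)) ⟶ y.comp (T'.S.hom (T.S.hom g.1))) :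
    ∃ γ : x ⟶ y, φ = Hom.hcomp γ (𝟙 _) :=
  (((hE.whiskerFull X.2 g.1 g.1).bend hT).bend hT').exists_hcomp (fun v => by
    obtain ⟨s, rfl⟩ := (hℱ _ _).isSimpleFamily.scalar g v
    refine ⟨s, ?_⟩
    change T'.S.hom₂ (T.S.hom₂ _) = _
    rw [LinearMap.id_apply, StrictEndo.hom₂_smul_id hT.left _ s, StrictEndo.hom₂_smul_id hT'.left _ s]) φ

theorem eq_zero_hom_hom {Z B : C.Obj} {X X' : E} (g : ℱ X.1 B) (g' : ℱ X'.1 B)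
    (h : (⟨X, g⟩ : Σ X : E, ℱ X.1 B) ≠ ⟨X', g'⟩)
    {x : C.Hom Z (T'.S.obj (T.S.obj X.1))} {y : C.Hom Z (T'.S.obj (T.S.obj X'.1))}
    (φ : x.comp (T'.S.hom (T.S.hom g.1)) ⟶ y.comp (T'.S.hom (T.S.hom g'.1))) : φ = 0 := by
  by_cases hX : X = X'
  · subst hX
    refine (((hE.whiskerFull X.2 g.1 g'.1).bend hT).bend hT').eq_zero (Or.inr fun v => ?_) φ
    rw [LinearMap.comp_apply, LinearMap.comp_apply, LinearMap.id_apply,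
      (hℱ _ _).isSimpleFamily.orthogonal g g' (fun e => h (by rw [e])) v, map_zero, map_zero]
  · have hd := ((hE.whiskerDisjoint X.2 X'.2 (fun e => hX (Subtype.ext e)) g.1 g'.1).bend hT).bend
      hT' _ x y
    exact hd.elim _ _

end Two

end Families

/-! ### The 1-morphisms f_{i(jkl)} and f_{(ijk)l} as simple generating families. -/

section TensorFamilies

variable {F : Type x} [Field F] {C : StrictTwoCategory.{u, v, w}} [SemistrictMonoidal C]
  [DualData C] [HasDuals C]
  [∀ A B : C.Obj, Preadditive (C.Hom A B)] [∀ A B : C.Obj, Linear F (C.Hom A B)]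
  [VectLinear F C]

theorem tensorRightBend_isLinear (D : C.Obj) : (tensorRightBend D).IsLinear F :=
  ⟨tensorRightEndo_isLinear F D, tensorRightEndo_isLinear F _⟩

theorem tensorLeftBend_isLinear (D : C.Obj) : (tensorLeftBend D).IsLinear F :=
  ⟨tensorLeftEndo_isLinear F D, tensorLeftEndo_isLinear F _⟩

variable {E : Finset C.Obj} (hE : IsObjectBasis F E)
  {ℱ : ∀ A B : C.Obj, Finset (C.Hom A B)} (hℱ : ∀ A B : C.Obj, IsTwoBasis F (ℱ A B))
include hE hℱ

theorem isSimpleFamily_rightComp (a b c r : C.Obj) :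
    IsSimpleFamily F (fun l : Σ q : E, ℱ r (q.1 ⊗ₒ a) × ℱ q.1 (c ⊗ₒ b) =>
      rightComp l.2.1.1 l.2.2.1) :=
  isSimpleFamily_recast (isSimpleFamily_comp hE hℱ (tensorRightBend_isLinear a) r (c ⊗ₒ b)) _
    fun _ => rfl

theorem isSimpleFamily_leftComp (a b c r : C.Obj) :
    IsSimpleFamily F (fun l : Σ p : E, ℱ r (c ⊗ₒ p.1) × ℱ p.1 (b ⊗ₒ a) =>
      leftComp l.2.1.1 l.2.2.1) :=
  isSimpleFamily_recast (isSimpleFamily_comp hE hℱ (tensorLeftBend_isLinear c) r (b ⊗ₒ a)) _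
    fun _ => rfl

/-- The bending argument produces the bracketing (c ⊗ b) ⊗ a of the target, so 1-morphisms are
re-read through strict associativity before and after. -/
theorem generatedBy_rightComp {a b c r : C.Obj} (Y : C.Hom r (c ⊗ₒ b ⊗ₒ a)) :
    GeneratedBy F (fun R => ∃ l : Σ q : E, ℱ r (q.1 ⊗ₒ a) × ℱ q.1 (c ⊗ₒ b),
      rightComp l.2.1.1 l.2.2.1 = R) Y := by
  have h := generatedBy_comp hE hℱ (tensorRightBend_isLinear a) (Z := r) (B := c ⊗ₒ b)
    ⟨Y.1, Y.2, Y.3.trans (tensor_assoc _ _ _).symm⟩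
  refine (generatedBy_recast h Y rfl).trans ?_
  rintro R' ⟨_, ⟨l, rfl⟩, e⟩
  exact .of_mem ⟨l, Hom.ext e⟩

theorem generatedBy_leftComp {a b c r : C.Obj} (Y : C.Hom r (c ⊗ₒ b ⊗ₒ a)) :
    GeneratedBy F (fun R => ∃ l : Σ p : E, ℱ r (c ⊗ₒ p.1) × ℱ p.1 (b ⊗ₒ a),
      leftComp l.2.1.1 l.2.2.1 = R) Y :=
  generatedBy_comp hE hℱ (tensorLeftBend_isLinear c) Y

end TensorFamilies

end StrictTwoCategory

/-! ## Two orthogonal decompositions of a space with a pairing -/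

section Orthogonal

variable {F : Type*} [Field F] {I : Type*} [DecidableEq I] {V V' : I → Type*}
  [∀ i, AddCommGroup (V i)] [∀ i, Module F (V i)] [∀ i, AddCommGroup (V' i)]
  [∀ i, Module F (V' i)] {W W' : Type*} [AddCommGroup W] [Module F W] [AddCommGroup W']
  [Module F W'] (B : W →ₗ[F] W' →ₗ[F] F)

/-- Families of maps into paired spaces that are isometric up to non-zero factors and have orthogonal
images. -/
structure IsOrthogonalPair (L : ∀ i, V i →ₗ[F] W) (L' : ∀ i, V' i →ₗ[F] W')
    (q : ∀ i, V i →ₗ[F] V' i →ₗ[F] F) (c : I → F) : Prop where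
  ne_zero : ∀ i, c i ≠ 0
  separating : ∀ i, (q i).SeparatingLeft
  isometric : ∀ i t t', c i * B (L i t) (L' i t') = q i t t'
  orthogonal : ∀ i j, i ≠ j → ∀ t t', B (L i t) (L' j t') = 0
  surjective : Function.Surjective (DirectSum.toModule F I W L)

variable {B} {L : ∀ i, V i →ₗ[F] W} {L' : ∀ i, V' i →ₗ[F] W'} {q : ∀ i, V i →ₗ[F] V' i →ₗ[F] F}
  {c : I → F} (h : IsOrthogonalPair B L L' q c)
include h

/-- Pairing with the i-th opposite image reads off the i-th coordinate: orthogonality kills the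
other summands and the isometry evaluates the remaining one. -/
theorem IsOrthogonalPair.apply_toModule (t : DirectSum I V) (i : I) (t' : V' i) :
    c i * B (DirectSum.toModule F I W L t) (L' i t') = q i (t i) t' := by
  induction t using DirectSum.induction_on with
  | zero => simp
  | of j y =>
    change c i * B (DirectSum.toModule F I W L (DirectSum.lof F I V j y)) _ =
      q i (DirectSum.lof F I V j y i) t'
    rw [DirectSum.toModule_lof]
    by_cases hij : j = i
    · subst hij
      rw [h.isometric, DirectSum.lof_apply]
    · rw [h.orthogonal j i hij, DirectSum.lof_eq_of, DirectSum.of_eq_of_ne _ _ _ (Ne.symm hij)]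
      simp
  | add a b ha hb =>
    rw [map_add, map_add, LinearMap.add_apply, mul_add, ha, hb, DirectSum.add_apply, map_add,
      LinearMap.add_apply]

theorem IsOrthogonalPair.eq_zero_of_forall (t : DirectSum I V)
    (ht : ∀ i t', B (DirectSum.toModule F I W L t) (L' i t') = 0) : t = 0 := by
  refine DFinsupp.ext fun i => h.separating i _ fun t' => ?_
  change q i (t i) t' = 0
  rw [← h.apply_toModule, ht, mul_zero]

theorem IsOrthogonalPair.bijective : Function.Bijective (DirectSum.toModule F I W L) := by
  refine ⟨(injective_iff_map_eq_zero _).2 fun t ht => h.eq_zero_of_forall t fun i t' => ?_,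
    h.surjective⟩
  rw [ht, map_zero, LinearMap.zero_apply]

/-- The difference is the image of some t, and its pairings are the coordinates of t. Surjectivity
thus makes the opposite images separate the vectors of W, without assuming that B is non-degenerate.
-/
theorem IsOrthogonalPair.ext {w₁ w₂ : W} (hw : ∀ i t', B w₁ (L' i t') = B w₂ (L' i t')) :
    w₁ = w₂ := by
  obtain ⟨t, ht⟩ := h.surjective (w₁ - w₂)
  have : t = 0 := h.eq_zero_of_forall t fun i t' => by
    rw [ht, map_sub, LinearMap.sub_apply, hw, sub_self]
  rw [this, map_zero] at ht
  exact (sub_eq_zero.1 ht.symm)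

/-- A map into the direct sum whose components are given by the pairing is a lift. -/
theorem IsOrthogonalPair.toModule_sum [Fintype I] {U : Type*} [AddCommGroup U] [Module F U]
    (M : U →ₗ[F] W) (Z : ∀ i, U →ₗ[F] V i) (hZ : ∀ i u t', q i (Z i u) t' = B (M u) (L' i t'))
    (u : U) :
    DirectSum.toModule F I W L
      ((∑ i, c i • (DirectSum.lof F I V i ∘ₗ Z i) : U →ₗ[F] DirectSum I V) u) = M u := by
  refine h.ext fun i t' => ?_
  -- The i-th coordinate of the sum is c_i Z_i(u), so both sides of the coordinate formula carry the
  -- factor c_i, which cancels.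
  have h1 := h.apply_toModule
    ((∑ i, c i • (DirectSum.lof F I V i ∘ₗ Z i) : U →ₗ[F] DirectSum I V) u) i t'
  have h2 : ((∑ i, c i • (DirectSum.lof F I V i ∘ₗ Z i) : U →ₗ[F] DirectSum I V) u) i =
      c i • Z i u := by
    rw [LinearMap.sum_apply, DirectSum.sum_apply, Finset.sum_eq_single i]
    · rw [LinearMap.smul_apply, LinearMap.comp_apply, DirectSum.smul_apply, DirectSum.lof_apply]
    · intro j _ hj
      rw [LinearMap.smul_apply, LinearMap.comp_apply, DirectSum.smul_apply, DirectSum.lof_eq_of,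
        DirectSum.of_eq_of_ne _ _ _ (Ne.symm hj), smul_zero]
    · simp
  rw [h2, map_smul, LinearMap.smul_apply, hZ, smul_eq_mul] at h1
  exact mul_left_cancel₀ (h.ne_zero i) h1

end Orthogonal

section Crossing

variable {F : Type*} [Field F] {I J : Type*} [DecidableEq I] [DecidableEq J] [Fintype I]
  [Fintype J] {V V' : I → Type*} {U U' : J → Type*}
  [∀ i, AddCommGroup (V i)] [∀ i, Module F (V i)] [∀ i, AddCommGroup (V' i)]
  [∀ i, Module F (V' i)] [∀ i, AddCommGroup (U i)] [∀ i, Module F (U i)]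
  [∀ i, AddCommGroup (U' i)] [∀ i, Module F (U' i)]
  {W W' : Type*} [AddCommGroup W] [Module F W] [AddCommGroup W']
  [Module F W'] {B : W →ₗ[F] W' →ₗ[F] F}
  {L : ∀ i, V i →ₗ[F] W} {L' : ∀ i, V' i →ₗ[F] W'} {q : ∀ i, V i →ₗ[F] V' i →ₗ[F] F}
  {c : I → F} {R : ∀ i, U i →ₗ[F] W} {R' : ∀ i, U' i →ₗ[F] W'}
  {r : ∀ i, U i →ₗ[F] U' i →ₗ[F] F} {d : J → F}

/-- Two orthogonal decompositions are related by the maps with components `Z±`. -/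
theorem IsOrthogonalPair.crossing (h : IsOrthogonalPair B L L' q c)
    (k : IsOrthogonalPair B R R' r d) (Zp : ∀ i j, V i →ₗ[F] U j) (Zm : ∀ j i, U j →ₗ[F] V i)
    (hZp : ∀ i j t s, r j (Zp i j t) s = B (L i t) (R' j s))
    (hZm : ∀ j i s t, q i (Zm j i s) t = B (R j s) (L' i t)) :
    let Φ : DirectSum I V →ₗ[F] DirectSum J U := DirectSum.toModule F I _ fun i =>
      ∑ j, d j • (DirectSum.lof F J U j ∘ₗ Zp i j)
    let Ψ : DirectSum J U →ₗ[F] DirectSum I V := DirectSum.toModule F J _ fun j =>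
      ∑ i, c i • (DirectSum.lof F I V i ∘ₗ Zm j i)
    Function.Bijective (DirectSum.toModule F I W L) ∧
      Function.Bijective (DirectSum.toModule F J W R) ∧
      DirectSum.toModule F J W R ∘ₗ Φ = DirectSum.toModule F I W L ∧
      Ψ ∘ₗ Φ = LinearMap.id ∧ Φ ∘ₗ Ψ = LinearMap.id := by
  intro Φ Ψ
  have hΦ : DirectSum.toModule F J W R ∘ₗ Φ = DirectSum.toModule F I W L := by
    refine DirectSum.linearMap_ext F fun i => LinearMap.ext fun t => ?_
    simp only [LinearMap.comp_apply, Φ, DirectSum.toModule_lof]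
    exact k.toModule_sum (L i) (Zp i) (fun j u t' => hZp i j u t') t
  have hΨ : DirectSum.toModule F I W L ∘ₗ Ψ = DirectSum.toModule F J W R := by
    refine DirectSum.linearMap_ext F fun j => LinearMap.ext fun s => ?_
    simp only [LinearMap.comp_apply, Ψ, DirectSum.toModule_lof]
    exact h.toModule_sum (R j) (Zm j) (fun i u t' => hZm j i u t') s
  -- Both compositions Ψ Φ and Φ Ψ lift a map along itself, so injectivity of the two decompositions
  -- identifies them with the identity.
  refine ⟨h.bijective, k.bijective, hΦ, ?_, ?_⟩
  · refine LinearMap.ext fun t => h.bijective.1 ?_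
    change (DirectSum.toModule F I W L ∘ₗ Ψ) (Φ t) = DirectSum.toModule F I W L t
    rw [hΨ, ← hΦ]
    rfl
  · refine LinearMap.ext fun t => k.bijective.1 ?_
    change (DirectSum.toModule F J W R ∘ₗ Φ) (Ψ t) = DirectSum.toModule F J W R t
    rw [hΦ, ← hΨ]
    rfl

end Crossing

/-! ### The composites βδ: straightening, sliding and pairing. -/

namespace StrictTwoCategory

@[simp] theorem leftComp_val {C : StrictTwoCategory.{u, v, w}} [SemistrictMonoidal C]
    {a b c p r : C.Obj} (fikl : C.Hom r (c ⊗ₒ p)) (fijk : C.Hom p (b ⊗ₒ a)) :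
    (leftComp fikl fijk).1 = fikl.1 ∗₁ c ◁₁ fijk.1 := rfl

@[simp] theorem rightComp_val {C : StrictTwoCategory.{u, v, w}} [SemistrictMonoidal C]
    {a b c q r : C.Obj} (fijl : C.Hom r (q ⊗ₒ a)) (fjkl : C.Hom q (c ⊗ₒ b)) :
    (rightComp fijl fjkl).1 = fijl.1 ∗₁ fjkl.1 ▷₁ a := rfl

/-- Bending `f` in a 2-morphism and straightening it through the tensorator. -/
theorem straighten_tensorator {C : StrictTwoCategory.{u, v, w}} [SemistrictMonoidal C]
    [DualData C] [HasDuals C] {Z X X' Y Y' : C.Obj} (f : C.Hom X X') (g : C.Hom Y Y')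
    (A : C.Hom Z (X' ⊗ₒ Y)) (B : C.Hom Z (X ⊗ₒ Y')) (ω : C.Mor₂)
    (hs : C.src ω = A.1 ∗₁ X' ◁₁ g.1) (ht : C.tgt ω = B.1 ∗₁ f.1 ▷₁ Y') :
    ((C.id₂ A.1 ⊡ₕ unit₁ (dual₁ f.1 ▷₁ Y)) ⊡ₕ C.id₂ (X' ◁₁ g.1)) ⊡ᵥ
      (C.id₂ (A.1 ∗₁ dual₁ f.1 ▷₁ Y) ⊡ₕ tensorator f.1 g.1) ⊡ᵥ
      (((C.id₂ A.1 ⊡ₕ tensorator (dual₁ f.1) g.1) ⊡ᵥ (ω ⊡ₕ C.id₂ (dual₁ f.1 ▷₁ Y')) ⊡ᵥ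
        (C.id₂ B.1 ⊡ₕ dual₂ (unit₁ (f.1 ▷₁ Y')))) ⊡ₕ C.id₂ (f.1 ▷₁ Y')) = ω := by
  -- The pair f*, f created to the left of g passes through both tensorators and becomes a pair
  -- created to the right of g; the tensorators disappear.
  have h1 := congrArg (C.id₂ A.1 ⊡ₕ ·) (unit_dual_tensorator_slide f g)
  beta_reduce at h1
  rw [id₂_hcomp_vcomp _ _ _ _ (by simp (maxDischargeDepth := 9) [*]) (by simp (maxDischargeDepth := 9) [*]), id₂_hcomp_vcomp _ _ _ _ (by simp (maxDischargeDepth := 9) [*]) (by simp (maxDischargeDepth := 9) [*]),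
    ← id₂_hcomp_id₂ _ _ _ _ (by simp (maxDischargeDepth := 9) [*]) (by simp (maxDischargeDepth := 9) [*]), id₂_id₂_hcomp _ _ _ _ (by simp (maxDischargeDepth := 9) [*]) (by simp (maxDischargeDepth := 9) [*]),
    id₂_id₂_hcomp _ _ _ _ (by simp (maxDischargeDepth := 9) [*]) (by simp (maxDischargeDepth := 9) [*]), ← id₂_hcomp_id₂ _ _ _ _ (by simp (maxDischargeDepth := 9) [*]) (by simp (maxDischargeDepth := 9) [*])] at h1
  -- The pair is now created to the right of ω, so it may be created after ω; then it meets the dual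
  -- of the unit of f.
  have h2 := C.exchange ω (unit₁ (dual₁ f.1 ▷₁ Y')) _ _ _ _ (by simp (maxDischargeDepth := 9) [*]) hs ht rfl rfl
  simp only [src_unit₁, tgt_unit₁, dom_tr₁, dom_dual₁, Hom.cod_eq] at h2
  rw [hcomp_id₂_id₁ _ ω _ (by simp (maxDischargeDepth := 9) [*])] at h2
  -- The dual of the unit of f is the counit of f*, so this zigzag straightens f.
  have h3 := HasDuals.zigzag_dual (dual₁ f.1 ▷₁ Y')
  rw [← HasDuals.dual₁_tr₁, HasDuals.dual₁_dual₁, HasDuals.counit₁_dual] at h3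
  rw [vcomp_hcomp_id₂ _ _ _ _ (by simp (maxDischargeDepth := 9) [*]) (by simp (maxDischargeDepth := 9) [*]), vcomp_hcomp_id₂ _ _ _ _ (by simp (maxDischargeDepth := 9) [*]) (by simp (maxDischargeDepth := 9) [*]),
    hcomp_id₂_id₂ _ ω _ _ (by simp (maxDischargeDepth := 9) [*]) (by simp (maxDischargeDepth := 9) [*]),
    C.vcomp_assoc _ (_ ⊡ₕ C.id₂ (_ ∗₁ _)) _ (by simp (maxDischargeDepth := 9) [*]) (by simp (maxDischargeDepth := 9) [*]),
    ← C.vcomp_assoc _ _ (_ ⊡ᵥ _) (by simp (maxDischargeDepth := 9) [*]) (by simp (maxDischargeDepth := 9) [*]), h1,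
    ← C.vcomp_assoc _ _ _ (by simp (maxDischargeDepth := 9) [*]) (by simp (maxDischargeDepth := 9) [*]), ← HasDuals.dual₁_tr₁]
  rw [← HasDuals.dual₁_tr₁, HasDuals.dual₁_dual₁] at h2
  rw [← h2, C.vcomp_assoc _ _ _ (by simp (maxDischargeDepth := 9) [*]) (by simp (maxDischargeDepth := 9) [*]), ← id₂_id₂_hcomp _ _ _ _ (by simp (maxDischargeDepth := 9) [*]) (by simp (maxDischargeDepth := 9) [*]),
    id₂_hcomp_id₂ _ _ _ _ (by simp (maxDischargeDepth := 9) [*]) (by simp (maxDischargeDepth := 9) [*]), ← id₂_hcomp_vcomp _ _ _ _ (by simp (maxDischargeDepth := 9) [*]) (by simp (maxDischargeDepth := 9) [*]), h3,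
    ← C.id₂_comp _ _ (by simp (maxDischargeDepth := 9) [*])]
  exact vcomp_id₂' _ _ _ ht

theorem exists_straighten {C : StrictTwoCategory.{u, v, w}} [SemistrictMonoidal C]
    [DualData C] [HasDuals C] {Z X X' Y Y' : C.Obj} (f : C.Hom X X') (g : C.Hom Y Y')
    (A : C.Hom Z (X' ⊗ₒ Y)) (B : C.Hom Z (X ⊗ₒ Y')) (ω : C.Mor₂)
    (hs : C.src ω = A.1 ∗₁ X' ◁₁ g.1) (ht : C.tgt ω = B.1 ∗₁ f.1 ▷₁ Y') :
    ∃ (Q : C.Hom Z (X ⊗ₒ Y)) (β δ : C.Mor₂), C.src β = A.1 ∧ C.tgt β = Q.1 ∗₁ f.1 ▷₁ Y ∧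
      C.src δ = Q.1 ∗₁ X ◁₁ g.1 ∧ C.tgt δ = B.1 ∧
      (β ⊡ₕ C.id₂ (X' ◁₁ g.1)) ⊡ᵥ (C.id₂ Q.1 ⊡ₕ tensorator f.1 g.1) ⊡ᵥ
        (δ ⊡ₕ C.id₂ (f.1 ▷₁ Y')) = ω :=
  -- The middle 1-morphism is A followed by f*. The first factor β creates f* f, and the second
  -- slides f* past g, applies ω and annihilates f f*.
  ⟨⟨A.1 ∗₁ dual₁ f.1 ▷₁ Y, by simp (maxDischargeDepth := 9) [*], by simp (maxDischargeDepth := 9) [*]⟩, C.id₂ A.1 ⊡ₕ unit₁ (dual₁ f.1 ▷₁ Y),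
    (C.id₂ A.1 ⊡ₕ tensorator (dual₁ f.1) g.1) ⊡ᵥ (ω ⊡ₕ C.id₂ (dual₁ f.1 ▷₁ Y')) ⊡ᵥ
      (C.id₂ B.1 ⊡ₕ dual₂ (unit₁ (f.1 ▷₁ Y'))), by simp (maxDischargeDepth := 9) [*], by simp (maxDischargeDepth := 9) [*], by simp (maxDischargeDepth := 9) [*], by simp (maxDischargeDepth := 9) [*],
    straighten_tensorator f g A B ω hs ht⟩

section TwoSimplices

variable (F : Type x) [Field F] {C : StrictTwoCategory.{u, v, w}} [SemistrictMonoidal C]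
  [∀ A B : C.Obj, Preadditive (C.Hom A B)] [∀ A B : C.Obj, Linear F (C.Hom A B)]
  [VectLinear F C]
  {e01 e02 e03 e04 e12 e14 e23 e24 e34 : C.Obj}
  (f012 : C.Hom e02 (e12 ⊗ₒ e01)) (f014 : C.Hom e04 (e14 ⊗ₒ e01))
  (f023 : C.Hom e03 (e23 ⊗ₒ e02)) (f034 : C.Hom e04 (e34 ⊗ₒ e03))
  (f124 : C.Hom e14 (e24 ⊗ₒ e12)) (f234 : C.Hom e24 (e34 ⊗ₒ e23))

/-- Whiskering a 2-morphism `f_{024} ⇒ f'_{024}` by `f_{234} ⊗ e_{02}`. -/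
def rightWhisker (P P' : C.Hom e04 (e24 ⊗ₒ e02)) :
    (P ⟶ P') →ₗ[F] (rightComp P f234 ⟶ rightComp P' f234) :=
  whiskerRightₗ F (f234.1 ▷₁ e02) (f234.tensorRight e02).2 _ _ rfl rfl

theorem rightWhisker_id (P : C.Hom e04 (e24 ⊗ₒ e02)) :
    rightWhisker F f234 P P (𝟙 P) = 𝟙 (rightComp P f234) :=
  Hom₂.ext (C.id₂_comp P.1 (f234.1 ▷₁ e02) (by simp)).symm

theorem rightWhisker_comp {P P' P'' : C.Hom e04 (e24 ⊗ₒ e02)} (χ : P ⟶ P') (χ' : P' ⟶ P'') :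
    rightWhisker F f234 P P'' (χ ≫ χ') =
      rightWhisker F f234 P P' χ ≫ rightWhisker F f234 P' P'' χ' :=
  Hom₂.ext (vcomp_hcomp_id₂ _ _ _ _ (by simp) (by simp))

/-- A 2-morphism `f_{024} ⇒ f'_{024}` slides from one factor of `βδ` to the other. -/
theorem compTwo_slide {P Q : C.Hom e04 (e24 ⊗ₒ e02)}
    (β : TetSpace f023 P f034 f234) (χ : P ⟶ Q) (δ : TetSpace f012 f014 Q f124) :
    compTwo F f012 f014 f023 Q f034 f124 f234 ((β ≫ rightWhisker F f234 P Q χ) ⊗ₜ δ) =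
      compTwo F f012 f014 f023 P f034 f124 f234
        (β ⊗ₜ (Hom.hcomp χ (𝟙 (f012.tensorLeft e24)) ≫ δ)) := by
  have hβs : C.src β.1 = (leftComp f034 f023).1 := β.2
  have hβt : C.tgt β.1 = P.1 ∗₁ f234.1 ▷₁ e02 := β.3
  have hδs : C.src δ.1 = Q.1 ∗₁ e24 ◁₁ f012.1 := δ.2
  apply Hom₂.ext
  rw [compTwo_tmul, compTwo_tmul]
  change ((β.1 ⊡ᵥ (χ.1 ⊡ₕ C.id₂ (f234.1 ▷₁ e02))) ⊡ₕ _) ⊡ᵥ _ ⊡ᵥ _ =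
    _ ⊡ᵥ _ ⊡ᵥ (((χ.1 ⊡ₕ C.id₂ (e24 ◁₁ f012.1)) ⊡ᵥ δ.1) ⊡ₕ _)
  rw [tl₁_tl₁, vcomp_hcomp_id₂ _ _ _ _ (by simp (maxDischargeDepth := 9) [*]) (by simp (maxDischargeDepth := 9) [*]),
    vcomp_hcomp_id₂ _ _ _ _ (by simp (maxDischargeDepth := 9) [*]) (by simp (maxDischargeDepth := 9) [*]), hcomp_id₂_id₂ _ χ.1 _ _ (by simp (maxDischargeDepth := 9) [*]) (by simp (maxDischargeDepth := 9) [*]),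
    hcomp_id₂_id₂ _ χ.1 _ _ (by simp (maxDischargeDepth := 9) [*]) (by simp (maxDischargeDepth := 9) [*]), C.vcomp_assoc _ (χ.1 ⊡ₕ _) _ (by simp (maxDischargeDepth := 9) [*]) (by simp (maxDischargeDepth := 9) [*]),
    C.exchange χ.1 (tensorator f234.1 f012.1) P.1 Q.1 (f234.1 ▷₁ e02 ∗₁ (e34 ⊗ₒ e23) ◁₁ f012.1)
      (e24 ◁₁ f012.1 ∗₁ f234.1 ▷₁ (e12 ⊗ₒ e01)) (by simp (maxDischargeDepth := 9) [*]) (by simp (maxDischargeDepth := 9) [*]) (by simp (maxDischargeDepth := 9) [*])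
      (by simp (maxDischargeDepth := 9) [*]) (by simp (maxDischargeDepth := 9) [*])]
  rw [← C.vcomp_assoc (β.1 ⊡ₕ _) (C.id₂ _ ⊡ₕ _) (χ.1 ⊡ₕ _) (by simp (maxDischargeDepth := 9) [*]) (by simp (maxDischargeDepth := 9) [*])]
  rw [C.vcomp_assoc _ (χ.1 ⊡ₕ _) (δ.1 ⊡ₕ _) (by simp (maxDischargeDepth := 9) [*]) (by simp (maxDischargeDepth := 9) [*])]

variable [DualData C] [HasDuals C]

/-- Every 2-morphism in `2H(01234)` is a composite `βδ` for some 1-morphism `f_{024}`. -/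
theorem exists_compTwo_eq (ω : leftComp₄ f012 f023 f034 ⟶ rightComp₄ f014 f124 f234) :
    ∃ (Q : C.Hom e04 (e24 ⊗ₒ e02)) (β : TetSpace f023 Q f034 f234)
      (δ : TetSpace f012 f014 Q f124),
      compTwo F f012 f014 f023 Q f034 f124 f234 (β ⊗ₜ δ) = ω := by
  -- The strand `f234` is bent around `f012`. The first 1-morphism is f_{(023)4} with its target
  -- re-bracketed as (e34 ⊗ e23) ⊗ e02.
  obtain ⟨Q, β, δ, hβs, hβt, hδs, hδt, h⟩ := exists_straighten f234 f012
    ⟨(leftComp f034 f023).1, (leftComp f034 f023).2,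
      (leftComp f034 f023).3.trans (tensor_assoc _ _ _).symm⟩
    (rightComp f014 f124) ω.1 (by rw [ω.2, ← tl₁_tl₁]; rfl) ω.3
  refine ⟨Q, ⟨β, hβs, hβt⟩, ⟨δ, hδs, hδt⟩, Hom₂.ext ?_⟩
  rw [compTwo_tmul, tl₁_tl₁]
  exact h

end TwoSimplices

theorem hcomp_comp_id {C : StrictTwoCategory.{u, v, w}} {A B D : C.Obj} {f f' f'' : C.Hom A B}
    (g : C.Hom B D) (α : f ⟶ f') (β : f' ⟶ f'') :
    Hom.hcomp (α ≫ β) (𝟙 g) = Hom.hcomp α (𝟙 g) ≫ Hom.hcomp β (𝟙 g) :=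
  Hom₂.ext (vcomp_hcomp_id₂ _ _ _ _ (by simp) (by simp))

section TwoSimplices

variable (F : Type x) [Field F] {C : StrictTwoCategory.{u, v, w}} [SemistrictMonoidal C]
  [∀ A B : C.Obj, Preadditive (C.Hom A B)] [∀ A B : C.Obj, Linear F (C.Hom A B)]
  [VectLinear F C] [DualData C] [HasDuals C]
  {e01 e02 e03 e04 e12 e14 e23 e24 e34 : C.Obj}
  (f012 : C.Hom e02 (e12 ⊗ₒ e01)) (f014 : C.Hom e04 (e14 ⊗ₒ e01))
  (f023 : C.Hom e03 (e23 ⊗ₒ e02)) (f034 : C.Hom e04 (e34 ⊗ₒ e03))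
  (f124 : C.Hom e14 (e24 ⊗ₒ e12)) (f234 : C.Hom e24 (e34 ⊗ₒ e23))

/-- The 2-morphism `f_{024} ⇒ f'_{024}` obtained from `δδ'` by a partial trace over
`e_{24} ⊗ f_{012}`. -/
def innerTrace {P P' : C.Hom e04 (e24 ⊗ₒ e02)} (δ : TetSpace f012 f014 P f124)
    (δ' : TetSpaceOp f012 f014 P' f124) : P ⟶ P' :=
  partialTrace (f := P) (f' := P') (f012.tensorLeft e24) (δ ≫ δ')

theorem closeUp_innerTrace {P : C.Hom e04 (e24 ⊗ₒ e02)} (δ : TetSpace f012 f014 P f124)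
    (δ' : TetSpaceOp f012 f014 P f124) :
    closeUpₗ F P (innerTrace f012 f014 f124 δ δ') = closeUpₗ F (leftComp P f012) (δ ≫ δ') :=
  (closeUp_comp F P (f012.tensorLeft e24) (δ ≫ δ')).symm

/-- Cyclicity brings β' · β together. The loop of e34 ⊗ e23 ⊗ f012 then surrounds only the crossings
and δδ'; pulled across `f234`, it becomes the loop of e24 ⊗ f012 around δδ'. -/
theorem closeUp_compTwo {P P' : C.Hom e04 (e24 ⊗ₒ e02)}
    (β : TetSpace f023 P f034 f234) (δ : TetSpace f012 f014 P f124)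
    (β' : TetSpaceOp f023 P' f034 f234) (δ' : TetSpaceOp f012 f014 P' f124) :
    closeUpₗ F (leftComp₄ f012 f023 f034)
        (compTwo F f012 f014 f023 P f034 f124 f234 (β ⊗ₜ δ) ≫
          compTwoOp F f012 f014 f023 P' f034 f124 f234 (β' ⊗ₜ δ')) =
      closeUpₗ F (rightComp P f234)
        (rightWhisker F f234 P P' (innerTrace f012 f014 f124 δ δ') ≫ β' ≫ β) := by
  let K := (f012.tensorLeft e23).tensorLeft e34
  let b : leftComp₄ f012 f023 f034 ⟶ mid₁ f012 P f234 := Hom.hcomp β (𝟙 K)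
  let b' : mid₁ f012 P' f234 ⟶ leftComp₄ f012 f023 f034 := Hom.hcomp β' (𝟙 K)
  let d : mid₂ f012 P f234 ⟶ rightComp₄ f014 f124 f234 :=
    whiskerRightₗ F (f234.1 ▷₁ (e12 ⊗ₒ e01)) (f234.tensorRight (e12 ⊗ₒ e01)).2 _ _ rfl rfl δ
  let d' : rightComp₄ f014 f124 f234 ⟶ mid₂ f012 P' f234 :=
    whiskerRightₗ F (f234.1 ▷₁ (e12 ⊗ₒ e01)) (f234.tensorRight (e12 ⊗ₒ e01)).2 _ _ rfl rfl δ'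
  -- ξ is the part of the composite inside the loop: δδ' conjugated by the two crossings, as in
  -- `partialTrace_tensorator`.
  let ξ : mid₁ f012 P f234 ⟶ mid₁ f012 P' f234 :=
    crossing f012 P f234 ≫ (d ≫ d') ≫ crossingInv f012 P' f234
  have h1 : compTwo F f012 f014 f023 P f034 f124 f234 (β ⊗ₜ δ) ≫
      compTwoOp F f012 f014 f023 P' f034 f124 f234 (β' ⊗ₜ δ') = b ≫ (ξ ≫ b') := by
    change ((b ≫ _) ≫ d) ≫ ((d' ≫ _) ≫ b') = _
    simp only [ξ, Category.assoc]
  have hs : C.src (δ ≫ δ').1 = P.1 ∗₁ e24 ◁₁ f012.1 := (δ ≫ δ').2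
  have ht : C.tgt (δ ≫ δ').1 = P'.1 ∗₁ e24 ◁₁ f012.1 := (δ ≫ δ').3
  have h2 : partialTrace (f := rightComp P f234) (f' := rightComp P' f234) K ξ =
      rightWhisker F f234 P P' (innerTrace f012 f014 f124 δ δ') := by
    refine Hom₂.ext (Eq.trans ?_ (partialTrace_tensorator f234 f012 P P' (δ ≫ δ').1 hs ht))
    have h3 : ξ.1 = (C.id₂ P.1 ⊡ₕ tensorator f234.1 f012.1) ⊡ᵥ
        (((δ ≫ δ').1 ⊡ₕ C.id₂ (f234.1 ▷₁ (e12 ⊗ₒ e01))) ⊡ᵥ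
          (C.id₂ P'.1 ⊡ₕ tensoratorInv f234.1 f012.1)) := by
      have hδ : C.cod (C.src δ.1) = e24 ⊗ₒ e12 ⊗ₒ e01 := by rw [δ.2, Hom.cod_eq]
      rw [Hom.vcomp_val δ δ', vcomp_hcomp_id₂ _ _ _ _ (by simp) (by rw [hδ]; simp)]
      rfl
    rw [← h3, ← tl₁_tl₁]
    rfl
  rw [h1, closeUp_comm, Category.assoc, ← h2]
  have h4 : b' ≫ b = Hom.hcomp (β' ≫ β) (𝟙 K) := (hcomp_comp_id K β' β).symm
  rw [h4]
  exact (closeUp_comp F (rightComp P f234) K _).trans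
    (congrArg _ (partialTrace_comp_hcomp (f := rightComp P f234) K ξ (β' ≫ β)))

variable [ScalarUnit F C]

theorem qdim₁_smul {A B : C.Obj} (f : C.Hom A B) (s : F) :
    scalarEquiv F (closeUpₗ F f (s • 𝟙 f)) = s * qdim₁ F f := by
  rw [map_smul, map_smul, qdim₁_eq, smul_eq_mul]

/-- Schur's lemma: the inner trace of δδ' is a scalar s. Closing it further gives ⟨δ,δ'⟩ = s · dim
P, while the whole diagram gives s · ⟨β,β'⟩. -/
theorem qdim₁_mul_pairing_compTwo {P : C.Hom e04 (e24 ⊗ₒ e02)}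
    (hP : ∀ φ : P ⟶ P, ∃ s : F, φ = s • 𝟙 P)
    (β : TetSpace f023 P f034 f234) (δ : TetSpace f012 f014 P f124)
    (β' : TetSpaceOp f023 P f034 f234) (δ' : TetSpaceOp f012 f014 P f124) :
    qdim₁ F P * pairing F (leftComp₄ f012 f023 f034) (rightComp₄ f014 f124 f234)
        (compTwo F f012 f014 f023 P f034 f124 f234 (β ⊗ₜ δ))
        (compTwoOp F f012 f014 f023 P f034 f124 f234 (β' ⊗ₜ δ')) =
      pairing F _ _ β β' * pairing F _ _ δ δ' := by
  obtain ⟨s, hs⟩ := hP (innerTrace f012 f014 f124 δ δ')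
  have h1 : pairing F _ _ δ δ' = s * qdim₁ F P := by
    rw [pairing_apply, ← closeUp_innerTrace, hs, qdim₁_smul]
  rw [pairing_apply, closeUp_compTwo, hs, map_smul, rightWhisker_id, h1, Linear.smul_comp,
    map_smul, map_smul, Category.id_comp, closeUp_comm, pairing_apply F _ _ β β', smul_eq_mul]
  ring

theorem pairing_compTwo_eq_zero {P P' : C.Hom e04 (e24 ⊗ₒ e02)} (hP : ∀ φ : P ⟶ P', φ = 0)
    (β : TetSpace f023 P f034 f234) (δ : TetSpace f012 f014 P f124)
    (β' : TetSpaceOp f023 P' f034 f234) (δ' : TetSpaceOp f012 f014 P' f124) :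
    pairing F (leftComp₄ f012 f023 f034) (rightComp₄ f014 f124 f234)
        (compTwo F f012 f014 f023 P f034 f124 f234 (β ⊗ₜ δ))
        (compTwoOp F f012 f014 f023 P' f034 f124 f234 (β' ⊗ₜ δ')) = 0 := by
  rw [pairing_apply, closeUp_compTwo, hP (innerTrace f012 f014 f124 δ δ'), map_zero,
    Limits.zero_comp, map_zero, map_zero]

end TwoSimplices

/-! ### The composites βδ span. -/

section TwoSimplexSum

variable (F : Type x) [Field F] {C : StrictTwoCategory.{u, v, w}} [SemistrictMonoidal C]
  [∀ A B : C.Obj, Preadditive (C.Hom A B)] [∀ A B : C.Obj, Linear F (C.Hom A B)]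
  [VectLinear F C] [DualData C] [HasDuals C]
  {ℱ : ∀ A B : C.Obj, Finset (C.Hom A B)} (hℱ : ∀ A B : C.Obj, IsTwoBasis F (ℱ A B))
  {e01 e02 e03 e04 e12 e14 e23 e24 e34 : C.Obj}
  (f012 : C.Hom e02 (e12 ⊗ₒ e01)) (f014 : C.Hom e04 (e14 ⊗ₒ e01))
  (f023 : C.Hom e03 (e23 ⊗ₒ e02)) (f034 : C.Hom e04 (e34 ⊗ₒ e03))
  (f124 : C.Hom e14 (e24 ⊗ₒ e12)) (f234 : C.Hom e24 (e34 ⊗ₒ e23))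

theorem compTwo_mem_range (f024 : ℱ e04 (e24 ⊗ₒ e02))
    (t : TetSpace f023 f024.1 f034 f234 ⊗[F] TetSpace f012 f014 f024.1 f124) :
    compTwo F f012 f014 f023 f024.1 f034 f124 f234 t ∈
      LinearMap.range (leftMap F ℱ f012 f014 f023 f034 f124 f234) := by
  classical
  refine ⟨DirectSum.lof F (ℱ e04 (e24 ⊗ₒ e02)) (fun f024 =>
    TetSpace f023 f024.1 f034 f234 ⊗[F] TetSpace f012 f014 f024.1 f124) f024 t, ?_⟩
  rw [leftMap, DirectSum.toModule_lof]

include hℱ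

theorem leftMap_surjective :
    Function.Surjective (leftMap F ℱ f012 f014 f023 f034 f124 f234) := by
  classical
  intro ω
  obtain ⟨Q, β, δ, rfl⟩ := exists_compTwo_eq F f012 f014 f023 f034 f124 f234 ω
  -- Inserting χ : Q ⇒ Q into βδ is linear in χ, so the expansion of 1_Q through basis 1-morphisms P
  -- may be used term by term. For χ = a · b the factor b slides into δ, leaving a composite over P.
  let m : (Q ⟶ Q) →ₗ[F] (leftComp₄ f012 f023 f034 ⟶ rightComp₄ f014 f124 f234) :=
    compTwo F f012 f014 f023 Q f034 f124 f234 ∘ₗ (TensorProduct.mk F _ _).flip δ ∘ₗ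
      Linear.leftComp F _ β ∘ₗ rightWhisker F f234 Q Q
  have hm : compTwo F f012 f014 f023 Q f034 f124 f234 (β ⊗ₜ δ) = m (𝟙 Q) := by
    change _ = compTwo F f012 f014 f023 Q f034 f124 f234
      ((β ≫ rightWhisker F f234 Q Q (𝟙 Q)) ⊗ₜ δ)
    rw [rightWhisker_id, Category.comp_id]
  rw [← LinearMap.mem_range, hm]
  refine (Submodule.span_le.2 ?_ : _ ≤ Submodule.comap m (LinearMap.range _))
    ((hℱ _ _).generatedBy Q)
  rintro _ ⟨P, hP, a, b, rfl⟩
  change compTwo F f012 f014 f023 Q f034 f124 f234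
      ((β ≫ rightWhisker F f234 Q Q (a ≫ b)) ⊗ₜ δ) ∈
    LinearMap.range (leftMap F ℱ f012 f014 f023 f034 f124 f234)
  rw [rightWhisker_comp, ← Category.assoc, compTwo_slide]
  exact compTwo_mem_range F f012 f014 f023 f034 f124 f234 ⟨P, hP⟩ _

end TwoSimplexSum

/-! ### Quantum dimensions of simple objects and of composites. -/

section Dimensions

variable {F : Type x} [Field F] {C : StrictTwoCategory.{u, v, w}} [SemistrictMonoidal C]
  [∀ A B : C.Obj, Preadditive (C.Hom A B)] [∀ A B : C.Obj, Linear F (C.Hom A B)]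
  [VectLinear F C]

/-- Full faithfulness for 1_X 1_X = 1_X identifies V ⊗ V with V for V = 2End(1_X), so n² = n for n =
dim V. Also n ≠ 0, since 1_{1_X} = 0 would make every 1-morphism X → X a zero object. -/
theorem IsObjectBasis.simple_idHom {E : Finset C.Obj} (hE : IsObjectBasis F E) {X : C.Obj}
    (hX : X ∈ E) : Function.Bijective (fun c : F => c • 𝟙 (idHom X)) := by
  have hid : (idHom X).comp (idHom X) = idHom X := Hom.ext (comp_id₁' _ _ _ (by simp))
  have h0 : 𝟙 (idHom X) ≠ 0 := by
    intro h
    obtain ⟨f, hf⟩ := hE.nonzero X hX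
    have hf' : (idHom X).comp f = f := Hom.ext (id₁_comp' _ _ _ (by simp))
    refine hf (hf' ▸ (IsZero.iff_id_eq_zero _).2 ?_)
    have : 𝟙 ((idHom X).comp f) = hcompₗ F _ _ _ _ (𝟙 (idHom X)) (𝟙 f) :=
      Hom₂.ext (C.id₂_comp _ _ (by simp))
    rw [this, h, map_zero, LinearMap.zero_apply]
  have h1 := (LinearEquiv.ofBijective _
    (hE.full_faithful X X X hX (idHom X) (idHom X) (idHom X) (idHom X))).finrank_eq
  rw [hid, Module.finrank_tensorProduct] at h1
  have h2 : Module.finrank F (idHom X ⟶ idHom X) = 1 := by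
    have hpos : 0 < Module.finrank F (idHom X ⟶ idHom X) :=
      Module.finrank_pos_iff_exists_ne_zero.2 ⟨_, h0⟩
    exact Nat.eq_of_mul_eq_mul_left hpos (by rw [h1, mul_one])
  exact ⟨smul_left_injective F h0, (finrank_eq_one_iff_of_nonzero' _ h0).1 h2⟩

variable [DualData C] [HasDuals C]

/-- Every endomorphism of f is a scalar, so with dim f = 0 the identity would pair to zero with all
of them, against non-degeneracy. -/
theorem qdim₁_ne_zero [ScalarUnit F C] [Nondegenerate F C] {A B : C.Obj} (f : C.Hom A B)
    (hf : Function.Bijective (fun c : F => c • 𝟙 f)) : qdim₁ F f ≠ 0 := by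
  intro h
  have h0 : 𝟙 f = 0 := by
    refine (Nondegenerate.nondegenerate (F := F) f f).1 _ fun β => ?_
    obtain ⟨s, rfl⟩ := hf.2 β
    rw [map_smul]
    change s • qdim₁ F f = 0
    rw [h, smul_zero]
  exact one_ne_zero (hf.1 (by simp only [h0, smul_zero]) : (1 : F) = 0)

theorem exists_trace_id {X B : C.Obj} (hX : Function.Bijective (fun c : F => c • 𝟙 (idHom X)))
    (g : C.Hom X B) : ∃ s : F, trace g (𝟙 g) = s • 𝟙 (idHom X) := by
  obtain ⟨s, hs⟩ := hX.2 (trace g (𝟙 g))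
  exact ⟨s, hs.symm⟩

/-- Identifies the value s of a loop of g as dim(g)/dim(X) when dim(X) is non-zero. The later lemmas
carry s instead of the quotient and need no division. -/
theorem qdim₁_of_trace [ScalarUnit F C] {X B : C.Obj} {g : C.Hom X B} {s : F}
    (hg : trace g (𝟙 g) = s • 𝟙 (idHom X)) : qdim₁ F g = s * qdim₀ F X := by
  rw [qdim₁_eq, ← closeUp_trace, hg, qdim₁_smul, qdim₀]

/-- Units and duals commute with tensoring, so tensoring a loop does not change its scalar value. -/
theorem trace_tensorRight {X B : C.Obj} {g : C.Hom X B} {s : F}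
    (hg : trace g (𝟙 g) = s • 𝟙 (idHom X)) (A : C.Obj) :
    trace (g.tensorRight A) (𝟙 (g.tensorRight A)) = s • 𝟙 (idHom (X ⊗ₒ A)) := by
  have h1 : trace (g.tensorRight A) (𝟙 (g.tensorRight A)) =
      tensorRightₗ F A (f := idHom X) (f' := idHom X) (idHom (X ⊗ₒ A)) (idHom (X ⊗ₒ A)) (tr₁_id₁ X A).symm (tr₁_id₁ X A).symm
        (trace g (𝟙 g)) := by
    refine Hom₂.ext ?_
    change unit₁ (g.1 ▷₁ A) ⊡ᵥ (C.id₂ (g.1 ▷₁ A) ⊡ₕ C.id₂ (dual₁ (g.1 ▷₁ A))) ⊡ᵥ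
      dual₂ (unit₁ (g.1 ▷₁ A)) =
      (unit₁ g.1 ⊡ᵥ (C.id₂ g.1 ⊡ₕ C.id₂ (dual₁ g.1)) ⊡ᵥ dual₂ (unit₁ g.1)) ▷₂ A
    rw [tr₂_vcomp _ _ _ (by simp (maxDischargeDepth := 9)), tr₂_vcomp _ _ _ (by simp (maxDischargeDepth := 9)), tr₂_hcomp _ _ _ (by simp (maxDischargeDepth := 9)),
      HasDuals.unit₁_tr₁, HasDuals.dual₂_tr₂, HasDuals.dual₁_tr₁, tr₂_id₂, tr₂_id₂]
  rw [h1, hg, map_smul]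
  congr 1
  exact Hom₂.ext ((tr₂_id₂ _ _).trans (congrArg _ (tr₁_id₁ X A)))

theorem trace_tensorLeft {X B : C.Obj} {g : C.Hom X B} {s : F}
    (hg : trace g (𝟙 g) = s • 𝟙 (idHom X)) (A : C.Obj) :
    trace (g.tensorLeft A) (𝟙 (g.tensorLeft A)) = s • 𝟙 (idHom (A ⊗ₒ X)) := by
  have h1 : trace (g.tensorLeft A) (𝟙 (g.tensorLeft A)) =
      tensorLeftₗ F A (f := idHom X) (f' := idHom X) (idHom (A ⊗ₒ X)) (idHom (A ⊗ₒ X)) (tl₁_id₁ A X).symm (tl₁_id₁ A X).symm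
        (trace g (𝟙 g)) := by
    refine Hom₂.ext ?_
    change unit₁ (A ◁₁ g.1) ⊡ᵥ (C.id₂ (A ◁₁ g.1) ⊡ₕ C.id₂ (dual₁ (A ◁₁ g.1))) ⊡ᵥ
      dual₂ (unit₁ (A ◁₁ g.1)) =
      A ◁₂ (unit₁ g.1 ⊡ᵥ (C.id₂ g.1 ⊡ₕ C.id₂ (dual₁ g.1)) ⊡ᵥ dual₂ (unit₁ g.1))
    rw [tl₂_vcomp _ _ _ (by simp (maxDischargeDepth := 9)), tl₂_vcomp _ _ _ (by simp (maxDischargeDepth := 9)), tl₂_hcomp _ _ _ (by simp (maxDischargeDepth := 9)),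
      HasDuals.unit₁_tl₁, HasDuals.dual₂_tl₂, HasDuals.dual₁_tl₁, tl₂_id₂, tl₂_id₂]
  rw [h1, hg, map_smul]
  congr 1
  exact Hom₂.ext ((tl₂_id₂ _ _).trans (congrArg _ (tl₁_id₁ A X)))

theorem partialTrace_id {Z X B : C.Obj} {g : C.Hom X B} {s : F}
    (hg : trace g (𝟙 g) = s • 𝟙 (idHom X)) (f : C.Hom Z X) :
    partialTrace g (𝟙 (f.comp g)) = s • 𝟙 f := by
  have h1 : partialTrace g (𝟙 (f.comp g)) =
      recast F (f := f.comp (idHom X)) (g := f.comp (idHom X)) (f' := f) (g' := f)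
        (comp_id₁' _ _ _ (by simp)) (comp_id₁' _ _ _ (by simp)) (Hom.hcomp (𝟙 f) (trace g (𝟙 g))) := by
    refine Hom₂.ext ?_
    change (C.id₂ f.1 ⊡ₕ unit₁ g.1) ⊡ᵥ (C.id₂ (f.1 ∗₁ g.1) ⊡ₕ C.id₂ (dual₁ g.1)) ⊡ᵥ
      (C.id₂ f.1 ⊡ₕ dual₂ (unit₁ g.1)) =
      C.id₂ f.1 ⊡ₕ (unit₁ g.1 ⊡ᵥ (C.id₂ g.1 ⊡ₕ C.id₂ (dual₁ g.1)) ⊡ᵥ dual₂ (unit₁ g.1))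
    rw [id₂_hcomp_vcomp _ _ _ _ (by simp (maxDischargeDepth := 9)) (by simp (maxDischargeDepth := 9)), id₂_hcomp_vcomp _ _ _ _ (by simp (maxDischargeDepth := 9)) (by simp (maxDischargeDepth := 9)),
      ← C.id₂_comp _ _ (by simp (maxDischargeDepth := 9)), ← C.id₂_comp _ _ (by simp (maxDischargeDepth := 9)), ← C.id₂_comp _ _ (by simp (maxDischargeDepth := 9)),
      C.comp_assoc _ _ _ (by simp (maxDischargeDepth := 9)) (by simp (maxDischargeDepth := 9))]
  rw [h1, hg, VectLinear.hcomp_smul, map_smul]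
  congr 1
  refine Hom₂.ext ?_
  change C.id₂ f.1 ⊡ₕ C.id₂ (C.id₁ X) = C.id₂ f.1
  exact hcomp_id₂_id₁ _ _ _ (by simp)

/-- When ζ acts on f alone, the loop of g is empty and can be removed at the cost of its value s. -/
theorem closeUp_hcomp_id {Z X B : C.Obj} {g : C.Hom X B} {s : F}
    (hg : trace g (𝟙 g) = s • 𝟙 (idHom X)) {f : C.Hom Z X} (ζ : f ⟶ f) :
    closeUpₗ F (f.comp g) (Hom.hcomp ζ (𝟙 g)) = s • closeUpₗ F f ζ := by
  have h := partialTrace_comp_hcomp g (𝟙 (f.comp g)) ζ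
  rw [Category.id_comp, partialTrace_id hg, Linear.smul_comp, Category.id_comp] at h
  rw [closeUp_comp, h, map_smul]

variable [ScalarUnit F C]

theorem qdim₁_leftComp {a b c p r : C.Obj} (f : C.Hom r (c ⊗ₒ p)) {g : C.Hom p (b ⊗ₒ a)} {s : F}
    (hg : trace g (𝟙 g) = s • 𝟙 (idHom p)) :
    qdim₁ F (leftComp f g) = s * qdim₁ F f := by
  have h := closeUp_hcomp_id (trace_tensorLeft hg c) (𝟙 f)
  rw [qdim₁_eq, qdim₁_eq, ← smul_eq_mul, ← map_smul, ← h]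
  exact congrArg _ (closeUp_congr F rfl (C.id₂_comp _ _ (by simp)))

theorem qdim₁_rightComp {a b c q r : C.Obj} (f : C.Hom r (q ⊗ₒ a)) {g : C.Hom q (c ⊗ₒ b)} {s : F}
    (hg : trace g (𝟙 g) = s • 𝟙 (idHom q)) :
    qdim₁ F (rightComp f g) = s * qdim₁ F f := by
  have h := closeUp_hcomp_id (trace_tensorRight hg a) (𝟙 f)
  rw [qdim₁_eq, qdim₁_eq, ← smul_eq_mul, ← map_smul, ← h]
  exact congrArg _ (closeUp_congr F rfl (C.id₂_comp _ _ (by simp)))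

end Dimensions

/-! ### The composites εγα and their pairings. -/

section ThreeSimplices

variable (F : Type x) [Field F] {C : StrictTwoCategory.{u, v, w}} [SemistrictMonoidal C]
  [∀ A B : C.Obj, Preadditive (C.Hom A B)] [∀ A B : C.Obj, Linear F (C.Hom A B)]
  [VectLinear F C]
  {e01 e02 e03 e04 e12 e13 e13' e14 e23 e24 e34 : C.Obj}
  (f012 : C.Hom e02 (e12 ⊗ₒ e01)) (f013 : C.Hom e03 (e13 ⊗ₒ e01))
  (f013' : C.Hom e03 (e13' ⊗ₒ e01))
  (f014 : C.Hom e04 (e14 ⊗ₒ e01)) (f023 : C.Hom e03 (e23 ⊗ₒ e02))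
  (f034 : C.Hom e04 (e34 ⊗ₒ e03))
  (f123 : C.Hom e13 (e23 ⊗ₒ e12)) (f123' : C.Hom e13' (e23 ⊗ₒ e12))
  (f124 : C.Hom e14 (e24 ⊗ₒ e12))
  (f134 : C.Hom e14 (e34 ⊗ₒ e13)) (f134' : C.Hom e14 (e34 ⊗ₒ e13'))
  (f234 : C.Hom e24 (e34 ⊗ₒ e23))

/-- `φ ↦ f_{014} ∘ (φ ⊗ e_{01})` between the 1-morphisms `f_{1(234)}`. -/
def whiskerAlpha : (leftComp f134 f123 ⟶ leftComp f134' f123') →ₗ[F]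
    (mid₄ f014 f123 f134 ⟶ mid₄ f014 f123' f134') :=
  have h (g : C.Hom e14 (e34 ⊗ₒ e23 ⊗ₒ e12)) :
      C.cod (g.1 ▷₁ e01) = e34 ⊗ₒ e23 ⊗ₒ e12 ⊗ₒ e01 := by
    rw [cod_tr₁, g.3, tensor_assoc, tensor_assoc]
  whiskerLeftₗ F f014.1 f014.3
      (f := ⟨_, ((leftComp f134 f123).tensorRight e01).2, h _⟩)
      (f' := ⟨_, ((leftComp f134' f123').tensorRight e01).2, h _⟩) _ _
      (mid₄_val f014 f123 f134) (mid₄_val f014 f123' f134') ∘ₗ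
    tensorRightₗ F e01 _ _ rfl rfl

/-- `φ ↦ f_{034} ∘ (e_{34} ⊗ φ)` between the 1-morphisms `f_{0(123)}`. -/
def whiskerEpsilon : (rightComp f013 f123 ⟶ rightComp f013' f123') →ₗ[F]
    (mid₃ f013 f034 f123 ⟶ mid₃ f013' f034 f123') :=
  whiskerLeftₗ F f034.1 f034.3 (f := (rightComp f013 f123).tensorLeft e34)
      (f' := (rightComp f013' f123').tensorLeft e34) _ _
      (mid₃_val f013 f034 f123) (mid₃_val f013' f034 f123') ∘ₗ
    tensorLeftₗ F e34 _ _ rfl rfl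

theorem whiskerAlpha_id : whiskerAlpha F f014 f123 f123 f134 f134 (𝟙 _) = 𝟙 _ := by
  refine Hom₂.ext ?_
  change C.id₂ f014.1 ⊡ₕ C.id₂ (leftComp f134 f123).1 ▷₂ e01 = C.id₂ _
  rw [tr₂_id₂, ← C.id₂_comp _ _ (by simp (maxDischargeDepth := 9)), mid₄_val]
  rfl

theorem whiskerEpsilon_id : whiskerEpsilon F f013 f013 f034 f123 f123 (𝟙 _) = 𝟙 _ := by
  refine Hom₂.ext ?_
  change C.id₂ f034.1 ⊡ₕ e34 ◁₂ C.id₂ (rightComp f013 f123).1 = C.id₂ _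
  rw [tl₂_id₂, ← C.id₂_comp _ _ (by simp (maxDischargeDepth := 9)), mid₃_val]
  rfl

theorem stepAlpha_comp_stepAlphaOp (α : TetSpace f123 f124 f134 f234)
    (α' : TetSpaceOp f123' f124 f134' f234) :
    stepAlpha F f014 f123 f124 f134 f234 α ≫ stepAlphaOp F f014 f123' f124 f134' f234 α' =
      whiskerAlpha F f014 f123 f123' f134 f134' (α ≫ α') := by
  refine Hom₂.ext ?_
  change (C.id₂ f014.1 ⊡ₕ α.1 ▷₂ e01) ⊡ᵥ (C.id₂ f014.1 ⊡ₕ α'.1 ▷₂ e01) =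
    C.id₂ f014.1 ⊡ₕ (α.1 ⊡ᵥ α'.1) ▷₂ e01
  rw [tr₂_vcomp _ _ _ (by simp), id₂_hcomp_vcomp _ _ _ _ (by simp) (by simp (maxDischargeDepth := 9))]

theorem stepEpsilonOp_comp_stepEpsilon (ε : TetSpace f012 f013 f023 f123)
    (ε' : TetSpaceOp f012 f013' f023 f123') :
    stepEpsilonOp F f012 f013' f023 f034 f123' ε' ≫ stepEpsilon F f012 f013 f023 f034 f123 ε =
      whiskerEpsilon F f013' f013 f034 f123' f123 (ε' ≫ ε) := by
  refine Hom₂.ext ?_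
  change (C.id₂ f034.1 ⊡ₕ e34 ◁₂ ε'.1) ⊡ᵥ (C.id₂ f034.1 ⊡ₕ e34 ◁₂ ε.1) =
    C.id₂ f034.1 ⊡ₕ e34 ◁₂ (ε'.1 ⊡ᵥ ε.1)
  rw [tl₂_vcomp _ _ _ (by simp), id₂_hcomp_vcomp _ _ _ _ (by simp) (by simp (maxDischargeDepth := 9))]

/-- `γ ↦ γ ∘ (e_{34} ⊗ f_{123} ⊗ e_{01})`. -/
def whiskerGamma : TetSpace f013 f014 f034 f134 →ₗ[F]
    (mid₃ f013 f034 f123 ⟶ mid₄ f014 f123 f134) :=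
  whiskerRightₗ F (e34 ◁₁ (f123.1 ▷₁ e01)) ((f123.tensorRight e01).tensorLeft e34).2 _ _ rfl rfl

/-- `γ ↦ γ ∘ (e_{34} ⊗ f_{123} ⊗ e_{01})` in the opposite direction. -/
def whiskerGammaOp : TetSpaceOp f013 f014 f034 f134 →ₗ[F]
    (mid₄ f014 f123 f134 ⟶ mid₃ f013 f034 f123) :=
  whiskerRightₗ F (e34 ◁₁ (f123.1 ▷₁ e01)) ((f123.tensorRight e01).tensorLeft e34).2 _ _ rfl rfl

theorem compThree_tmul_eq (α : TetSpace f123 f124 f134 f234) (γ : TetSpace f013 f014 f034 f134)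
    (ε : TetSpace f012 f013 f023 f123) :
    compThree F f012 f013 f014 f023 f034 f123 f124 f134 f234 (α ⊗ₜ γ ⊗ₜ ε) =
      stepEpsilon F f012 f013 f023 f034 f123 ε ≫ whiskerGamma F f013 f014 f034 f123 f134 γ ≫
        stepAlpha F f014 f123 f124 f134 f234 α := rfl

theorem compThreeOp_tmul_eq (α : TetSpaceOp f123 f124 f134 f234)
    (γ : TetSpaceOp f013 f014 f034 f134) (ε : TetSpaceOp f012 f013 f023 f123) :
    compThreeOp F f012 f013 f014 f023 f034 f123 f124 f134 f234 (α ⊗ₜ γ ⊗ₜ ε) =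
      (stepAlphaOp F f014 f123 f124 f134 f234 α ≫ whiskerGammaOp F f013 f014 f034 f123 f134 γ) ≫
        stepEpsilonOp F f012 f013 f023 f034 f123 ε := rfl

variable [DualData C] [HasDuals C]

/-- Cyclicity moves ε behind ε', so that both products ε'ε and αα' become 2-morphisms between
members of simple families. -/
theorem closeUp_compThree (α : TetSpace f123 f124 f134 f234) (γ : TetSpace f013 f014 f034 f134)
    (ε : TetSpace f012 f013 f023 f123) (α' : TetSpaceOp f123' f124 f134' f234)
    (γ' : TetSpaceOp f013' f014 f034 f134') (ε' : TetSpaceOp f012 f013' f023 f123') :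
    closeUpₗ F (leftComp₄ f012 f023 f034)
        (compThree F f012 f013 f014 f023 f034 f123 f124 f134 f234 (α ⊗ₜ γ ⊗ₜ ε) ≫
          compThreeOp F f012 f013' f014 f023 f034 f123' f124 f134' f234 (α' ⊗ₜ γ' ⊗ₜ ε')) =
      closeUpₗ F (mid₃ f013 f034 f123) (whiskerGamma F f013 f014 f034 f123 f134 γ ≫
        whiskerAlpha F f014 f123 f123' f134 f134' (α ≫ α') ≫
        whiskerGammaOp F f013' f014 f034 f123' f134' γ' ≫
        whiskerEpsilon F f013' f013 f034 f123' f123 (ε' ≫ ε)) := by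
  rw [compThree_tmul_eq, compThreeOp_tmul_eq, ← stepAlpha_comp_stepAlphaOp,
    ← stepEpsilonOp_comp_stepEpsilon, Category.assoc, closeUp_comm]
  simp only [Category.assoc]

theorem closeUp_whiskerGamma {s : F} (hg : trace f123 (𝟙 f123) = s • 𝟙 (idHom e13))
    (γ : TetSpace f013 f014 f034 f134) (γ' : TetSpaceOp f013 f014 f034 f134) :
    closeUpₗ F (mid₃ f013 f034 f123) (whiskerGamma F f013 f014 f034 f123 f134 γ ≫
        whiskerGammaOp F f013 f014 f034 f123 f134 γ') =
      s • closeUpₗ F (leftComp f034 f013) (γ ≫ γ') := by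
  have h := closeUp_hcomp_id (trace_tensorLeft (trace_tensorRight hg e01) e34) (γ ≫ γ')
  rw [← h]
  refine closeUp_congr F rfl (vcomp_hcomp_id₂ _ _ _ _ (by simp) ?_).symm
  rw [γ.2, Hom.cod_eq]
  simp

variable [ScalarUnit F C]

theorem pairing_compThree_eq_zero
    (h : (∀ φ : rightComp f013' f123' ⟶ rightComp f013 f123, φ = 0) ∨
      ∀ φ : leftComp f134 f123 ⟶ leftComp f134' f123', φ = 0)
    (α : TetSpace f123 f124 f134 f234) (γ : TetSpace f013 f014 f034 f134)
    (ε : TetSpace f012 f013 f023 f123) (α' : TetSpaceOp f123' f124 f134' f234)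
    (γ' : TetSpaceOp f013' f014 f034 f134') (ε' : TetSpaceOp f012 f013' f023 f123') :
    pairing F (leftComp₄ f012 f023 f034) (rightComp₄ f014 f124 f234)
        (compThree F f012 f013 f014 f023 f034 f123 f124 f134 f234 (α ⊗ₜ γ ⊗ₜ ε))
        (compThreeOp F f012 f013' f014 f023 f034 f123' f124 f134' f234 (α' ⊗ₜ γ' ⊗ₜ ε')) = 0 := by
  rw [pairing_apply, closeUp_compThree]
  rcases h with h | h
  · rw [h (ε' ≫ ε)]
    simp only [map_zero, Limits.comp_zero]
  · rw [h (α ≫ α')]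
    simp only [map_zero, Limits.comp_zero, Limits.zero_comp]

/-- Let ε'ε = s and αα' = t be the scalars given by Schur, and l the value of a loop of `f123`. The
whole diagram is s t l ⟨γ,γ'⟩, while ⟨ε,ε'⟩ = s l dim(f013) and ⟨α,α'⟩ = t l dim(f134). The identity
follows from dim(f123) = l · dim(e13). -/
theorem mul_pairing_compThree (hd : qdim₀ F e13 ≠ 0) {l : F}
    (hl : trace f123 (𝟙 f123) = l • 𝟙 (idHom e13))
    (hR : ∀ φ : rightComp f013 f123 ⟶ rightComp f013 f123, ∃ s : F, φ = s • 𝟙 _)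
    (hL : ∀ φ : leftComp f134 f123 ⟶ leftComp f134 f123, ∃ s : F, φ = s • 𝟙 _)
    (α : TetSpace f123 f124 f134 f234) (γ : TetSpace f013 f014 f034 f134)
    (ε : TetSpace f012 f013 f023 f123) (α' : TetSpaceOp f123 f124 f134 f234)
    (γ' : TetSpaceOp f013 f014 f034 f134) (ε' : TetSpaceOp f012 f013 f023 f123) :
    ((qdim₀ F e13)⁻¹ * qdim₁ F f013 * qdim₁ F f123 * qdim₁ F f134) *
      pairing F (leftComp₄ f012 f023 f034) (rightComp₄ f014 f124 f234)
        (compThree F f012 f013 f014 f023 f034 f123 f124 f134 f234 (α ⊗ₜ γ ⊗ₜ ε))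
        (compThreeOp F f012 f013 f014 f023 f034 f123 f124 f134 f234 (α' ⊗ₜ γ' ⊗ₜ ε')) =
      pairing F _ _ α α' * pairing F _ _ γ γ' * pairing F _ _ ε ε' := by
  obtain ⟨s, hs⟩ := hR (ε' ≫ ε)
  obtain ⟨t, ht⟩ := hL (α ≫ α')
  have h1 : pairing F _ _ ε ε' = s * (l * qdim₁ F f013) := by
    rw [pairing_apply, closeUp_comm, hs, qdim₁_smul, qdim₁_rightComp f013 hl]
  have h2 : pairing F _ _ α α' = t * (l * qdim₁ F f134) := by
    rw [pairing_apply, ht, qdim₁_smul, qdim₁_leftComp f134 hl]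
  have h3 : pairing F (leftComp₄ f012 f023 f034) (rightComp₄ f014 f124 f234)
        (compThree F f012 f013 f014 f023 f034 f123 f124 f134 f234 (α ⊗ₜ γ ⊗ₜ ε))
        (compThreeOp F f012 f013 f014 f023 f034 f123 f124 f134 f234 (α' ⊗ₜ γ' ⊗ₜ ε')) =
      s * t * l * pairing F _ _ γ γ' := by
    rw [pairing_apply, closeUp_compThree, hs, ht, map_smul, map_smul, whiskerAlpha_id,
      whiskerEpsilon_id]
    simp only [Linear.smul_comp, Linear.comp_smul, Category.id_comp, Category.comp_id, map_smul]
    rw [closeUp_whiskerGamma F f013 f014 f034 f123 f134 hl, map_smul, pairing_apply]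
    simp only [smul_eq_mul]
    ring
  rw [h1, h2, h3, qdim₁_of_trace hl]
  field_simp

end ThreeSimplices

theorem mem_range_toModule {F I W : Type*} [Field F] [DecidableEq I] {V : I → Type*}
    [∀ i, AddCommGroup (V i)] [∀ i, Module F (V i)] [AddCommGroup W] [Module F W]
    (L : ∀ i, V i →ₗ[F] W) (i : I) (t : V i) :
    L i t ∈ LinearMap.range (DirectSum.toModule F I W L) :=
  ⟨DirectSum.lof F I V i t, DirectSum.toModule_lof F i t⟩

/-! ### The composites εγα span. -/

section ThreeSimplexSum

variable (F : Type x) [Field F] {C : StrictTwoCategory.{u, v, w}} [SemistrictMonoidal C]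
  [∀ A B : C.Obj, Preadditive (C.Hom A B)] [∀ A B : C.Obj, Linear F (C.Hom A B)]
  [VectLinear F C]
  {E : Finset C.Obj} {ℱ : ∀ A B : C.Obj, Finset (C.Hom A B)}
  {e01 e02 e03 e04 e12 e14 e23 e24 e34 : C.Obj}
  (f012 : C.Hom e02 (e12 ⊗ₒ e01)) (f014 : C.Hom e04 (e14 ⊗ₒ e01))
  (f023 : C.Hom e03 (e23 ⊗ₒ e02)) (f034 : C.Hom e04 (e34 ⊗ₒ e03))
  (f124 : C.Hom e14 (e24 ⊗ₒ e12)) (f234 : C.Hom e24 (e34 ⊗ₒ e23))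

/-- `φ ↦ f_{034} ∘ (e_{34} ⊗ φ)` on endomorphisms of `f_{(012)3}`. -/
def whiskerSource : (leftComp f023 f012 ⟶ leftComp f023 f012) →ₗ[F]
    (leftComp₄ f012 f023 f034 ⟶ leftComp₄ f012 f023 f034) :=
  whiskerLeftₗ F f034.1 f034.3 (f := (leftComp f023 f012).tensorLeft e34)
      (f' := (leftComp f023 f012).tensorLeft e34) _ _
      (leftComp₄_val f012 f023 f034) (leftComp₄_val f012 f023 f034) ∘ₗ
    tensorLeftₗ F e34 _ _ rfl rfl

/-- `φ ↦ f_{014} ∘ (φ ⊗ e_{01})` on endomorphisms of `f_{1(234)}`. -/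
def whiskerTarget : (rightComp f124 f234 ⟶ rightComp f124 f234) →ₗ[F]
    (rightComp₄ f014 f124 f234 ⟶ rightComp₄ f014 f124 f234) :=
  have h (g : C.Hom e14 (e34 ⊗ₒ e23 ⊗ₒ e12)) :
      C.cod (g.1 ▷₁ e01) = e34 ⊗ₒ e23 ⊗ₒ e12 ⊗ₒ e01 := by
    rw [cod_tr₁, g.3, tensor_assoc, tensor_assoc]
  whiskerLeftₗ F f014.1 f014.3
      (f := ⟨_, ((rightComp f124 f234).tensorRight e01).2, h _⟩)
      (f' := ⟨_, ((rightComp f124 f234).tensorRight e01).2, h _⟩) _ _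
      (rightComp₄_val f014 f124 f234) (rightComp₄_val f014 f124 f234) ∘ₗ
    tensorRightₗ F e01 _ _ rfl rfl

theorem whiskerSource_id : whiskerSource F f012 f023 f034 (𝟙 _) = 𝟙 _ := by
  refine Hom₂.ext ?_
  change C.id₂ f034.1 ⊡ₕ e34 ◁₂ C.id₂ (leftComp f023 f012).1 = C.id₂ _
  rw [tl₂_id₂, ← C.id₂_comp _ _ (by simp (maxDischargeDepth := 9)), leftComp₄_val]
  rfl

theorem whiskerTarget_id : whiskerTarget F f014 f124 f234 (𝟙 _) = 𝟙 _ := by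
  refine Hom₂.ext ?_
  change C.id₂ f014.1 ⊡ₕ C.id₂ (rightComp f124 f234).1 ▷₂ e01 = C.id₂ _
  rw [tr₂_id₂, ← C.id₂_comp _ _ (by simp (maxDischargeDepth := 9)), rightComp₄_val]
  rfl

theorem whiskerSource_comp {e13 : C.Obj} (f013 : C.Hom e03 (e13 ⊗ₒ e01))
    (f123 : C.Hom e13 (e23 ⊗ₒ e12)) (ε : TetSpace f012 f013 f023 f123)
    (ε' : TetSpaceOp f012 f013 f023 f123) :
    whiskerSource F f012 f023 f034 (ε ≫ ε') =
      stepEpsilon F f012 f013 f023 f034 f123 ε ≫ stepEpsilonOp F f012 f013 f023 f034 f123 ε' := by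
  refine Hom₂.ext ?_
  change C.id₂ f034.1 ⊡ₕ e34 ◁₂ (ε.1 ⊡ᵥ ε'.1) =
    (C.id₂ f034.1 ⊡ₕ e34 ◁₂ ε.1) ⊡ᵥ (C.id₂ f034.1 ⊡ₕ e34 ◁₂ ε'.1)
  rw [tl₂_vcomp _ _ _ (by simp), id₂_hcomp_vcomp _ _ _ _ (by simp) (by simp (maxDischargeDepth := 9))]

theorem whiskerTarget_comp {e13 : C.Obj} (f123 : C.Hom e13 (e23 ⊗ₒ e12))
    (f134 : C.Hom e14 (e34 ⊗ₒ e13)) (α' : TetSpaceOp f123 f124 f134 f234)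
    (α : TetSpace f123 f124 f134 f234) :
    whiskerTarget F f014 f124 f234 (α' ≫ α) =
      stepAlphaOp F f014 f123 f124 f134 f234 α' ≫ stepAlpha F f014 f123 f124 f134 f234 α := by
  refine Hom₂.ext ?_
  change C.id₂ f014.1 ⊡ₕ (α'.1 ⊡ᵥ α.1) ▷₂ e01 =
    (C.id₂ f014.1 ⊡ₕ α'.1 ▷₂ e01) ⊡ᵥ (C.id₂ f014.1 ⊡ₕ α.1 ▷₂ e01)
  rw [tr₂_vcomp _ _ _ (by simp), id₂_hcomp_vcomp _ _ _ _ (by simp) (by simp (maxDischargeDepth := 9))]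

theorem compThree_mem_range (X : E) (f013 : ℱ e03 (X.1 ⊗ₒ e01)) (f123 : ℱ X.1 (e23 ⊗ₒ e12))
    (f134 : ℱ e14 (e34 ⊗ₒ X.1)) (t : TetSpace f123.1 f124 f134.1 f234 ⊗[F]
      TetSpace f013.1 f014 f034 f134.1 ⊗[F] TetSpace f012 f013.1 f023 f123.1) :
    compThree F f012 f013.1 f014 f023 f034 f123.1 f124 f134.1 f234 t ∈
      LinearMap.range (rightMap F E ℱ f012 f014 f023 f034 f124 f234) := by
  classical
  exact mem_range_toModule (I := InnerLabel E ℱ e01 e03 e12 e14 e23 e34)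
    (fun l => compThree F f012 l.2.1.1 f014 f023 f034 l.2.2.1.1 f124 l.2.2.2.1 f234)
    ⟨X, f013, f123, f134⟩ t

variable [DualData C] [HasDuals C] {F}
  (hE : IsObjectBasis F E) (hℱ : ∀ A B : C.Obj, IsTwoBasis F (ℱ A B))
include hE hℱ

/-- Since `f123` is simple and tensoring with e34 and e01 preserves full faithfulness, a 2-morphism
between composites ending in e34 ⊗ f123 ⊗ e01 acts on the first factors only. -/
theorem exists_eq_whiskerGamma {X : E} (f013 : C.Hom e03 (X.1 ⊗ₒ e01))
    (f134 : C.Hom e14 (e34 ⊗ₒ X.1)) (g : ℱ X.1 (e23 ⊗ₒ e12))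
    (φ : mid₃ f013 f034 g.1 ⟶ mid₄ f014 g.1 f134) :
    ∃ γ, φ = whiskerGamma F f013 f014 f034 g.1 f134 γ := by
  obtain ⟨γ, hγ⟩ := exists_eq_hcomp_hom_hom hE hℱ (tensorRightBend_isLinear e01)
    (tensorLeftBend_isLinear e34) g (x := leftComp f034 f013) (y := rightComp f014 f134)
    (recast F (f := mid₃ f013 f034 g.1) (g := mid₄ f014 g.1 f134)
      (f' := (leftComp f034 f013).comp ((g.1.tensorRight e01).tensorLeft e34))
      (g' := (rightComp f014 f134).comp ((g.1.tensorRight e01).tensorLeft e34)) rfl rfl φ)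
  exact ⟨γ, Hom₂.ext (congrArg Hom₂.val hγ :)⟩

theorem mid_eq_zero {X X' : E} (f013 : C.Hom e03 (X.1 ⊗ₒ e01))
    (f134 : C.Hom e14 (e34 ⊗ₒ X'.1)) (g : ℱ X.1 (e23 ⊗ₒ e12)) (g' : ℱ X'.1 (e23 ⊗ₒ e12))
    (h : (⟨X, g⟩ : Σ X : E, ℱ X.1 (e23 ⊗ₒ e12)) ≠ ⟨X', g'⟩)
    (φ : mid₃ f013 f034 g.1 ⟶ mid₄ f014 g'.1 f134) : φ = 0 := by
  let ρ := recast F (f := mid₃ f013 f034 g.1) (g := mid₄ f014 g'.1 f134)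
    (f' := (leftComp f034 f013).comp ((g.1.tensorRight e01).tensorLeft e34))
    (g' := (rightComp f014 f134).comp ((g'.1.tensorRight e01).tensorLeft e34)) rfl rfl
  refine ρ.map_eq_zero_iff.1 ?_
  exact eq_zero_hom_hom hE hℱ (tensorRightBend_isLinear e01) (tensorLeftBend_isLinear e34) g g' h
    (x := leftComp f034 f013) (y := rightComp f014 f134) (ρ φ)

/-- The expansions at the source and at the target introduce independent labels `f123` and `f123'`.
If these agree, the middle 2-morphism comes from some γ; otherwise it vanishes. -/
theorem stepEpsilon_comp_stepAlpha_mem_range {X X' : E} (f013 : ℱ e03 (X.1 ⊗ₒ e01))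
    (f123 : ℱ X.1 (e23 ⊗ₒ e12)) (f123' : ℱ X'.1 (e23 ⊗ₒ e12)) (f134 : ℱ e14 (e34 ⊗ₒ X'.1))
    (ε : TetSpace f012 f013.1 f023 f123.1) (φ : mid₃ f013.1 f034 f123.1 ⟶ mid₄ f014 f123'.1 f134.1)
    (α : TetSpace f123'.1 f124 f134.1 f234) :
    stepEpsilon F f012 f013.1 f023 f034 f123.1 ε ≫ φ ≫
        stepAlpha F f014 f123'.1 f124 f134.1 f234 α ∈
      LinearMap.range (rightMap F E ℱ f012 f014 f023 f034 f124 f234) := by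
  by_cases h : (⟨X, f123⟩ : Σ X : E, ℱ X.1 (e23 ⊗ₒ e12)) = ⟨X', f123'⟩
  · obtain ⟨rfl, h⟩ := Sigma.mk.inj h
    obtain rfl := eq_of_heq h
    obtain ⟨γ, hγ⟩ := exists_eq_whiskerGamma f014 f034 hE hℱ f013.1 f134.1 f123 φ
    rw [hγ]
    exact compThree_mem_range F f012 f014 f023 f034 f124 f234 X f013 f123 f134 (α ⊗ₜ γ ⊗ₜ ε)
  · rw [mid_eq_zero f014 f034 hE hℱ f013.1 f134.1 f123 f123' h φ]
    simp only [Limits.zero_comp, Limits.comp_zero]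
    exact Submodule.zero_mem _

theorem rightMap_surjective :
    Function.Surjective (rightMap F E ℱ f012 f014 f023 f034 f124 f234) := by
  intro ω
  -- ω is surrounded by endomorphisms of f_{(012)3} and f_{1(234)}, bilinearly. Putting identities
  -- there and expanding each through the other bracketing reduces ω to terms with ε at the start
  -- and α at the end.
  let m : (leftComp f023 f012 ⟶ leftComp f023 f012) →ₗ[F]
      (rightComp f124 f234 ⟶ rightComp f124 f234) →ₗ[F]
        (leftComp₄ f012 f023 f034 ⟶ rightComp₄ f014 f124 f234) :=
    (vcompₗ F _ _ _).compl₁₂ (Linear.rightComp F _ ω ∘ₗ whiskerSource F f012 f023 f034)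
      (whiskerTarget F f014 f124 f234)
  have hm (χ ψ) : m χ ψ = (whiskerSource F f012 f023 f034 χ ≫ ω) ≫
      whiskerTarget F f014 f124 f234 ψ := rfl
  have hω : ω = m (𝟙 _) (𝟙 _) := by
    rw [hm, whiskerSource_id, whiskerTarget_id, Category.id_comp, Category.comp_id]
  rw [← LinearMap.mem_range, hω]
  refine (Submodule.span_le.2 ?_ : _ ≤ Submodule.comap (m.flip (𝟙 _)) (LinearMap.range _))
    (generatedBy_rightComp hE hℱ (leftComp f023 f012))
  rintro _ ⟨_, ⟨⟨X, f013, f123⟩, rfl⟩, ε, ε', rfl⟩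
  refine (Submodule.span_le.2 ?_ : _ ≤ Submodule.comap (m (ε ≫ ε')) (LinearMap.range _))
    (generatedBy_leftComp hE hℱ (rightComp f124 f234))
  rintro _ ⟨_, ⟨⟨X', f134, f123'⟩, rfl⟩, α', α, rfl⟩
  change m (ε ≫ ε') (α' ≫ α) ∈ LinearMap.range (rightMap F E ℱ f012 f014 f023 f034 f124 f234)
  have h1 : m (ε ≫ ε') (α' ≫ α) = stepEpsilon F f012 f013.1 f023 f034 f123.1 ε ≫
      (stepEpsilonOp F f012 f013.1 f023 f034 f123.1 ε' ≫ ω ≫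
        stepAlphaOp F f014 f123'.1 f124 f134.1 f234 α') ≫
      stepAlpha F f014 f123'.1 f124 f134.1 f234 α := by
    rw [hm, whiskerSource_comp, whiskerTarget_comp]
    simp only [Category.assoc]
  rw [h1]
  exact stepEpsilon_comp_stepAlpha_mem_range f012 f014 f023 f034 f124 f234 hE hℱ f013 f123 f123'
    f134 ε _ α

end ThreeSimplexSum

/-! ### Assembling the two orthogonal decompositions. -/

section Assembly

variable {F : Type x} [Field F] {C : StrictTwoCategory.{u, v, w}} [SemistrictMonoidal C]
  [DualData C] [HasDuals C]
  [∀ A B : C.Obj, Preadditive (C.Hom A B)] [∀ A B : C.Obj, Linear F (C.Hom A B)]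
  [VectLinear F C] [ScalarUnit F C] [Nondegenerate F C]

section Pairings

variable (F) {e01 e02 e03 e04 e12 e13 e14 e23 e24 e34 : C.Obj}
  (f012 : C.Hom e02 (e12 ⊗ₒ e01)) (f013 : C.Hom e03 (e13 ⊗ₒ e01))
  (f014 : C.Hom e04 (e14 ⊗ₒ e01)) (f023 : C.Hom e03 (e23 ⊗ₒ e02))
  (f024 : C.Hom e04 (e24 ⊗ₒ e02)) (f034 : C.Hom e04 (e34 ⊗ₒ e03))
  (f123 : C.Hom e13 (e23 ⊗ₒ e12)) (f124 : C.Hom e14 (e24 ⊗ₒ e12))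
  (f134 : C.Hom e14 (e34 ⊗ₒ e13)) (f234 : C.Hom e24 (e34 ⊗ₒ e23))

/-- The duality between `2H(0234) ⊗ 2H(0124)` and the tensor product of the opposite spaces. -/
noncomputable def pairTwo :
    (TetSpace f023 f024 f034 f234 ⊗[F] TetSpace f012 f014 f024 f124) ≃ₗ[F]
      Module.Dual F (TetSpaceOp f023 f024 f034 f234 ⊗[F] TetSpaceOp f012 f014 f024 f124) :=
  TensorProduct.congr
      (pairing F (rightComp f024 f234) (leftComp f034 f023)).flip.toPerfPair
      (pairing F (rightComp f014 f124) (leftComp f024 f012)).flip.toPerfPair ≪≫ₗ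
    TensorProduct.dualDistribEquiv F _ _

/-- The duality between `2H(1234) ⊗ 2H(0134) ⊗ 2H(0123)` and the tensor product of the opposite
spaces. -/
noncomputable def pairThree :
    (TetSpace f123 f124 f134 f234 ⊗[F] TetSpace f013 f014 f034 f134 ⊗[F]
        TetSpace f012 f013 f023 f123) ≃ₗ[F]
      Module.Dual F (TetSpaceOp f123 f124 f134 f234 ⊗[F] TetSpaceOp f013 f014 f034 f134 ⊗[F]
        TetSpaceOp f012 f013 f023 f123) :=
  TensorProduct.congr
      (TensorProduct.congr (pairing F (leftComp f134 f123) (rightComp f124 f234)).toPerfPair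
          (pairing F (leftComp f034 f013) (rightComp f014 f134)).toPerfPair ≪≫ₗ
        TensorProduct.dualDistribEquiv F _ _)
      (pairing F (leftComp f023 f012) (rightComp f013 f123)).toPerfPair ≪≫ₗ
    TensorProduct.dualDistribEquiv F _ _

theorem pairTwo_tmul (β : TetSpace f023 f024 f034 f234) (δ : TetSpace f012 f014 f024 f124)
    (β' : TetSpaceOp f023 f024 f034 f234) (δ' : TetSpaceOp f012 f014 f024 f124) :
    pairTwo F f012 f014 f023 f024 f034 f124 f234 (β ⊗ₜ δ) (β' ⊗ₜ δ') =
      pairing F _ _ β β' * pairing F _ _ δ δ' := by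
  rw [pairing_symm F _ _ β, pairing_symm F _ _ δ]
  rfl

theorem pairThree_tmul (α : TetSpace f123 f124 f134 f234) (γ : TetSpace f013 f014 f034 f134)
    (ε : TetSpace f012 f013 f023 f123) (α' : TetSpaceOp f123 f124 f134 f234)
    (γ' : TetSpaceOp f013 f014 f034 f134) (ε' : TetSpaceOp f012 f013 f023 f123) :
    pairThree F f012 f013 f014 f023 f034 f123 f124 f134 f234 (α ⊗ₜ γ ⊗ₜ ε) (α' ⊗ₜ γ' ⊗ₜ ε') =
      pairing F _ _ α α' * pairing F _ _ γ γ' * pairing F _ _ ε ε' := rfl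

/-- `Zplus` is the inverse of the duality `pairThree` applied to a functional; undoing the inverse
recovers its defining equation. -/
theorem pairThree_Zplus (t) :
    pairThree F f012 f013 f014 f023 f034 f123 f124 f134 f234
        (Zplus F f012 f013 f014 f023 f024 f034 f123 f124 f134 f234 t) =
      pairing F (leftComp₄ f012 f023 f034) (rightComp₄ f014 f124 f234)
          (compTwo F f012 f014 f023 f024 f034 f124 f234 t) ∘ₗ
        compThreeOp F f012 f013 f014 f023 f034 f123 f124 f134 f234 :=
  LinearEquiv.apply_symm_apply (pairThree F f012 f013 f014 f023 f034 f123 f124 f134 f234) _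

theorem pairTwo_Zminus (t) :
    pairTwo F f012 f014 f023 f024 f034 f124 f234
        (Zminus F f012 f013 f014 f023 f024 f034 f123 f124 f134 f234 t) =
      (pairing F (rightComp₄ f014 f124 f234) (leftComp₄ f012 f023 f034)).flip
          (compThree F f012 f013 f014 f023 f034 f123 f124 f134 f234 t) ∘ₗ
        compTwoOp F f012 f014 f023 f024 f034 f124 f234 :=
  LinearEquiv.apply_symm_apply (pairTwo F f012 f014 f023 f024 f034 f124 f234) _

theorem mul_pairing_compThree_apply (hd : qdim₀ F e13 ≠ 0) {l : F}
    (hl : trace f123 (𝟙 f123) = l • 𝟙 (idHom e13))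
    (hR : ∀ φ : rightComp f013 f123 ⟶ rightComp f013 f123, ∃ s : F, φ = s • 𝟙 _)
    (hL : ∀ φ : leftComp f134 f123 ⟶ leftComp f134 f123, ∃ s : F, φ = s • 𝟙 _) (t t') :
    ((qdim₀ F e13)⁻¹ * qdim₁ F f013 * qdim₁ F f123 * qdim₁ F f134) *
      pairing F (leftComp₄ f012 f023 f034) (rightComp₄ f014 f124 f234)
        (compThree F f012 f013 f014 f023 f034 f123 f124 f134 f234 t)
        (compThreeOp F f012 f013 f014 f023 f034 f123 f124 f134 f234 t') =
      pairThree F f012 f013 f014 f023 f034 f123 f124 f134 f234 t t' := by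
  induction t using TensorProduct.induction_on with
  | zero => simp
  | add a b ha hb => simp only [map_add, LinearMap.add_apply, mul_add, ha, hb]
  | tmul r ε =>
    induction r using TensorProduct.induction_on with
    | zero => simp
    | add a b ha hb => simp only [add_tmul, map_add, LinearMap.add_apply, mul_add, ha, hb]
    | tmul α γ =>
      induction t' using TensorProduct.induction_on with
      | zero => simp
      | add a b ha hb => simp only [map_add, mul_add, ha, hb]
      | tmul r' ε' =>
        induction r' using TensorProduct.induction_on with
        | zero => simp
        | add a b ha hb => simp only [add_tmul, map_add, mul_add, ha, hb]
        | tmul α' γ' =>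
          rw [pairThree_tmul, mul_pairing_compThree F f012 f013 f014 f023 f034 f123 f124 f134 f234
            hd hl hR hL]

theorem pairing_compThree_apply_eq_zero {e13' : C.Obj} (f013' : C.Hom e03 (e13' ⊗ₒ e01))
    (f123' : C.Hom e13' (e23 ⊗ₒ e12)) (f134' : C.Hom e14 (e34 ⊗ₒ e13'))
    (h : (∀ φ : rightComp f013' f123' ⟶ rightComp f013 f123, φ = 0) ∨
      ∀ φ : leftComp f134 f123 ⟶ leftComp f134' f123', φ = 0) (t t') :
    pairing F (leftComp₄ f012 f023 f034) (rightComp₄ f014 f124 f234)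
        (compThree F f012 f013 f014 f023 f034 f123 f124 f134 f234 t)
        (compThreeOp F f012 f013' f014 f023 f034 f123' f124 f134' f234 t') = 0 := by
  induction t using TensorProduct.induction_on with
  | zero => simp
  | add a b ha hb => simp only [map_add, LinearMap.add_apply, ha, hb, add_zero]
  | tmul r ε =>
    induction r using TensorProduct.induction_on with
    | zero => simp
    | add a b ha hb => simp only [add_tmul, map_add, LinearMap.add_apply, ha, hb, add_zero]
    | tmul α γ =>
      induction t' using TensorProduct.induction_on with
      | zero => simp
      | add a b ha hb => simp only [map_add, ha, hb, add_zero]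
      | tmul r' ε' =>
        induction r' using TensorProduct.induction_on with
        | zero => simp
        | add a b ha hb => simp only [add_tmul, map_add, ha, hb, add_zero]
        | tmul α' γ' => exact pairing_compThree_eq_zero F _ _ _ _ _ _ _ _ _ _ _ _ h α γ ε α' γ' ε'

end Pairings

theorem separatingLeft_toLinearMap {V V' : Type*} [AddCommGroup V] [Module F V] [AddCommGroup V']
    [Module F V'] (e : V ≃ₗ[F] Module.Dual F V') : e.toLinearMap.SeparatingLeft :=
  fun _ hx => e.map_eq_zero_iff.1 (LinearMap.ext hx)

variable {E : Finset C.Obj} (hE : IsObjectBasis F E)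
  {ℱ : ∀ A B : C.Obj, Finset (C.Hom A B)} (hℱ : ∀ A B : C.Obj, IsTwoBasis F (ℱ A B))
  {e01 e02 e03 e04 e12 e14 e23 e24 e34 : C.Obj}
  (f012 : C.Hom e02 (e12 ⊗ₒ e01)) (f014 : C.Hom e04 (e14 ⊗ₒ e01))
  (f023 : C.Hom e03 (e23 ⊗ₒ e02)) (f034 : C.Hom e04 (e34 ⊗ₒ e03))
  (f124 : C.Hom e14 (e24 ⊗ₒ e12)) (f234 : C.Hom e24 (e34 ⊗ₒ e23))
include hℱ

open Classical in
theorem isOrthogonalPair_compTwo :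
    IsOrthogonalPair (I := ℱ e04 (e24 ⊗ₒ e02))
      (pairing F (leftComp₄ f012 f023 f034) (rightComp₄ f014 f124 f234))
      (fun f024 => compTwo F f012 f014 f023 f024.1 f034 f124 f234)
      (fun f024 => compTwoOp F f012 f014 f023 f024.1 f034 f124 f234)
      (fun f024 => (pairTwo F f012 f014 f023 f024.1 f034 f124 f234).toLinearMap)
      (fun f024 => qdim₁ F f024.1) where
  ne_zero f024 := qdim₁_ne_zero _ ((hℱ _ _).simple _ f024.2)
  separating _ := separatingLeft_toLinearMap _
  isometric f024 t t' := by
    induction t using TensorProduct.induction_on with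
    | zero => simp
    | add a b ha hb => simp only [map_add, LinearMap.add_apply, mul_add, ha, hb]
    | tmul β δ =>
      induction t' using TensorProduct.induction_on with
      | zero => simp
      | add a b ha hb => simp only [map_add, mul_add, ha, hb]
      | tmul β' δ' =>
        exact (qdim₁_mul_pairing_compTwo F f012 f014 f023 f034 f124 f234
          ((hℱ _ _).isSimpleFamily.scalar f024) β δ β' δ').trans
          (pairTwo_tmul F f012 f014 f023 f024.1 f034 f124 f234 β δ β' δ').symm
  orthogonal f024 g024 hne t t' := by
    induction t using TensorProduct.induction_on with
    | zero => simp
    | add a b ha hb => simp only [map_add, LinearMap.add_apply, ha, hb, add_zero]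
    | tmul β δ =>
      induction t' using TensorProduct.induction_on with
      | zero => simp
      | add a b ha hb => simp only [map_add, ha, hb, add_zero]
      | tmul β' δ' =>
        exact pairing_compTwo_eq_zero F f012 f014 f023 f034 f124 f234
          ((hℱ _ _).isSimpleFamily.orthogonal f024 g024 hne) β δ β' δ'
  surjective := leftMap_surjective F hℱ f012 f014 f023 f034 f124 f234

include hE

/-- If the labels differ in (e13, f013, f123), the 1-morphisms f_{0(123)} are distinct members of a
simple family. Otherwise they differ in f134 alone, and the f_{(123)4} are distinct. -/
theorem leftComp_rightComp_orthogonal (l l' : InnerLabel E ℱ e01 e03 e12 e14 e23 e34)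
    (hne : l ≠ l') :
    (∀ φ : rightComp l'.2.1.1 l'.2.2.1.1 ⟶ rightComp l.2.1.1 l.2.2.1.1, φ = 0) ∨
      ∀ φ : leftComp l.2.2.2.1 l.2.2.1.1 ⟶ leftComp l'.2.2.2.1 l'.2.2.1.1, φ = 0 := by
  obtain ⟨X, f013, f123, f134⟩ := l
  obtain ⟨X', f013', f123', f134'⟩ := l'
  by_cases h1 : (⟨X', f013', f123'⟩ : Σ q : E, ℱ e03 (q.1 ⊗ₒ e01) × ℱ q.1 (e23 ⊗ₒ e12)) =
      ⟨X, f013, f123⟩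
  · obtain ⟨rfl, h1⟩ := Sigma.mk.inj h1
    obtain ⟨rfl, rfl⟩ := Prod.mk.inj (eq_of_heq h1)
    refine Or.inr ((isSimpleFamily_leftComp hE hℱ e12 e23 e34 e14).orthogonal
      ⟨X', f134, f123'⟩ ⟨X', f134', f123'⟩ fun h2 => hne ?_)
    obtain ⟨-, h2⟩ := Sigma.mk.inj h2
    obtain ⟨rfl, -⟩ := Prod.mk.inj (eq_of_heq h2)
    rfl
  · exact Or.inl ((isSimpleFamily_rightComp hE hℱ e01 e12 e23 e03).orthogonal _ _ h1)

theorem innerLabel_isometric (l : InnerLabel E ℱ e01 e03 e12 e14 e23 e34) (t t') :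
    ((qdim₀ F l.1.1)⁻¹ * qdim₁ F l.2.1.1 * qdim₁ F l.2.2.1.1 * qdim₁ F l.2.2.2.1) *
      pairing F (leftComp₄ f012 f023 f034) (rightComp₄ f014 f124 f234)
        (compThree F f012 l.2.1.1 f014 f023 f034 l.2.2.1.1 f124 l.2.2.2.1 f234 t)
        (compThreeOp F f012 l.2.1.1 f014 f023 f034 l.2.2.1.1 f124 l.2.2.2.1 f234 t') =
      pairThree F f012 l.2.1.1 f014 f023 f034 l.2.2.1.1 f124 l.2.2.2.1 f234 t t' := by
  have hX := exists_trace_id (hE.simple_idHom l.1.2) l.2.2.1.1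
  obtain ⟨s, hs⟩ := hX
  have hR : ∀ φ : rightComp l.2.1.1 l.2.2.1.1 ⟶ rightComp l.2.1.1 l.2.2.1.1, ∃ s : F, φ = s • 𝟙 _ :=
    (isSimpleFamily_rightComp hE hℱ e01 e12 e23 e03).scalar ⟨l.1, l.2.1, l.2.2.1⟩
  have hL : ∀ φ : leftComp l.2.2.2.1 l.2.2.1.1 ⟶ leftComp l.2.2.2.1 l.2.2.1.1, ∃ s : F, φ = s • 𝟙 _ :=
    (isSimpleFamily_leftComp hE hℱ e12 e23 e34 e14).scalar ⟨l.1, l.2.2.2, l.2.2.1⟩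
  have hd : qdim₀ F l.1.1 ≠ 0 := qdim₁_ne_zero _ (hE.simple_idHom l.1.2)
  exact mul_pairing_compThree_apply F f012 l.2.1.1 f014 f023 f034 l.2.2.1.1 f124 l.2.2.2.1 f234
    hd hs hR hL t t'

open Classical in
theorem isOrthogonalPair_compThree :
    IsOrthogonalPair (I := InnerLabel E ℱ e01 e03 e12 e14 e23 e34)
      (pairing F (leftComp₄ f012 f023 f034) (rightComp₄ f014 f124 f234))
      (fun l => compThree F f012 l.2.1.1 f014 f023 f034 l.2.2.1.1 f124 l.2.2.2.1 f234)
      (fun l => compThreeOp F f012 l.2.1.1 f014 f023 f034 l.2.2.1.1 f124 l.2.2.2.1 f234)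
      (fun l => (pairThree F f012 l.2.1.1 f014 f023 f034 l.2.2.1.1 f124 l.2.2.2.1
        f234).toLinearMap)
      (fun l => (qdim₀ F l.1.1)⁻¹ * qdim₁ F l.2.1.1 * qdim₁ F l.2.2.1.1 *
        qdim₁ F l.2.2.2.1) where
  ne_zero l := mul_ne_zero (mul_ne_zero (mul_ne_zero
    (inv_ne_zero (qdim₁_ne_zero _ (hE.simple_idHom l.1.2)))
    (qdim₁_ne_zero _ ((hℱ _ _).simple _ l.2.1.2)))
    (qdim₁_ne_zero _ ((hℱ _ _).simple _ l.2.2.1.2)))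
    (qdim₁_ne_zero _ ((hℱ _ _).simple _ l.2.2.2.2))
  separating _ := separatingLeft_toLinearMap _
  isometric l t t' := innerLabel_isometric hE hℱ f012 f014 f023 f034 f124 f234 l t t'
  orthogonal l l' hne t t' := pairing_compThree_apply_eq_zero F f012 l.2.1.1 f014 f023 f034
    l.2.2.1.1 f124 l.2.2.2.1 f234 l'.2.1.1 l'.2.2.1.1 l'.2.2.2.1
    (leftComp_rightComp_orthogonal hE hℱ l l' hne) t t'
  surjective := rightMap_surjective f012 f014 f023 f034 f124 f234 hE hℱ

end Assembly

end StrictTwoCategory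

open StrictTwoCategory in
theorem lemma3p1 {F : Type x} [Field F] [CharZero F]
    (C : StrictTwoCategory.{u, v, w}) [SemistrictMonoidal C] [DualData C] [HasDuals C]
    [Pivotal C] [ConsistentPivotal C] [Spherical C]
    [∀ A B : C.Obj, Preadditive (C.Hom A B)] [∀ A B : C.Obj, Linear F (C.Hom A B)]
    [VectLinear F C] [ScalarUnit F C] [Nondegenerate F C]
    (E : Finset C.Obj) (hE : IsObjectBasis F E)
    (ℱ : ∀ A B : C.Obj, Finset (C.Hom A B)) (hℱ : ∀ A B : C.Obj, IsTwoBasis F (ℱ A B))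
    {e01 e02 e03 e04 e12 e14 e23 e24 e34 : C.Obj}
    (he01 : e01 ∈ E) (he02 : e02 ∈ E) (he03 : e03 ∈ E) (he04 : e04 ∈ E) (he12 : e12 ∈ E)
    (he14 : e14 ∈ E) (he23 : e23 ∈ E) (he24 : e24 ∈ E) (he34 : e34 ∈ E)
    (f012 : ℱ e02 (e12 ⊗ₒ e01)) (f014 : ℱ e04 (e14 ⊗ₒ e01)) (f023 : ℱ e03 (e23 ⊗ₒ e02))
    (f034 : ℱ e04 (e34 ⊗ₒ e03)) (f124 : ℱ e14 (e24 ⊗ₒ e12)) (f234 : ℱ e24 (e34 ⊗ₒ e23)) :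
    Function.Bijective (leftMap F ℱ f012.1 f014.1 f023.1 f034.1 f124.1 f234.1) ∧
    Function.Bijective (rightMap F E ℱ f012.1 f014.1 f023.1 f034.1 f124.1 f234.1) ∧
    rightMap F E ℱ f012.1 f014.1 f023.1 f034.1 f124.1 f234.1 ∘ₗ
        Phi F E ℱ f012.1 f014.1 f023.1 f034.1 f124.1 f234.1 =
      leftMap F ℱ f012.1 f014.1 f023.1 f034.1 f124.1 f234.1 ∧
    PhiInv F E ℱ f012.1 f014.1 f023.1 f034.1 f124.1 f234.1 ∘ₗ
        Phi F E ℱ f012.1 f014.1 f023.1 f034.1 f124.1 f234.1 = LinearMap.id ∧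
    Phi F E ℱ f012.1 f014.1 f023.1 f034.1 f124.1 f234.1 ∘ₗ
        PhiInv F E ℱ f012.1 f014.1 f023.1 f034.1 f124.1 f234.1 = LinearMap.id := by

  classical
  have hL := isOrthogonalPair_compTwo (F := F) hℱ f012.1 f014.1 f023.1 f034.1 f124.1 f234.1
  have hR := isOrthogonalPair_compThree hE hℱ f012.1 f014.1 f023.1 f034.1 f124.1 f234.1
  have h := hL.crossing hR
    (fun f024 l => Zplus F f012.1 l.2.1.1 f014.1 f023.1 f024.1 f034.1 l.2.2.1.1 f124.1 l.2.2.2.1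
      f234.1)
    (fun l f024 => Zminus F f012.1 l.2.1.1 f014.1 f023.1 f024.1 f034.1 l.2.2.1.1 f124.1 l.2.2.2.1
      f234.1)
    (fun f024 l t s => congrArg (· s) (pairThree_Zplus F f012.1 l.2.1.1 f014.1 f023.1 f024.1
      f034.1 l.2.2.1.1 f124.1 l.2.2.2.1 f234.1 t))
    (fun l f024 s t => (congrArg (· t) (pairTwo_Zminus F f012.1 l.2.1.1 f014.1 f023.1 f024.1
      f034.1 l.2.2.1.1 f124.1 l.2.2.2.1 f234.1 s)).trans (pairing_symm F _ _ _ _))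
  -- `leftMap`, `rightMap`, `Phi` and `PhiInv` unfold to the maps of the abstract statement, with
  -- the coefficients of `Phi` and `PhiInv` as the constants of the two decompositions.
  exact h
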